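/- **Setting.** For each sample size $n$ let $p_n\in\mathbb N$, let $X_n$ be a real $n\times p_n$ design matrix and $A_{p_n}$ a real symmetric $p_n\times p_n$ matrix. A model is a subset $k\subseteq\{1,\dots,p_n\}$ of size $|k|$; $X_k$ denotes the columns of $X_n$ indexed by $k$, $A_k$ the principal submatrix of $A_{p_n}$ indexed by $k$, and $\beta_k\in\mathbb R^{k}$. Fix an integer $r\ge 1$ and $\alpha_1,\alpha_2>0$. Given a prior probability distribution $\pi_n$ on the models, consider the hierarchical model $$Y_n\mid\beta_k,\sigma^2,k\sim N(X_k\beta_k,\sigma^2I_n),$$ $$\pi(\beta_k\mid\tau,\sigma^2,k)=d_k(2\pi)^{-|k|/2}(\tau\sigma^2)^{-r|k|-|k|/2}\,(\det A_k)^{1/2}\exp\Big(-\frac{\beta_k^TA_k\beta_k}{2\tau\sigma^2}\Big)\prod_{i\in k}\beta_i^{2r},$$ $$\tau\sim\text{Inverse-Gamma}(1/2,\,n/2),\qquad \sigma^2\sim\text{Inverse-Gamma}(\alpha_1,\alpha_2),$$ where $d_k$ is the normalizing constant (independent of $\tau,\sigma^2$). Let $m_k(y)$ be the marginal density of the data under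 model $k$, obtained by integrating out $\beta_k,\sigma^2,\tau$, and $\pi(k\mid y)=\pi_n(k)m_k(y)/\sum_j\pi_n(j)m_j(y)$ the posterior probability of $k$. The data are generated as $y_n=X_n\beta_0+\epsilon_n$, where the entries of $\epsilon_n$ are i.i.d. $N(0,\sigma_0^2)$ with $\sigma_0^2>0$ fixed, and $\beta_0$ has the fixed finite support $t$ (the true model, contained in $\{1,\dots,p_n\}$ for all large $n$) with fixed nonzero entries on $t$. **Assumptions** (for all large $n$). 1. There are $0<\varepsilon_n<1$ with $\varepsilon_n^{-1}=O((\log n)^{1/8})$ such that for every model $k\subseteq\{1,\dots,p_n\}$ the $\min(n,|k|)$ largest eigenvalues of $X_k^TX_k/n$, counted with multiplicity, lie in $[\varepsilon_n,\varepsilon_n^{-1}]$ (so $X_k$ has rank $\min(n,|k|)$, and these are all its nonzero eigenvalues). 2. $\pi_n(k)=0$ whenever $|k|>q_n$, where $q_n=O(n^{\xi})$ for some $\xi<1$. 3. There is a constant $\omega>0$, not depending on $n$, with $\pi_n(t)/\pi_n(k)>\omega$ for every $k$ with $\pi_n(k)>0$. 4. All eigenvalues of $A_{p_n}$ lie in $(a_1,a_2)$,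 where $0<a_1<a_2<\infty$ do not depend on $n$. No further condition on $p_n$ is imposed. **Theorem.** As $n\to\infty$, $$\max_{k\ne t}\frac{\pi(k\mid y_n)}{\pi(t\mid y_n)}\longrightarrow 0\quad\text{in probability},$$ and the posterior mode is the true model with probability tending to one: $$P\big(t=\operatorname{argmax}_k\pi(k\mid y_n)\big)=P\big(\pi(k\mid y_n)<\pi(t\mid y_n)\text{ for all }k\ne t\big)\longrightarrow 1 .$$ -/

import Mathlib

open MeasureTheory ProbabilityTheory Filter Topology Asymptotics
open scoped ENNReal NNReal Matrix

noncomputable section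

namespace HyperPMOM

/-- A model on `p` covariates: the set of indices of the nonzero regression coefficients. -/
abbrev Model (p : ℕ) : Type := Finset (Fin p)

/-- `X_k`: the columns of the design matrix belonging to the model `k`. -/
def designSub {n p : ℕ} (X : Matrix (Fin n) (Fin p) ℝ) (k : Model p) : Matrix (Fin n) k ℝ :=
  X.submatrix id Subtype.val

/-- `A_k`: the `k × k` principal submatrix of `A` belonging to the model `k`. -/
def prinSub {p : ℕ} (A : Matrix (Fin p) (Fin p) ℝ) (k : Model p) : Matrix k k ℝ :=
  A.submatrix Subtype.val Subtype.val

/-- The Gram matrix `X_kᵀ X_k / n`. -/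
def gram {n p : ℕ} (X : Matrix (Fin n) (Fin p) ℝ) (k : Model p) : Matrix k k ℝ :=
  (n : ℝ)⁻¹ • ((designSub X k)ᵀ * designSub X k)

theorem gram_isHermitian {n p : ℕ} (X : Matrix (Fin n) (Fin p) ℝ) (k : Model p) :
    (gram X k).IsHermitian := by
  unfold gram
  have h : ((designSub X k)ᵀ * designSub X k).IsHermitian := by
    have := Matrix.isHermitian_conjTranspose_mul_self (designSub X k)
    rwa [Matrix.conjTranspose_eq_transpose_of_trivial] at this
  unfold Matrix.IsHermitian at h ⊢
  rw [Matrix.conjTranspose_smul, h]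
  simp

/-- The density of `N(X_k β_k, v I_n)` at `y`, where `v` is the variance `σ²`. -/
def likelihood {n p : ℕ} (X : Matrix (Fin n) (Fin p) ℝ) (k : Model p)
    (b : k → ℝ) (v : ℝ) (y : Fin n → ℝ) : ℝ :=
  (2 * Real.pi * v) ^ (-(n : ℝ) / 2) *
    Real.exp (-(∑ i, (y i - (designSub X k *ᵥ b) i) ^ 2) / (2 * v))

/-- The pMOM density of order `r` on `ℝ^k` without its normalizing constant, at scale
`s = τ σ²`. -/
def pMOMKernel {p : ℕ} (r : ℕ) (A : Matrix (Fin p) (Fin p) ℝ) (k : Model p)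
    (s : ℝ) (b : k → ℝ) : ℝ :=
  (2 * Real.pi) ^ (-(k.card : ℝ) / 2) * s ^ (-(r : ℝ) * k.card - (k.card : ℝ) / 2) *
    (prinSub A k).det ^ (1 / 2 : ℝ) *
    Real.exp (-(b ⬝ᵥ (prinSub A k *ᵥ b)) / (2 * s)) * ∏ i, b i ^ (2 * r)

/-- The normalizing constant `d_k` of the pMOM density. The integral of `pMOMKernel` does not
depend on the scale `s > 0` (substitute `b = √s b'`), so it is taken at `s = 1`. -/
def normConst {p : ℕ} (r : ℕ) (A : Matrix (Fin p) (Fin p) ℝ) (k : Model p) : ℝ :=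
  (∫ b : k → ℝ, pMOMKernel r A k 1 b)⁻¹

/-- The pMOM prior density `π(β_k | τ, σ², k)`, where `v` is `σ²`. -/
def pMOMDensity {p : ℕ} (r : ℕ) (A : Matrix (Fin p) (Fin p) ℝ) (k : Model p)
    (τ v : ℝ) (b : k → ℝ) : ℝ :=
  normConst r A k * pMOMKernel r A k (τ * v) b

/-- The density of the Inverse-Gamma distribution with shape `a` and scale `c` at `x > 0`. -/
def invGammaDensity (a c x : ℝ) : ℝ :=
  c ^ a / Real.Gamma a * x ^ (-(a + 1)) * Real.exp (-c / x)

/-- The marginal density `m_k(y)` of the data under the model `k`: the coefficients, `σ²`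
(Inverse-Gamma `(α₁, α₂)`) and `τ` (Inverse-Gamma `(1/2, n/2)`) are integrated out. -/
def marginal {n p : ℕ} (r : ℕ) (α₁ α₂ : ℝ) (X : Matrix (Fin n) (Fin p) ℝ)
    (A : Matrix (Fin p) (Fin p) ℝ) (k : Model p) (y : Fin n → ℝ) : ℝ≥0∞ :=
  ∫⁻ τ in Set.Ioi (0 : ℝ), ∫⁻ v in Set.Ioi (0 : ℝ), ∫⁻ b : k → ℝ,
    ENNReal.ofReal (likelihood X k b v y * pMOMDensity r A k τ v b *
      invGammaDensity (1 / 2) ((n : ℝ) / 2) τ * invGammaDensity α₁ α₂ v)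

/-- The posterior probability `π(k | y)`, by Bayes' rule. -/
def posterior {n p : ℕ} (r : ℕ) (α₁ α₂ : ℝ) (X : Matrix (Fin n) (Fin p) ℝ)
    (A : Matrix (Fin p) (Fin p) ℝ) (prior : PMF (Model p)) (y : Fin n → ℝ) (k : Model p) :
    ℝ≥0∞ :=
  prior k * marginal r α₁ α₂ X A k y / ∑ j, prior j * marginal r α₁ α₂ X A j y

/-- For every model `k`, the `min(n, |k|)` largest eigenvalues `ν_j` of `X_kᵀ X_k / n` lie in
`[ε, ε⁻¹]`; the remaining ones are zero because the rank is at most `min(n, |k|)`.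
(`eigenvalues₀` lists the eigenvalues in decreasing order, with multiplicity.) -/
def EigenBound {n p : ℕ} (X : Matrix (Fin n) (Fin p) ℝ) (ε : ℝ) : Prop :=
  ∀ k : Model p, ∀ j : Fin (Fintype.card k), (j : ℕ) < min n k.card →
    ε ≤ (gram_isHermitian X k).eigenvalues₀ j ∧ (gram_isHermitian X k).eigenvalues₀ j ≤ ε⁻¹

/-- `A` is symmetric with all its eigenvalues strictly between `a₁` and `a₂`. -/
def ScaleMatrixBound {p : ℕ} (A : Matrix (Fin p) (Fin p) ℝ) (a₁ a₂ : ℝ) : Prop :=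
  ∃ hA : A.IsHermitian, ∀ i, a₁ < hA.eigenvalues i ∧ hA.eigenvalues i < a₂

/-- The true model as a model on `p` covariates; covariates are numbered from `0`. -/
def trueModel (t : Finset ℕ) (p : ℕ) : Model p :=
  Finset.univ.filter fun i => (i : ℕ) ∈ t

/-- The responses `y = X β₀ + noise`. -/
def response {n p : ℕ} (X : Matrix (Fin n) (Fin p) ℝ) (β₀ : ℕ → ℝ) (noise : Fin n → ℝ) :
    Fin n → ℝ :=
  X *ᵥ (fun i : Fin p => β₀ i) + noise

/-- `max_{k ≠ t} post k / post t`, with values in `[0, ∞]` (and `0` if there is no `k ≠ t`). -/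
def maxRatio {p : ℕ} (post : Model p → ℝ≥0∞) (t : Model p) : ℝ≥0∞ :=
  ⨆ k, ⨆ _ : k ≠ t, post k / post t

/-- `t` is the unique maximizer of `post`, i.e. `t = argmax_k post k`. -/
def IsUniqueMode {p : ℕ} (post : Model p → ℝ≥0∞) (t : Model p) : Prop :=
  ∀ k, k ≠ t → post k < post t

end HyperPMOM

end

/-!
Up to constants common to all models, the marginal density of a model `k` is comparable to a power
of `n` times `B ^ (-n / 2)`, where `B` is essentially the residual sum of squares of `k`. The moment
factor `∏ β_i ^ (2 r)` is of order `n ^ (-r)` near a vanishing coefficient, and every spurious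
covariate costs at least a factor `n ^ (r + 1 / 2)`.

The eigenvalue bounds force `p ≤ n ε⁻²`, because every column of `X` has squared norm at least `n ε`
and every row at most `n ε⁻¹`. A union bound over all models then shows that, with probability
tending to one, any `s` spurious covariates lower the residual sum of squares by at most about
`(67 / 32) σ₀² s log n`. They gain at most a factor `n ^ (5 s / 4)` in this way, and
`5 / 4 < 3 / 2 ≤ r + 1 / 2`, so models that strictly contain the true one lose. A model that omits
a true covariate has a residual sum of squares larger by an amount of order `n ε`, hence loses a
factor exponential in `n ε`; this beats every power of `n` that occurs, as models have size at most
`q` and `q log n = o(n ε)`. Since the prior odds are bounded, the posterior odds follow.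
-/

noncomputable section

namespace HyperPMOM

/-! ### Quadratic forms and restricted eigenvalues -/

section QuadraticForms

open scoped MatrixOrder

variable {ι : Type*} [Fintype ι]

lemma sum_sq_eq_dotProduct (x : ι → ℝ) : ∑ i, x i ^ 2 = x ⬝ᵥ x := by
  simp only [dotProduct, sq]

variable [DecidableEq ι] {A : Matrix ι ι ℝ}

lemma mul_sum_sq_le_dotProduct_mulVec (hA : A.IsHermitian) {c : ℝ}
    (hc : ∀ i, c ≤ hA.eigenvalues i) (x : ι → ℝ) : c * ∑ i, x i ^ 2 ≤ x ⬝ᵥ (A *ᵥ x) := by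
  have hle : algebraMap ℝ (Matrix ι ι ℝ) c ≤ A := by
    refine (algebraMap_le_iff_le_spectrum hA).2 ?_
    rw [hA.spectrum_real_eq_range_eigenvalues]
    rintro _ ⟨i, rfl⟩
    exact hc i
  rw [sum_sq_eq_dotProduct]
  simpa [Matrix.sub_mulVec, Algebra.algebraMap_eq_smul_one, Matrix.smul_mulVec,
    dotProduct_sub] using (Matrix.le_iff.1 hle).dotProduct_mulVec_nonneg x

lemma dotProduct_mulVec_le_mul_sum_sq (hA : A.IsHermitian) {c : ℝ}
    (hc : ∀ i, hA.eigenvalues i ≤ c) (x : ι → ℝ) : x ⬝ᵥ (A *ᵥ x) ≤ c * ∑ i, x i ^ 2 := by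
  have hle : A ≤ algebraMap ℝ (Matrix ι ι ℝ) c := by
    refine (le_algebraMap_iff_spectrum_le hA).2 ?_
    rw [hA.spectrum_real_eq_range_eigenvalues]
    rintro _ ⟨i, rfl⟩
    exact hc i
  rw [sum_sq_eq_dotProduct]
  simpa [Matrix.sub_mulVec, Algebra.algebraMap_eq_smul_one, Matrix.smul_mulVec,
    dotProduct_sub] using (Matrix.le_iff.1 hle).dotProduct_mulVec_nonneg x

end QuadraticForms

section ExtendZero

variable {n p : ℕ}

/-- The coefficient vector on all covariates that agrees with `b` on the model `k` and vanishes
off it; it turns statements about `X_k` and `A_k` into statements about `X` and `A`. -/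
def extendZero (k : Model p) (b : k → ℝ) : Fin p → ℝ :=
  fun j => if h : j ∈ k then b ⟨j, h⟩ else 0

lemma extendZero_coe {k : Model p} (b : k → ℝ) (j : k) : extendZero k b j = b j := by
  simp [extendZero]

lemma extendZero_of_notMem {k : Model p} (b : k → ℝ) {j : Fin p} (hj : j ∉ k) :
    extendZero k b j = 0 := by
  simp [extendZero, hj]

lemma extendZero_restrict {k : Model p} {h : Fin p → ℝ} (hh : ∀ j ∉ k, h j = 0) :
    extendZero k (fun j => h j) = h := by
  funext j
  by_cases hj : j ∈ k <;> simp [extendZero, hj, hh]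

lemma sum_coe_eq_sum {k : Model p} {f : Fin p → ℝ} (hf : ∀ j ∉ k, f j = 0) :
    ∑ j : k, f j = ∑ j, f j := by
  rw [Finset.sum_coe_sort k f]
  exact Finset.sum_subset (Finset.subset_univ k) fun j _ hj => hf j hj

lemma designSub_mulVec (X : Matrix (Fin n) (Fin p) ℝ) (k : Model p) (b : k → ℝ) :
    designSub X k *ᵥ b = X *ᵥ extendZero k b := by
  funext i
  simp only [Matrix.mulVec, dotProduct]
  rw [← sum_coe_eq_sum (k := k) fun j hj => by simp [extendZero_of_notMem b hj]]
  simp [extendZero_coe, designSub]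

lemma dotProduct_prinSub_mulVec (A : Matrix (Fin p) (Fin p) ℝ) (k : Model p) (b : k → ℝ) :
    b ⬝ᵥ (prinSub A k *ᵥ b) = extendZero k b ⬝ᵥ (A *ᵥ extendZero k b) := by
  simp only [Matrix.mulVec, dotProduct]
  rw [← sum_coe_eq_sum (k := k) fun j hj => by simp [extendZero_of_notMem b hj]]
  refine Finset.sum_congr rfl fun i _ => ?_
  rw [← sum_coe_eq_sum (k := k) (f := fun j => A i j * extendZero k b j)
    fun j hj => by simp [extendZero_of_notMem b hj]]
  simp [extendZero_coe, prinSub]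

lemma sum_extendZero_sub_sq (k : Model p) (b : k → ℝ) (β : Fin p → ℝ) :
    ∑ j, (extendZero k b j - β j) ^ 2 = ∑ i : k, (b i - β i) ^ 2 + ∑ j ∈ kᶜ, β j ^ 2 := by
  rw [← Finset.sum_add_sum_compl k, ← Finset.sum_coe_sort k]
  congr 1
  · simp [extendZero_coe]
  · refine Finset.sum_congr rfl fun j hj => ?_
    rw [extendZero_of_notMem b (by simpa using hj), zero_sub, neg_sq]

lemma sum_extendZero_sq (k : Model p) (b : k → ℝ) :
    ∑ j, extendZero k b j ^ 2 = ∑ j, b j ^ 2 := by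
  simpa using sum_extendZero_sub_sq k b 0

end ExtendZero

namespace ScaleMatrixBound

variable {p : ℕ} {A : Matrix (Fin p) (Fin p) ℝ} {a₁ a₂ : ℝ}

lemma mul_sum_sq_le (hA : ScaleMatrixBound A a₁ a₂) (k : Model p) (b : k → ℝ) :
    a₁ * ∑ i, b i ^ 2 ≤ b ⬝ᵥ (prinSub A k *ᵥ b) := by
  obtain ⟨hA, h⟩ := hA
  rw [dotProduct_prinSub_mulVec, ← sum_extendZero_sq]
  exact mul_sum_sq_le_dotProduct_mulVec hA (fun i => (h i).1.le) _

lemma le_mul_sum_sq (hA : ScaleMatrixBound A a₁ a₂) (k : Model p) (b : k → ℝ) :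
    b ⬝ᵥ (prinSub A k *ᵥ b) ≤ a₂ * ∑ i, b i ^ 2 := by
  obtain ⟨hA, h⟩ := hA
  rw [dotProduct_prinSub_mulVec, ← sum_extendZero_sq]
  exact dotProduct_mulVec_le_mul_sum_sq hA (fun i => (h i).2.le) _

lemma det_prinSub_pos (hA : ScaleMatrixBound A a₁ a₂) (ha₁ : 0 < a₁) (k : Model p) :
    0 < (prinSub A k).det := by
  obtain ⟨hA, h⟩ := hA
  have hpd : A.PosDef := hA.posDef_iff_eigenvalues_pos.2 fun i => ha₁.trans (h i).1
  exact (hpd.submatrix Subtype.val_injective).det_pos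

lemma mono (hA : ScaleMatrixBound A a₁ a₂) {a : ℝ} (ha : a₂ ≤ a) : ScaleMatrixBound A a₁ a :=
  hA.imp fun _ h i => ⟨(h i).1, (h i).2.trans_le ha⟩

end ScaleMatrixBound

lemma sum_mulVec_extendZero_sq {n p : ℕ} (hn : n ≠ 0) (X : Matrix (Fin n) (Fin p) ℝ)
    (k : Model p) (b : k → ℝ) :
    ∑ i, (X *ᵥ extendZero k b) i ^ 2 = n * (b ⬝ᵥ (gram X k *ᵥ b)) := by
  rw [gram, Matrix.smul_mulVec, dotProduct_smul, smul_eq_mul,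
    mul_inv_cancel_left₀ (Nat.cast_ne_zero.2 hn), ← Matrix.mulVec_mulVec,
    Matrix.dotProduct_mulVec, Matrix.vecMul_transpose, designSub_mulVec]
  simp [dotProduct, sq]

namespace EigenBound

variable {n p : ℕ} {X : Matrix (Fin n) (Fin p) ℝ} {ε : ℝ}

lemma sum_mulVec_sq_le (hX : EigenBound X ε) (hn : n ≠ 0) (h : Fin p → ℝ) :
    ∑ i, (X *ᵥ h) i ^ 2 ≤ n * ε⁻¹ * ∑ j, h j ^ 2 := by
  rw [← extendZero_restrict (k := Finset.univ) (h := h) (by simp), sum_mulVec_extendZero_sq hn,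
    sum_extendZero_sq, mul_assoc]
  gcongr
  refine dotProduct_mulVec_le_mul_sum_sq (gram_isHermitian X _) (fun i => ?_) _
  have hpos : 0 < Fintype.card (Finset.univ : Model p) := Fintype.card_pos_iff.2 ⟨i⟩
  refine ((gram_isHermitian X _).eigenvalues₀_antitone (Nat.zero_le _)).trans
    (hX Finset.univ ⟨0, hpos⟩ ?_).2
  rw [Fintype.card_coe] at hpos
  exact lt_min (Nat.pos_of_ne_zero hn) hpos

lemma le_sum_mulVec_sq (hX : EigenBound X ε) (hn : n ≠ 0) {u : Model p} (hu : u.card ≤ n)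
    {h : Fin p → ℝ} (hh : ∀ j ∉ u, h j = 0) :
    n * ε * ∑ j, h j ^ 2 ≤ ∑ i, (X *ᵥ h) i ^ 2 := by
  rw [← extendZero_restrict hh, sum_mulVec_extendZero_sq hn, sum_extendZero_sq, mul_assoc]
  gcongr
  refine mul_sum_sq_le_dotProduct_mulVec (gram_isHermitian X u) (fun i => ?_) _
  refine (hX u ((Fintype.equivOfCardEq (Fintype.card_fin _)).symm i) ?_).1
  rw [min_eq_right hu]
  exact (Fin.is_lt _).trans_eq (Fintype.card_coe u)

lemma le_sum_col_sq (hX : EigenBound X ε) (hn : n ≠ 0) (j : Fin p) :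
    n * ε ≤ ∑ i, X i j ^ 2 := by
  have h := hX.le_sum_mulVec_sq hn (u := {j}) (by simpa using Nat.one_le_iff_ne_zero.2 hn)
    (h := Pi.single j 1) fun l hl => Pi.single_eq_of_ne (by simpa using hl) _
  simpa [Matrix.mulVec_single, Pi.single_apply, ite_pow] using h

lemma sum_row_sq_le (hX : EigenBound X ε) (hn : n ≠ 0) (hε : 0 < ε) (i : Fin n) :
    ∑ j, X i j ^ 2 ≤ n * ε⁻¹ := by
  have hdiag : (X *ᵥ X i) i = ∑ j, X i j ^ 2 := by simp [Matrix.mulVec, dotProduct, sq]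
  have hsq : (∑ j, X i j ^ 2) ^ 2 ≤ n * ε⁻¹ * ∑ j, X i j ^ 2 :=
    calc (∑ j, X i j ^ 2) ^ 2 ≤ ∑ l, (X *ᵥ X i) l ^ 2 := by
          rw [← hdiag]
          exact Finset.single_le_sum (f := fun l => (X *ᵥ X i) l ^ 2) (fun _ _ => sq_nonneg _)
            (Finset.mem_univ i)
      _ ≤ _ := hX.sum_mulVec_sq_le hn (X i)
  rcases (Finset.sum_nonneg fun j _ => sq_nonneg (X i j)).eq_or_lt with h0 | h0
  · rw [← h0]
    positivity
  · rw [sq] at hsq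
    exact le_of_mul_le_mul_right hsq h0

lemma card_le (hX : EigenBound X ε) (hn : n ≠ 0) (hε : 0 < ε) : (p : ℝ) ≤ n * ε⁻¹ ^ 2 := by
  have hcount : (p : ℝ) * (n * ε) ≤ n * (n * ε⁻¹) :=
    calc (p : ℝ) * (n * ε) = ∑ _j : Fin p, n * ε := by simp
      _ ≤ ∑ j, ∑ i, X i j ^ 2 := Finset.sum_le_sum fun j _ => hX.le_sum_col_sq hn j
      _ = ∑ i, ∑ j, X i j ^ 2 := Finset.sum_comm
      _ ≤ ∑ _i : Fin n, n * ε⁻¹ := Finset.sum_le_sum fun i _ => hX.sum_row_sq_le hn hε i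
      _ = n * (n * ε⁻¹) := by simp
  refine le_of_mul_le_mul_right (hcount.trans_eq ?_) (a := n * ε) (by positivity)
  field_simp

end EigenBound

/-! ### Gaussian noise and its projections -/

lemma lintegral_pi_prod {ι : Type*} [Fintype ι] {α : ι → Type*} [∀ i, MeasurableSpace (α i)]
    (μ : ∀ i, Measure (α i)) [∀ i, IsProbabilityMeasure (μ i)] {f : ∀ i, α i → ℝ≥0∞}
    (hf : ∀ i, Measurable (f i)) :
    ∫⁻ x, ∏ i, f i (x i) ∂Measure.pi μ = ∏ i, ∫⁻ x, f i x ∂μ i := by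
  rw [lintegral_prod_eq_prod_lintegral_of_indepFun Finset.univ
    (fun i (x : ∀ i, α i) => f i (x i))
    (iIndepFun_pi fun i => (hf i).aemeasurable) fun i => (hf i).comp (measurable_pi_apply i)]
  exact Finset.prod_congr rfl fun i _ => (measurePreserving_eval μ i).lintegral_comp (hf i)

lemma lintegral_exp_sq_gaussianReal {θ : ℝ} (hθ : θ < 1) :
    ∫⁻ g, ENNReal.ofReal (Real.exp (θ / 2 * g ^ 2)) ∂gaussianReal 0 1 =
      ENNReal.ofReal ((1 - θ) ^ (-(1 / 2) : ℝ)) := by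
  have hpos : 0 < 1 - θ := by linarith
  have hdensity : ∀ g : ℝ,
      (gaussianPDF 0 1 * fun g => ENNReal.ofReal (Real.exp (θ / 2 * g ^ 2))) g =
        ENNReal.ofReal ((√(2 * Real.pi))⁻¹ * Real.exp (-((1 - θ) / 2) * g ^ 2)) := fun g => by
    simp only [Pi.mul_apply, gaussianPDF]
    rw [← ENNReal.ofReal_mul (gaussianPDFReal_nonneg _ _ _), gaussianPDFReal_def]
    simp only [NNReal.coe_one, mul_one, sub_zero, mul_assoc, ← Real.exp_add]
    congr 3
    ring
  rw [gaussianReal_of_var_ne_zero _ one_ne_zero,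
    lintegral_withDensity_eq_lintegral_mul _ (measurable_gaussianPDF _ _) (by fun_prop)]
  simp_rw [hdensity]
  rw [← ofReal_integral_eq_lintegral_ofReal
    ((integrable_exp_neg_mul_sq (by positivity)).const_mul _)
    (ae_of_all _ fun _ => by positivity), integral_const_mul, integral_gaussian,
    Real.rpow_neg hpos.le, ← Real.sqrt_eq_rpow, ← Real.sqrt_inv, ← Real.sqrt_inv,
    ← Real.sqrt_mul (by positivity)]
  have := Real.pi_pos
  congr 2
  field_simp

section StdGaussian

variable {E : Type*} [NormedAddCommGroup E] [InnerProductSpace ℝ E] [FiniteDimensional ℝ E]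
  [MeasurableSpace E] [BorelSpace E]

lemma lintegral_exp_norm_sq_stdGaussian {θ : ℝ} (hθ : θ < 1) :
    ∫⁻ z, ENNReal.ofReal (Real.exp (θ / 2 * ‖z‖ ^ 2)) ∂stdGaussian E =
      ENNReal.ofReal ((1 - θ) ^ (-(1 / 2) : ℝ)) ^ Module.finrank ℝ E := by
  have hnorm : ∀ x : Fin (Module.finrank ℝ E) → ℝ,
      ‖∑ i, x i • stdOrthonormalBasis ℝ E i‖ ^ 2 = ∑ i, x i ^ 2 := fun x => by
    rw [← (stdOrthonormalBasis ℝ E).sum_sq_norm_inner_right]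
    simp [inner_sum, inner_smul_right, orthonormal_iff_ite.1 (stdOrthonormalBasis ℝ E).orthonormal]
  rw [stdGaussian, lintegral_map (by fun_prop) (by fun_prop)]
  simp_rw [hnorm, Finset.mul_sum, Real.exp_sum,
    ENNReal.ofReal_prod_of_nonneg fun _ _ => (Real.exp_pos _).le]
  rw [lintegral_pi_prod (f := fun _ g => ENNReal.ofReal (Real.exp (θ / 2 * g ^ 2))) _
    fun _ => by fun_prop, lintegral_exp_sq_gaussianReal hθ]
  simp

/-- Both tails of the chi-square distribution at once: `θ > 0` gives the upper one and `θ < 0`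
the lower one. -/
lemma stdGaussian_mul_le_mul_norm_sq_le {θ : ℝ} (hθ : θ < 1) (x : ℝ) :
    stdGaussian E {z | θ * x ≤ θ / 2 * ‖z‖ ^ 2} ≤ ENNReal.ofReal
      (((1 - θ) ^ (-(1 / 2) : ℝ)) ^ Module.finrank ℝ E * Real.exp (-(θ * x))) := by
  have hnonneg : (0 : ℝ) ≤ (1 - θ) ^ (-(1 / 2) : ℝ) := Real.rpow_nonneg (by linarith) _
  calc stdGaussian E {z | θ * x ≤ θ / 2 * ‖z‖ ^ 2}
      ≤ stdGaussian E {z | ENNReal.ofReal (Real.exp (θ * x)) ≤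
          ENNReal.ofReal (Real.exp (θ / 2 * ‖z‖ ^ 2))} :=
        measure_mono fun z hz => ENNReal.ofReal_le_ofReal (Real.exp_le_exp.2 hz)
    _ ≤ (∫⁻ z, ENNReal.ofReal (Real.exp (θ / 2 * ‖z‖ ^ 2)) ∂stdGaussian E) /
          ENNReal.ofReal (Real.exp (θ * x)) :=
        meas_ge_le_lintegral_div (by fun_prop) (by simp [Real.exp_pos]) ENNReal.ofReal_ne_top
    _ = _ := by
        rw [lintegral_exp_norm_sq_stdGaussian hθ, ← ENNReal.ofReal_pow hnonneg,
          ← ENNReal.ofReal_div_of_pos (Real.exp_pos _), Real.exp_neg, div_eq_mul_inv]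

lemma stdGaussian_map_orthogonalProjectionOnto (V : Submodule ℝ E) :
    (stdGaussian E).map V.orthogonalProjectionOnto = stdGaussian V := by
  refine Measure.ext_of_charFun (funext fun w => ?_)
  have hinner : ∀ z : E, inner ℝ (V.orthogonalProjectionOnto z) w = inner ℝ z (w : E) := fun z =>
    Submodule.inner_orthogonalProjectionOnto_eq_of_mem_right w z
  rw [charFun_apply, integral_map (by fun_prop) (by fun_prop)]
  simp_rw [hinner]
  rw [← charFun_apply, charFun_stdGaussian, charFun_stdGaussian, Submodule.coe_norm]

end StdGaussian

lemma map_toLp_pi_gaussianReal (ι : Type*) [Fintype ι] (v : ℝ≥0) :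
    (Measure.pi fun _ : ι => gaussianReal 0 v).map (WithLp.toLp 2) =
      (stdGaussian (EuclideanSpace ℝ ι)).map (√(v : ℝ) • ·) := by
  have hscale : gaussianReal 0 v = (gaussianReal 0 1).map (√(v : ℝ) * ·) := by
    rw [gaussianReal_map_const_mul]
    congr 1
    · simp
    · ext; simp
  rw [hscale, ← Measure.pi_map_pi fun _ => by fun_prop, ← map_pi_eq_stdGaussian,
    Measure.map_map (by fun_prop) (by fun_prop), Measure.map_map (by fun_prop) (by fun_prop)]
  rfl

section Noise

variable {ι : Type*} [Fintype ι] {v : ℝ≥0}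

lemma noise_mul_le_mul_norm_starProjection_sq_le (hv : 0 < v)
    (V : Submodule ℝ (EuclideanSpace ℝ ι)) {θ : ℝ} (hθ : θ < 1) (x : ℝ) :
    (Measure.pi fun _ : ι => gaussianReal 0 v)
        {e | θ * x * v ≤ θ / 2 * ‖V.starProjection (WithLp.toLp 2 e)‖ ^ 2} ≤
      ENNReal.ofReal
        (((1 - θ) ^ (-(1 / 2) : ℝ)) ^ Module.finrank ℝ V * Real.exp (-(θ * x))) := by
  have hv' : (0 : ℝ) < v := hv
  have hpre : ∀ z : EuclideanSpace ℝ ι,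
      θ * x * v ≤ θ / 2 * ‖V.starProjection (√(v : ℝ) • z)‖ ^ 2 ↔
        θ * x ≤ θ / 2 * ‖V.orthogonalProjectionOnto z‖ ^ 2 := fun z => by
    rw [map_smul, norm_smul, mul_pow, Real.norm_eq_abs, sq_abs, Real.sq_sqrt hv'.le,
      Submodule.starProjection_apply, ← Submodule.coe_norm, mul_left_comm, mul_comm _ (v : ℝ),
      mul_le_mul_iff_right₀ hv']
  have hmeas : MeasurableSet {z : EuclideanSpace ℝ ι |
      θ * x * v ≤ θ / 2 * ‖V.starProjection z‖ ^ 2} :=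
    measurableSet_le (by fun_prop) (by fun_prop)
  calc _ = (Measure.pi fun _ : ι => gaussianReal 0 v).map (WithLp.toLp 2)
          {z | θ * x * v ≤ θ / 2 * ‖V.starProjection z‖ ^ 2} :=
        (Measure.map_apply (by fun_prop) hmeas).symm
    _ = stdGaussian (EuclideanSpace ℝ ι)
          (V.orthogonalProjectionOnto ⁻¹' {w | θ * x ≤ θ / 2 * ‖w‖ ^ 2}) := by
        rw [map_toLp_pi_gaussianReal, Measure.map_apply (by fun_prop) hmeas]
        exact congrArg _ (Set.ext hpre)
    _ = stdGaussian V {w | θ * x ≤ θ / 2 * ‖w‖ ^ 2} := by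
        rw [← stdGaussian_map_orthogonalProjectionOnto V, Measure.map_apply (by fun_prop)
          (measurableSet_le (by fun_prop) (by fun_prop))]
    _ ≤ _ := stdGaussian_mul_le_mul_norm_sq_le hθ x

lemma noise_le_norm_starProjection_sq_le (hv : 0 < v)
    (V : Submodule ℝ (EuclideanSpace ℝ ι)) {d : ℕ} (hd : Module.finrank ℝ V ≤ d) (x : ℝ) :
    (Measure.pi fun _ : ι => gaussianReal 0 v)
        {e | 2 * v * x ≤ ‖V.starProjection (WithLp.toLp 2 e)‖ ^ 2} ≤
      ENNReal.ofReal (8 ^ d * Real.exp (-(63 / 64 * x))) := by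
  have hmgf : (1 - 63 / 64 : ℝ) ^ (-(1 / 2) : ℝ) = 8 := by
    rw [show (1 - 63 / 64 : ℝ) = (8 : ℝ) ^ (-2 : ℝ) by
      rw [Real.rpow_neg (by norm_num)]; norm_num, ← Real.rpow_mul (by norm_num)]
    norm_num
  have htail := noise_mul_le_mul_norm_starProjection_sq_le hv V (θ := 63 / 64) (by norm_num) x
  rw [hmgf] at htail
  refine (measure_mono fun e he => ?_).trans (htail.trans (ENNReal.ofReal_le_ofReal ?_))
  · simp only [Set.mem_ofPred_eq] at he ⊢
    linarith
  · gcongr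
    norm_num

lemma noise_mul_le_mul_sum_sq_le (hv : 0 < v) {θ : ℝ} (hθ : θ < 1) (x : ℝ) :
    (Measure.pi fun _ : ι => gaussianReal 0 v) {e | θ * x * v ≤ θ / 2 * ∑ i, e i ^ 2} ≤
      ENNReal.ofReal
        (((1 - θ) ^ (-(1 / 2) : ℝ)) ^ Fintype.card ι * Real.exp (-(θ * x))) := by
  have hnorm : ∀ e : ι → ℝ, ∑ i, e i ^ 2 =
      ‖(⊤ : Submodule ℝ (EuclideanSpace ℝ ι)).starProjection (WithLp.toLp 2 e)‖ ^ 2 := fun e => by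
    rw [Submodule.starProjection_eq_self_iff.2 Submodule.mem_top, EuclideanSpace.real_norm_sq_eq]
  simpa [hnorm] using
    noise_mul_le_mul_norm_starProjection_sq_le hv (⊤ : Submodule ℝ (EuclideanSpace ℝ ι)) hθ x

end Noise

section NoiseSize

variable {ι : Type*} [Fintype ι] {v : ℝ≥0}

lemma noise_two_mul_card_mul_le_sum_sq_le (hv : 0 < v) :
    (Measure.pi fun _ : ι => gaussianReal 0 v)
        {e | 2 * Fintype.card ι * v ≤ ∑ i, e i ^ 2} ≤
      ENNReal.ofReal (Real.exp (-(Fintype.card ι / 8))) := by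
  have htail := noise_mul_le_mul_sum_sq_le (ι := ι) hv (θ := 1 / 2) (by norm_num) (Fintype.card ι)
  refine (measure_mono fun e he => ?_).trans (htail.trans (ENNReal.ofReal_le_ofReal ?_))
  · simp only [Set.mem_ofPred_eq] at he ⊢
    linarith
  · have hlog : Real.log (1 - 1 / 2) = -Real.log 2 := by
      rw [← Real.log_inv]
      norm_num
    rw [Real.rpow_def_of_pos (by norm_num), ← Real.exp_nat_mul, ← Real.exp_add, hlog]
    refine Real.exp_le_exp.2 ?_
    have : (Fintype.card ι : ℝ) * Real.log 2 ≤ Fintype.card ι * 0.7 := by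
      gcongr
      linarith [Real.log_two_lt_d9]
    linarith

lemma noise_sum_sq_le_le (hv : 0 < v) :
    (Measure.pi fun _ : ι => gaussianReal 0 v)
        {e | ∑ i, e i ^ 2 ≤ Fintype.card ι * v * (127 / 128)} ≤
      ENNReal.ofReal (Real.exp (-(Fintype.card ι / 100000))) := by
  have htail := noise_mul_le_mul_sum_sq_le (ι := ι) hv (θ := -(1 / 256)) (by norm_num)
    (Fintype.card ι * (127 / 256))
  refine (measure_mono fun e he => ?_).trans (htail.trans (ENNReal.ofReal_le_ofReal ?_))
  · simp only [Set.mem_ofPred_eq] at he ⊢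
    linarith
  · have hlog : 2 / 513 ≤ Real.log (1 - -(1 / 256)) := by
      have := Real.le_log_one_add_of_nonneg (x := 1 / 256) (by norm_num)
      norm_num at this ⊢
      exact this
    rw [Real.rpow_def_of_pos (by norm_num), ← Real.exp_nat_mul, ← Real.exp_add]
    refine Real.exp_le_exp.2 ?_
    have := mul_le_mul_of_nonneg_left hlog (Nat.cast_nonneg (α := ℝ) (Fintype.card ι))
    linarith

end NoiseSize

lemma inner_sq_le_of_sub_starProjection_mem {E : Type*} [NormedAddCommGroup E]
    [InnerProductSpace ℝ E] (V U : Submodule ℝ E) [V.HasOrthogonalProjection]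
    [U.HasOrthogonalProjection] (e : E) {z : E} (hz : z - V.starProjection z ∈ U) :
    inner ℝ e z ^ 2 ≤ (‖V.starProjection e‖ ^ 2 + ‖U.starProjection e‖ ^ 2) * ‖z‖ ^ 2 := by
  have habs : ∀ (W : Submodule ℝ E) [W.HasOrthogonalProjection], ∀ w ∈ W,
      |inner ℝ e w| ≤ ‖W.starProjection e‖ * ‖w‖ := fun W _ w hw => by
    rw [← Submodule.starProjection_eq_self_iff.2 hw,
      ← Submodule.inner_starProjection_left_eq_right, Submodule.starProjection_eq_self_iff.2 hw]
    exact abs_real_inner_le_norm _ _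
  have hsplit : inner ℝ e z =
      inner ℝ e (V.starProjection z) + inner ℝ e (z - V.starProjection z) := by
    rw [← inner_add_right, add_sub_cancel]
  have hpyth : ‖z‖ ^ 2 = ‖V.starProjection z‖ ^ 2 + ‖z - V.starProjection z‖ ^ 2 := by
    rw [Submodule.norm_sq_eq_add_norm_sq_starProjection z V,
      Submodule.starProjection_orthogonal_val]
  have hle : |inner ℝ e z| ≤ ‖V.starProjection e‖ * ‖V.starProjection z‖ +
      ‖U.starProjection e‖ * ‖z - V.starProjection z‖ := by
    rw [hsplit]
    exact (abs_add_le _ _).trans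
      (add_le_add (habs V _ (Submodule.starProjection_apply_mem V z)) (habs U _ hz))
  rw [hpyth, ← sq_abs]
  refine (pow_le_pow_left₀ (abs_nonneg _) hle 2).trans ?_
  linarith [sq_nonneg (‖V.starProjection e‖ * ‖z - V.starProjection z‖ -
    ‖U.starProjection e‖ * ‖V.starProjection z‖)]

section ColumnSpan

variable {n p : ℕ}

/-- The `j`-th column of the design matrix, as a Euclidean vector. -/
def column (X : Matrix (Fin n) (Fin p) ℝ) (j : Fin p) : EuclideanSpace ℝ (Fin n) :=
  WithLp.toLp 2 fun i => X i j

/-- The column space of the model `t`. -/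
def columnSpan (X : Matrix (Fin n) (Fin p) ℝ) (t : Model p) :
    Submodule ℝ (EuclideanSpace ℝ (Fin n)) :=
  Submodule.span ℝ (Set.range fun j : t => column X j)

/-- The space spanned by the columns in `s` after projecting out the columns in `t`. Its dimension
is at most `|s|`, while the column space of `t ∪ s` needs `|t| + |s|`: this is what keeps the
fluctuations attributed to the covariates outside the true model proportional to their number. -/
def residualSpan (X : Matrix (Fin n) (Fin p) ℝ) (t s : Model p) :
    Submodule ℝ (EuclideanSpace ℝ (Fin n)) :=
  Submodule.span ℝ (Set.range fun j : s =>
    column X j - (columnSpan X t).starProjection (column X j))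

variable (X : Matrix (Fin n) (Fin p) ℝ) (t s : Model p)

lemma finrank_columnSpan_le : Module.finrank ℝ (columnSpan X t) ≤ t.card :=
  (finrank_range_le_card _).trans_eq (Fintype.card_coe t)

lemma finrank_residualSpan_le : Module.finrank ℝ (residualSpan X t s) ≤ s.card :=
  (finrank_range_le_card _).trans_eq (Fintype.card_coe s)

lemma toLp_mulVec (h : Fin p → ℝ) :
    (WithLp.toLp 2 (X *ᵥ h) : EuclideanSpace ℝ (Fin n)) = ∑ j, h j • column X j := by
  ext i
  simp [Matrix.mulVec, dotProduct, column, mul_comm]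

variable {t s}

lemma sub_starProjection_mulVec_mem_residualSpan {h : Fin p → ℝ}
    (hh : ∀ j, j ∉ t → j ∉ s → h j = 0) :
    (WithLp.toLp 2 (X *ᵥ h) : EuclideanSpace ℝ (Fin n)) -
      (columnSpan X t).starProjection (WithLp.toLp 2 (X *ᵥ h)) ∈ residualSpan X t s := by
  rw [toLp_mulVec, map_sum, ← Finset.sum_sub_distrib]
  refine Submodule.sum_mem _ fun j _ => ?_
  rw [map_smul, ← smul_sub]
  by_cases hjs : j ∈ s
  · exact Submodule.smul_mem _ _ (Submodule.subset_span ⟨⟨j, hjs⟩, rfl⟩)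
  by_cases hjt : j ∈ t
  · have hcol : column X j ∈ columnSpan X t := Submodule.subset_span ⟨⟨j, hjt⟩, rfl⟩
    simp [Submodule.starProjection_eq_self_iff.2 hcol]
  · simp [hh j hjt hjs]

lemma sum_mul_mulVec_sq_le (e : Fin n → ℝ) {h : Fin p → ℝ}
    (hh : ∀ j, j ∉ t → j ∉ s → h j = 0) :
    (∑ i, e i * (X *ᵥ h) i) ^ 2 ≤
      (‖(columnSpan X t).starProjection (WithLp.toLp 2 e)‖ ^ 2 +
        ‖(residualSpan X t s).starProjection (WithLp.toLp 2 e)‖ ^ 2) *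
        ∑ i, (X *ᵥ h) i ^ 2 := by
  simpa [PiLp.inner_apply, EuclideanSpace.real_norm_sq_eq, mul_comm] using
    inner_sq_le_of_sub_starProjection_mem _ _ (WithLp.toLp 2 e)
      (sub_starProjection_mulVec_mem_residualSpan X hh)

end ColumnSpan

/-- The event on which the noise is well behaved: its norm has the expected size, and its
projections onto the column space of `t` and onto the residual spans are not too large. -/
structure TameNoise {n p : ℕ} (X : Matrix (Fin n) (Fin p) ℝ) (t : Model p) (v : ℝ)
    (e : Fin n → ℝ) : Prop where
  lower : n * v * (127 / 128) ≤ ∑ i, e i ^ 2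
  upper : ∑ i, e i ^ 2 ≤ 2 * n * v
  proj : ‖(columnSpan X t).starProjection (WithLp.toLp 2 e)‖ ^ 2 ≤ v / 64 * Real.log n
  resid : ∀ s : Model p, ‖(residualSpan X t s).starProjection (WithLp.toLp 2 e)‖ ^ 2 ≤
    2 * v * (67 / 64 * (s.card * Real.log n))

lemma sum_erase_empty_pow_card_le {ι : Type*} [Fintype ι] [DecidableEq ι] {a : ℝ}
    (ha : 0 ≤ a) :
    ∑ s ∈ (Finset.univ : Finset (Finset ι)).erase ∅, a ^ s.card ≤
      Real.exp (Fintype.card ι * a) - 1 := by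
  have hbinom : ∑ s : Finset ι, a ^ s.card = (a + 1) ^ Fintype.card ι := by
    simpa using Finset.sum_pow_mul_eq_add_pow a 1 (Finset.univ : Finset ι)
  have hexp : (a + 1) ^ Fintype.card ι ≤ Real.exp (Fintype.card ι * a) := by
    rw [Real.exp_nat_mul]
    exact pow_le_pow_left₀ (by positivity) (Real.add_one_le_exp a) _
  have := Finset.add_sum_erase Finset.univ (fun s : Finset ι => a ^ s.card) (Finset.mem_univ ∅)
  simp only [Finset.card_empty, pow_zero] at this
  linarith

section TameNoise

variable {n p : ℕ} (X : Matrix (Fin n) (Fin p) ℝ) (t : Model p) {v : ℝ≥0}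

lemma noise_exists_le_norm_residualSpan_sq_le (hv : 0 < v) :
    (Measure.pi fun _ : Fin n => gaussianReal 0 v)
        (⋃ s ∈ (Finset.univ : Finset (Model p)).erase ∅,
          {e | 2 * v * (67 / 64 * (s.card * Real.log n)) ≤
            ‖(residualSpan X t s).starProjection (WithLp.toLp 2 e)‖ ^ 2}) ≤
      ENNReal.ofReal (Real.exp (p * (8 * Real.exp (-(4221 / 4096 * Real.log n)))) - 1) := by
  set a : ℝ := 8 * Real.exp (-(4221 / 4096 * Real.log n)) with ha
  refine (measure_biUnion_finset_le _ _).trans ?_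
  calc _ ≤ ∑ s ∈ (Finset.univ : Finset (Model p)).erase ∅, ENNReal.ofReal (a ^ s.card) := by
        refine Finset.sum_le_sum fun s _ => (noise_le_norm_starProjection_sq_le hv _
          (finrank_residualSpan_le X t s) _).trans_eq ?_
        rw [ha, mul_pow, ← Real.exp_nat_mul]
        congr 3
        ring
    _ = ENNReal.ofReal (∑ s ∈ (Finset.univ : Finset (Model p)).erase ∅, a ^ s.card) :=
        (ENNReal.ofReal_sum_of_nonneg fun s _ => by positivity).symm
    _ ≤ _ := by
        refine ENNReal.ofReal_le_ofReal ((sum_erase_empty_pow_card_le (by positivity)).trans_eq ?_)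
        rw [Fintype.card_fin]

lemma noise_not_tameNoise_le (hv : 0 < v) :
    (Measure.pi fun _ : Fin n => gaussianReal 0 v) {e | ¬ TameNoise X t v e} ≤
      ENNReal.ofReal (Real.exp (-(n / 100000))) + ENNReal.ofReal (Real.exp (-(n / 8))) +
      ENNReal.ofReal (8 ^ t.card * Real.exp (-(63 / 64 * (1 / 128 * Real.log n)))) +
      ENNReal.ofReal (Real.exp (p * (8 * Real.exp (-(4221 / 4096 * Real.log n)))) - 1) := by
  have hsub : {e | ¬ TameNoise X t v e} ⊆
      {e | ∑ i, e i ^ 2 ≤ n * v * (127 / 128)} ∪ {e | 2 * n * v ≤ ∑ i, e i ^ 2} ∪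
      {e | 2 * v * (1 / 128 * Real.log n) ≤
        ‖(columnSpan X t).starProjection (WithLp.toLp 2 e)‖ ^ 2} ∪
      ⋃ s ∈ (Finset.univ : Finset (Model p)).erase ∅,
        {e | 2 * v * (67 / 64 * (s.card * Real.log n)) ≤
          ‖(residualSpan X t s).starProjection (WithLp.toLp 2 e)‖ ^ 2} := fun e he => by
    by_contra hcon
    simp only [Set.mem_union, Set.mem_iUnion, Set.mem_ofPred_eq, not_or, not_exists, not_le,
      Finset.mem_erase, Finset.mem_univ, and_true] at hcon
    obtain ⟨⟨⟨hlower, hupper⟩, hproj⟩, hresid⟩ := hcon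
    refine he ⟨hlower.le, hupper.le, by linarith, fun s => ?_⟩
    rcases s.eq_empty_or_nonempty with rfl | hs
    · have hbot : residualSpan X t ∅ = ⊥ := by simp [residualSpan]
      simp [hbot]
    · exact (hresid s hs.ne_empty).le
  refine (measure_mono hsub).trans <| (measure_union_le _ _).trans <| add_le_add
    ((measure_union_le _ _).trans <| add_le_add ((measure_union_le _ _).trans <| add_le_add
      ?_ ?_) ?_) (noise_exists_le_norm_residualSpan_sq_le X t hv)
  · simpa using noise_sum_sq_le_le (ι := Fin n) hv
  · simpa using noise_two_mul_card_mul_le_sum_sq_le (ι := Fin n) hv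
  · exact noise_le_norm_starProjection_sq_le hv _ (finrank_columnSpan_le X t) _

end TameNoise

lemma tendsto_log_natCast : Tendsto (fun n : ℕ => Real.log n) atTop atTop :=
  Real.tendsto_log_atTop.comp tendsto_natCast_atTop_atTop

lemma eventually_le_mul_of_isLittleO {α : Type*} {l : Filter α} {f g : α → ℝ} (hf : f =o[l] g)
    (hg : ∀ᶠ x in l, 0 ≤ g x) {c : ℝ} (hc : 0 < c) : ∀ᶠ x in l, f x ≤ c * g x := by
  filter_upwards [hf.bound hc, hg] with x hx hgx
  rw [Real.norm_of_nonneg hgx] at hx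
  exact (Real.le_norm_self _).trans hx

lemma mem_trueModel {t : Finset ℕ} {p : ℕ} {i : Fin p} : i ∈ trueModel t p ↔ (i : ℕ) ∈ t := by
  simp [trueModel]

lemma card_trueModel_le (t : Finset ℕ) (p : ℕ) : (trueModel t p).card ≤ t.card :=
  Finset.card_le_card_of_injOn Fin.val (fun _ hi => mem_trueModel.1 hi) fun _ _ _ _ h => Fin.ext h

lemma EigenBound.card_mul_exp_neg_le {n p : ℕ} {X : Matrix (Fin n) (Fin p) ℝ} {ε : ℝ}
    (hX : EigenBound X ε) (hn : n ≠ 0) (hε : 0 < ε) (hlog : ε⁻¹ ≤ Real.log n) :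
    p * (8 * Real.exp (-(4221 / 4096 * Real.log n))) ≤
      8 * (Real.log n ^ 2 * Real.exp (-(125 / 4096 * Real.log n))) := by
  have hn' : (0 : ℝ) < n := by positivity
  have hexp : Real.exp (-(4221 / 4096 * Real.log n)) =
      (n : ℝ)⁻¹ * Real.exp (-(125 / 4096 * Real.log n)) := by
    rw [← Real.exp_log (inv_pos.2 hn'), ← Real.exp_add, Real.log_inv]
    congr 1
    ring
  calc (p : ℝ) * (8 * Real.exp (-(4221 / 4096 * Real.log n)))
      ≤ (n * ε⁻¹ ^ 2) * (8 * ((n : ℝ)⁻¹ * Real.exp (-(125 / 4096 * Real.log n)))) := by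
        rw [hexp]
        gcongr
        exact hX.card_le hn hε
    _ = 8 * (ε⁻¹ ^ 2 * Real.exp (-(125 / 4096 * Real.log n))) := by field_simp
    _ ≤ _ := by gcongr

lemma tendsto_log_sq_mul_exp_neg_mul_log {c : ℝ} (hc : 0 < c) :
    Tendsto (fun n : ℕ => Real.log n ^ 2 * Real.exp (-(c * Real.log n))) atTop (𝓝 0) := by
  have h := ((Real.tendsto_pow_mul_exp_neg_atTop_nhds_zero 2).comp
    (tendsto_log_natCast.const_mul_atTop hc)).const_mul (c⁻¹ ^ 2)
  rw [mul_zero] at h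
  refine h.congr fun n => ?_
  simp only [Function.comp_apply, mul_pow]
  field_simp

lemma tendsto_bound_not_tameNoise (T : ℕ) :
    Tendsto (fun n : ℕ =>
      ENNReal.ofReal (Real.exp (-(n / 100000))) + ENNReal.ofReal (Real.exp (-(n / 8))) +
      ENNReal.ofReal (8 ^ T * Real.exp (-(63 / 64 * (1 / 128 * Real.log n)))) +
      ENNReal.ofReal (Real.exp
        (8 * (Real.log n ^ 2 * Real.exp (-(125 / 4096 * Real.log n)))) - 1)) atTop (𝓝 0) := by
  have hexp : ∀ {f : ℕ → ℝ}, Tendsto f atTop atTop → ∀ a : ℝ,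
      Tendsto (fun n => ENNReal.ofReal (a * Real.exp (-f n))) atTop (𝓝 0) := fun hf a => by
    simpa using ENNReal.tendsto_ofReal
      ((Real.tendsto_exp_neg_atTop_nhds_zero.comp hf).const_mul a)
  have hlast := ENNReal.tendsto_ofReal (((Real.continuous_exp.tendsto _).comp
    ((tendsto_log_sq_mul_exp_neg_mul_log (c := 125 / 4096) (by norm_num)).const_mul 8)).sub_const 1)
  have hn : ∀ {c : ℝ}, 0 < c → Tendsto (fun n : ℕ => n / c) atTop atTop := fun hc =>
    tendsto_natCast_atTop_atTop.atTop_div_const hc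
  have h := (((hexp (hn (c := 100000) (by norm_num)) 1).add
    (hexp (hn (c := 8) (by norm_num)) 1)).add
    (hexp ((tendsto_log_natCast.const_mul_atTop (r := 1 / 128) (by norm_num)).const_mul_atTop
      (r := 63 / 64) (by norm_num)) (8 ^ T))).add hlast
  simpa using h

lemma tendsto_measure_not_tameNoise {Ω : Type*} [MeasurableSpace Ω] {P : Measure Ω}
    [IsProbabilityMeasure P] {p : ℕ → ℕ} {X : ∀ n, Matrix (Fin n) (Fin (p n)) ℝ} (t : Finset ℕ)
    {v : ℝ≥0} (hv : 0 < v) {noise : ∀ n, Fin n → Ω → ℝ}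
    (hlaw : ∀ n i, HasLaw (noise n i) (gaussianReal 0 v) P)
    (hindep : ∀ n, iIndepFun (noise n) P) {ε : ℕ → ℝ} (hε : ∀ᶠ n in atTop, 0 < ε n)
    (hεo : (fun n => (ε n)⁻¹) =o[atTop] fun n : ℕ => Real.log n)
    (hX : ∀ᶠ n in atTop, EigenBound (X n) (ε n)) :
    Tendsto (fun n => P {ω | ¬ TameNoise (X n) (trueModel t (p n)) v (fun i => noise n i ω)})
      atTop (𝓝 0) := by
  refine tendsto_of_tendsto_of_tendsto_of_le_of_le' tendsto_const_nhds
    (tendsto_bound_not_tameNoise t.card) (Eventually.of_forall fun _ => zero_le) ?_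
  filter_upwards [hε, hX, eventually_ne_atTop 0, eventually_le_mul_of_isLittleO hεo
    (tendsto_log_natCast.eventually_ge_atTop 0) one_pos] with n hε hX hn hlog
  have hlawn : HasLaw (fun ω i => noise n i ω) (Measure.pi fun _ : Fin n => gaussianReal 0 v) P :=
    (hindep n).hasLaw_pi (hlaw n)
  have hpush : P {ω | ¬ TameNoise (X n) (trueModel t (p n)) v (fun i => noise n i ω)} ≤
      (Measure.pi fun _ : Fin n => gaussianReal 0 v)
        {e | ¬ TameNoise (X n) (trueModel t (p n)) v e} := by
    rw [← hlawn.map_eq]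
    exact Measure.le_map_apply hlawn.aemeasurable _
  refine (hpush.trans (noise_not_tameNoise_le (X n) _ hv)).trans ?_
  gcongr _ + ENNReal.ofReal (8 ^ ?_ * _) + ENNReal.ofReal (Real.exp ?_ - 1)
  · norm_num
  · exact card_trueModel_le t (p n)
  · exact hX.card_mul_exp_neg_le hn hε (by linarith)

/-! ### The normalizing constant of the prior -/

/-- The integral `∫ x^{2r} exp(-a x²/2) dx`, whose `|k|`-th power is the normalizing integral of
the prior on `ℝ^k` for `A_k = a I`. -/
def gaussMoment (r : ℕ) (a : ℝ) : ℝ := ∫ x : ℝ, Real.exp (-(a * x ^ 2) / 2) * x ^ (2 * r)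

lemma integrable_gaussMoment (r : ℕ) {a : ℝ} (ha : 0 < a) :
    Integrable fun x : ℝ => Real.exp (-(a * x ^ 2) / 2) * x ^ (2 * r) := by
  have h := integrable_rpow_mul_exp_neg_mul_sq (half_pos ha) (s := (2 * r : ℕ))
    (neg_one_lt_zero.trans_le (Nat.cast_nonneg _))
  refine h.congr (ae_of_all _ fun x => ?_)
  simp only [Real.rpow_natCast]
  rw [mul_comm, neg_mul, div_mul_eq_mul_div, neg_div]

lemma gaussMoment_pos (r : ℕ) {a : ℝ} (ha : 0 < a) : 0 < gaussMoment r a := by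
  have hnonneg (x : ℝ) : 0 ≤ Real.exp (-(a * x ^ 2) / 2) * x ^ (2 * r) := by
    rw [pow_mul]; positivity
  rw [gaussMoment, integral_pos_iff_support_of_nonneg hnonneg (integrable_gaussMoment r ha)]
  have hsub : Set.Ioi (0 : ℝ) ⊆
      Function.support fun x : ℝ => Real.exp (-(a * x ^ 2) / 2) * x ^ (2 * r) := by
    intro x (hx : 0 < x)
    rw [Function.mem_support]
    positivity
  exact lt_of_lt_of_le (by simp) (measure_mono hsub)

lemma prod_pow_two_mul_nonneg {ι : Type*} [Fintype ι] (r : ℕ) (b : ι → ℝ) :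
    0 ≤ ∏ i, b i ^ (2 * r) :=
  Finset.prod_nonneg fun i _ => by rw [pow_mul]; positivity

lemma exp_sum_sq_mul_prod {ι : Type*} [Fintype ι] (r : ℕ) (a : ℝ) (b : ι → ℝ) :
    Real.exp (-(a * ∑ i, b i ^ 2) / 2) * ∏ i, b i ^ (2 * r) =
      ∏ i, (Real.exp (-(a * b i ^ 2) / 2) * b i ^ (2 * r)) := by
  rw [Finset.prod_mul_distrib, ← Real.exp_sum, ← Finset.sum_div, Finset.sum_neg_distrib,
    Finset.mul_sum]

lemma integrable_exp_sum_sq_mul_prod {ι : Type*} [Fintype ι] (r : ℕ) {a : ℝ} (ha : 0 < a) :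
    Integrable fun b : ι → ℝ => Real.exp (-(a * ∑ i, b i ^ 2) / 2) * ∏ i, b i ^ (2 * r) := by
  simp_rw [exp_sum_sq_mul_prod]
  exact Integrable.fintype_prod fun _ => integrable_gaussMoment r ha

lemma integral_exp_sum_sq_mul_prod {ι : Type*} [Fintype ι] (r : ℕ) (a : ℝ) :
    ∫ b : ι → ℝ, Real.exp (-(a * ∑ i, b i ^ 2) / 2) * ∏ i, b i ^ (2 * r) =
      gaussMoment r a ^ Fintype.card ι := by
  simp_rw [exp_sum_sq_mul_prod]
  exact integral_fintype_prod_volume_eq_pow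
    (fun x : ℝ => Real.exp (-(a * x ^ 2) / 2) * x ^ (2 * r))

/-- The integral `∫ exp(-bᵀ A_k b/2) ∏ b_i^{2r} db`: up to the powers of `2π` and `det A_k`, which
cancel in the prior density, this is the inverse of the normalizing constant `d_k`. -/
def priorMoment {p : ℕ} (r : ℕ) (A : Matrix (Fin p) (Fin p) ℝ) (k : Model p) : ℝ :=
  ∫ b : k → ℝ, Real.exp (-(b ⬝ᵥ (prinSub A k *ᵥ b)) / 2) * ∏ i, b i ^ (2 * r)

section Prior

variable {p : ℕ} {A : Matrix (Fin p) (Fin p) ℝ} {a₁ a₂ : ℝ}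

lemma integrable_priorMoment (r : ℕ) (hA : ScaleMatrixBound A a₁ a₂) (ha₁ : 0 < a₁)
    (k : Model p) :
    Integrable fun b : k → ℝ =>
      Real.exp (-(b ⬝ᵥ (prinSub A k *ᵥ b)) / 2) * ∏ i, b i ^ (2 * r) := by
  refine (integrable_exp_sum_sq_mul_prod r ha₁).mono' ?_ (ae_of_all _ fun b => ?_)
  · refine Continuous.aestronglyMeasurable ?_
    simp only [dotProduct, Matrix.mulVec]
    fun_prop
  · have hprod := prod_pow_two_mul_nonneg r b
    rw [Real.norm_of_nonneg (by positivity)]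
    gcongr
    exact hA.mul_sum_sq_le k b

lemma priorMoment_le (r : ℕ) (hA : ScaleMatrixBound A a₁ a₂) (ha₁ : 0 < a₁) (k : Model p) :
    priorMoment r A k ≤ gaussMoment r a₁ ^ k.card := by
  rw [← Fintype.card_coe, ← integral_exp_sum_sq_mul_prod]
  refine integral_mono (integrable_priorMoment r hA ha₁ k) (integrable_exp_sum_sq_mul_prod r ha₁)
    fun b => mul_le_mul_of_nonneg_right ?_ (prod_pow_two_mul_nonneg r b)
  gcongr
  exact hA.mul_sum_sq_le k b

lemma le_priorMoment (r : ℕ) (hA : ScaleMatrixBound A a₁ a₂) (ha₁ : 0 < a₁) (ha₂ : 0 < a₂)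
    (k : Model p) : gaussMoment r a₂ ^ k.card ≤ priorMoment r A k := by
  rw [← Fintype.card_coe, ← integral_exp_sum_sq_mul_prod]
  refine integral_mono (integrable_exp_sum_sq_mul_prod r ha₂) (integrable_priorMoment r hA ha₁ k)
    fun b => mul_le_mul_of_nonneg_right ?_ (prod_pow_two_mul_nonneg r b)
  gcongr
  exact hA.le_mul_sum_sq k b

lemma priorMoment_pos (r : ℕ) (hA : ScaleMatrixBound A a₁ a₂) (ha₁ : 0 < a₁) (ha₂ : 0 < a₂)
    (k : Model p) : 0 < priorMoment r A k :=
  (pow_pos (gaussMoment_pos r ha₂) _).trans_le (le_priorMoment r hA ha₁ ha₂ k)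

lemma pMOMDensity_eq (r : ℕ) (hA : ScaleMatrixBound A a₁ a₂) (ha₁ : 0 < a₁) (k : Model p)
    (τ v : ℝ) (b : k → ℝ) :
    pMOMDensity r A k τ v b = (priorMoment r A k)⁻¹ * (τ * v) ^ (-((r + 1 / 2) * k.card : ℝ)) *
      Real.exp (-(b ⬝ᵥ (prinSub A k *ᵥ b)) / (2 * (τ * v))) * ∏ i, b i ^ (2 * r) := by
  have hdet := hA.det_prinSub_pos ha₁ k
  have := Real.pi_pos
  set C : ℝ := (2 * Real.pi) ^ (-(k.card : ℝ) / 2) * (prinSub A k).det ^ (1 / 2 : ℝ) with hC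
  have hC0 : C ≠ 0 := by positivity
  have hnorm : normConst r A k = C⁻¹ * (priorMoment r A k)⁻¹ := by
    rw [normConst, priorMoment, ← mul_inv, ← integral_const_mul]
    congr 2
    funext b
    simp only [pMOMKernel, Real.one_rpow, mul_one, hC]
    ring
  have hexp : -(r : ℝ) * k.card - k.card / 2 = -((r + 1 / 2) * k.card) := by ring
  rw [pMOMDensity, hnorm, pMOMKernel, hexp, mul_right_comm _ _ ((prinSub A k).det ^ _), ← hC]
  field_simp

end Prior

/-! ### Bounds on the marginal densities -/

lemma integrableOn_rpow_mul_exp_neg_mul {a B : ℝ} (ha : 0 < a) (hB : 0 < B) :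
    IntegrableOn (fun t : ℝ => t ^ (a - 1) * Real.exp (-(B * t))) (Set.Ioi 0) := by
  simpa using integrableOn_rpow_mul_exp_neg_mul_rpow (by linarith : -1 < a - 1) one_pos hB

lemma lintegral_rpow_mul_exp_neg_div {a B : ℝ} (ha : 0 < a) (hB : 0 < B) :
    ∫⁻ v in Set.Ioi (0 : ℝ), ENNReal.ofReal (v ^ (-(a + 1)) * Real.exp (-B / v)) =
      ENNReal.ofReal (Real.Gamma a * B ^ (-a)) := by
  set g : ℝ → ℝ := fun t => t ^ (a - 1) * Real.exp (-(B * t)) with hg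
  have hsubst : ∀ v ∈ Set.Ioi (0 : ℝ), (|(-1 : ℝ)| * v ^ ((-1 : ℝ) - 1)) • g (v ^ (-1 : ℝ)) =
      v ^ (-(a + 1)) * Real.exp (-B / v) := by
    intro v (hv : 0 < v)
    simp only [hg, abs_neg, abs_one, one_mul, smul_eq_mul]
    rw [← mul_assoc, ← Real.rpow_mul hv.le, ← Real.rpow_add hv, Real.rpow_neg_one, neg_div,
      div_eq_mul_inv]
    congr 2
    ring
  have hint : IntegrableOn (fun v => v ^ (-(a + 1)) * Real.exp (-B / v)) (Set.Ioi 0) :=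
    ((integrableOn_Ioi_comp_rpow_iff g (p := -1) (by norm_num)).2
      (integrableOn_rpow_mul_exp_neg_mul ha hB)).congr_fun hsubst measurableSet_Ioi
  rw [← ofReal_integral_eq_lintegral_ofReal hint
      (ae_restrict_of_forall_mem measurableSet_Ioi fun v (hv : 0 < v) => by positivity),
    ← setIntegral_congr_fun measurableSet_Ioi hsubst, integral_comp_rpow_Ioi g (by norm_num), hg,
    Real.integral_rpow_mul_exp_neg_mul_Ioi ha hB, one_div, Real.inv_rpow hB.le,
    Real.rpow_neg hB.le, mul_comm]

lemma lintegral_rpow_mul_exp_neg_div_mul {a x B C U : ℝ} (ha : 0 < a) (hBC : 0 < B + C)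
    (hU : 0 ≤ U) :
    ∫⁻ v in Set.Ioi (0 : ℝ), ENNReal.ofReal (v ^ (-(a + x + 1)) * Real.exp (-B / v)) *
        ENNReal.ofReal (U * v ^ x * Real.exp (-C / v)) =
      ENNReal.ofReal (U * (Real.Gamma a * (B + C) ^ (-a))) := by
  have hmul : ∀ v ∈ Set.Ioi (0 : ℝ),
      ENNReal.ofReal (v ^ (-(a + x + 1)) * Real.exp (-B / v)) *
        ENNReal.ofReal (U * v ^ x * Real.exp (-C / v)) =
      ENNReal.ofReal U * ENNReal.ofReal (v ^ (-(a + 1)) * Real.exp (-(B + C) / v)) := by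
    intro v (hv : 0 < v)
    have hpow : v ^ (-(a + 1)) = v ^ (-(a + x + 1)) * v ^ x := by
      rw [← Real.rpow_add hv]; congr 1; ring
    have hexp : Real.exp (-(B + C) / v) = Real.exp (-B / v) * Real.exp (-C / v) := by
      rw [← Real.exp_add]; congr 1; ring
    rw [← ENNReal.ofReal_mul (by positivity), ← ENNReal.ofReal_mul hU, hpow, hexp]
    congr 1
    ring
  rw [setLIntegral_congr_fun measurableSet_Ioi hmul,
    lintegral_const_mul' _ _ ENNReal.ofReal_ne_top, lintegral_rpow_mul_exp_neg_div ha hBC,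
    ENNReal.ofReal_mul hU]

lemma le_setLIntegral_Ici_rpow_mul_exp {c s : ℝ} (hc : 0 < c) (hs : 0 ≤ s) :
    ENNReal.ofReal (c * ((2 * c) ^ (-s) * Real.exp (-(1 / 2)))) ≤
      ∫⁻ τ in Set.Ici c, ENNReal.ofReal (τ ^ (-s) * Real.exp (-(c / 2) / τ)) := by
  have hle : ∀ τ ∈ Set.Icc c (2 * c),
      (2 * c) ^ (-s) * Real.exp (-(1 / 2)) ≤ τ ^ (-s) * Real.exp (-(c / 2) / τ) := by
    rintro τ ⟨hcτ, hτ⟩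
    have hτ0 : 0 < τ := hc.trans_le hcτ
    refine mul_le_mul (Real.rpow_le_rpow_of_nonpos hτ0 hτ (by linarith)) (Real.exp_le_exp.2 ?_)
      (Real.exp_pos _).le (by positivity)
    rw [le_div_iff₀ hτ0]
    linarith
  calc ENNReal.ofReal (c * ((2 * c) ^ (-s) * Real.exp (-(1 / 2))))
      = ∫⁻ _τ in Set.Icc c (2 * c), ENNReal.ofReal ((2 * c) ^ (-s) * Real.exp (-(1 / 2))) := by
        rw [setLIntegral_const, Real.volume_Icc, ← ENNReal.ofReal_mul (by positivity)]
        congr 1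
        ring
    _ ≤ ∫⁻ τ in Set.Icc c (2 * c), ENNReal.ofReal (τ ^ (-s) * Real.exp (-(c / 2) / τ)) :=
        setLIntegral_mono' measurableSet_Icc fun τ hτ => ENNReal.ofReal_le_ofReal (hle τ hτ)
    _ ≤ _ := lintegral_mono_set Set.Icc_subset_Ici_self

lemma lintegral_prod_exp_neg_sq {ι : Type*} [Fintype ι] {κ v : ℝ} (hκ : 0 < κ) (hv : 0 < v)
    (c : ι → ℝ) :
    ∫⁻ b : ι → ℝ, ENNReal.ofReal (∏ i, Real.exp (-(κ * (b i - c i) ^ 2) / (2 * v))) =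
      ENNReal.ofReal (√(2 * Real.pi * v / κ) ^ Fintype.card ι) := by
  have hshift (i : ι) : (fun x : ℝ => Real.exp (-(κ * (x - c i) ^ 2) / (2 * v))) =
      fun x : ℝ => (fun z => Real.exp (-(κ / (2 * v)) * z ^ 2)) (x - c i) := by
    funext x
    congr 1
    ring
  have hint (i : ι) : Integrable fun x : ℝ => Real.exp (-(κ * (x - c i) ^ 2) / (2 * v)) := by
    rw [hshift]
    exact (integrable_exp_neg_mul_sq (by positivity)).comp_sub_right (c i)
  have hgauss (i : ι) : ∫ x : ℝ, Real.exp (-(κ * (x - c i) ^ 2) / (2 * v)) =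
      √(2 * Real.pi * v / κ) := by
    rw [hshift, integral_sub_right_eq_self (fun z => Real.exp (-(κ / (2 * v)) * z ^ 2)),
      integral_gaussian]
    congr 1
    field_simp
  rw [volume_pi, ← ofReal_integral_eq_lintegral_ofReal (Integrable.fintype_prod hint)
      (ae_of_all _ fun b => Finset.prod_nonneg fun i _ => (Real.exp_pos _).le),
    integral_fintype_prod_eq_prod (fun i x => Real.exp (-(κ * (x - c i) ^ 2) / (2 * v)))]
  simp_rw [hgauss]
  rw [Finset.prod_const, Finset.card_univ]

lemma pow_two_mul_mul_exp_le (r : ℕ) {l v : ℝ} (hl : 0 < l) (hv : 0 < v) (b : ℝ) :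
    b ^ (2 * r) * Real.exp (-(l * b ^ 2) / (2 * v)) ≤ (2 * v / l) ^ r * r.factorial := by
  set x : ℝ := l * b ^ 2 / (2 * v) with hx
  have hpow : b ^ (2 * r) = (2 * v / l) ^ r * x ^ r := by
    rw [pow_mul, ← mul_pow, hx]
    field_simp
  have hexp : x ^ r * Real.exp (-x) ≤ r.factorial := by
    rw [Real.exp_neg, ← div_eq_mul_inv, div_le_iff₀ (Real.exp_pos _),
      ← div_le_iff₀' (by positivity)]
    exact Real.pow_div_factorial_le_exp x (by positivity) r
  rw [hpow, neg_div, ← hx, mul_assoc]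
  gcongr

/-- The factor common to the marginal densities of all models: the powers of `2π` of the
likelihood and the normalizing constants of the two Inverse-Gamma densities. -/
def marginalConst (n : ℕ) (α₁ α₂ : ℝ) : ℝ :=
  (2 * Real.pi) ^ (-(n : ℝ) / 2) * ((n / 2 : ℝ) ^ (1 / 2 : ℝ) / Real.Gamma (1 / 2)) *
    (α₂ ^ α₁ / Real.Gamma α₁)

lemma marginalConst_pos {n : ℕ} {α₁ α₂ : ℝ} (hn : n ≠ 0) (hα₁ : 0 < α₁) (hα₂ : 0 < α₂) :
    0 < marginalConst n α₁ α₂ := by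
  have := Real.pi_pos
  have := Real.Gamma_pos_of_pos hα₁
  have := Real.Gamma_pos_of_pos (one_half_pos (α := ℝ))
  have : (0 : ℝ) < n := by positivity
  unfold marginalConst
  positivity

/-- The part of the integrand of `marginal` that depends on the coefficients `b`. -/
def coefKernel {n p : ℕ} (r : ℕ) (X : Matrix (Fin n) (Fin p) ℝ) (A : Matrix (Fin p) (Fin p) ℝ)
    (k : Model p) (y : Fin n → ℝ) (τ v : ℝ) (b : k → ℝ) : ℝ :=
  Real.exp (-(∑ i, (y i - (designSub X k *ᵥ b) i) ^ 2 + b ⬝ᵥ (prinSub A k *ᵥ b) / τ) / (2 * v)) *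
    ∏ i, b i ^ (2 * r)

/-- The bound on the marginal density of a model of size `m` obtained in `marginal_le`, without
the factors that also occur in the bound for the true model. -/
def marginalUpper (r n : ℕ) (g κ : ℝ) (m : ℕ) (Λ : ℝ) : ℝ :=
  (g ^ m)⁻¹ * (Real.Gamma ((r + 1 / 2) * m + 1 / 2) *
    (n / 2 : ℝ) ^ (-((r + 1 / 2) * m + 1 / 2) : ℝ)) *
    ((2 ^ r * r.factorial * √(2 * Real.pi / κ)) ^ m * Λ)

/-- The lower bound on the marginal density of a model of size `m` obtained in `le_marginal`,
without the factors that also occur in the upper bound. -/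
def marginalLower (r n : ℕ) (G : ℝ) (m : ℕ) (w ρ : ℝ) : ℝ :=
  (G ^ m)⁻¹ * (n * ((2 * n : ℝ) ^ (-((r + 1 / 2) * m + 1 / 2 + 1) : ℝ) *
    Real.exp (-(1 / 2)))) * (w ^ m * ρ)

section Marginal

variable {n p : ℕ} {r : ℕ} {α₁ α₂ a₁ a₂ : ℝ} {X : Matrix (Fin n) (Fin p) ℝ}
  {A : Matrix (Fin p) (Fin p) ℝ} {k : Model p} {y : Fin n → ℝ}

lemma integrand_eq (hA : ScaleMatrixBound A a₁ a₂) (ha₁ : 0 < a₁) {τ v : ℝ} (hτ : 0 < τ)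
    (hv : 0 < v) (b : k → ℝ) :
    likelihood X k b v y * pMOMDensity r A k τ v b *
        invGammaDensity (1 / 2) ((n : ℝ) / 2) τ * invGammaDensity α₁ α₂ v =
      marginalConst n α₁ α₂ * (priorMoment r A k)⁻¹ *
        (τ ^ (-((r + 1 / 2) * k.card + 1 / 2 + 1) : ℝ) * Real.exp (-(n / 2) / τ)) *
        (v ^ (-(n / 2 + α₁ + (r + 1 / 2) * k.card + 1)) * Real.exp (-α₂ / v)) *
        coefKernel r X A k y τ v b := by
  have := Real.pi_pos
  set x : ℝ := (r + 1 / 2) * k.card with hx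
  set S : ℝ := ∑ i, (y i - (designSub X k *ᵥ b) i) ^ 2 with hS
  have hτpow : τ ^ (-(x + 1 / 2 + 1)) = τ ^ (-x) * τ ^ (-(1 / 2 + 1) : ℝ) := by
    rw [← Real.rpow_add hτ]; congr 1; ring
  have hvpow : v ^ (-(n / 2 + α₁ + x + 1)) = v ^ (-(n : ℝ) / 2) * v ^ (-x) * v ^ (-(α₁ + 1)) := by
    rw [← Real.rpow_add hv, ← Real.rpow_add hv]; congr 1; ring
  have hexp : Real.exp (-(S + b ⬝ᵥ (prinSub A k *ᵥ b) / τ) / (2 * v)) =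
      Real.exp (-S / (2 * v)) * Real.exp (-(b ⬝ᵥ (prinSub A k *ᵥ b)) / (2 * (τ * v))) := by
    rw [← Real.exp_add]; congr 1; field_simp; ring
  rw [pMOMDensity_eq r hA ha₁, Real.mul_rpow hτ.le hv.le, invGammaDensity, invGammaDensity,
    likelihood, Real.mul_rpow (by positivity) hv.le, coefKernel, marginalConst, ← hS, ← hx, hτpow,
    hvpow, hexp]
  ring

lemma marginal_eq (hA : ScaleMatrixBound A a₁ a₂) (ha₁ : 0 < a₁) (ha₂ : 0 < a₂) (hn : n ≠ 0)
    (hα₁ : 0 < α₁) (hα₂ : 0 < α₂) :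
    marginal r α₁ α₂ X A k y =
      ENNReal.ofReal (marginalConst n α₁ α₂ * (priorMoment r A k)⁻¹) *
        ∫⁻ τ in Set.Ioi (0 : ℝ), ENNReal.ofReal
          (τ ^ (-((r + 1 / 2) * k.card + 1 / 2 + 1) : ℝ) * Real.exp (-(n / 2) / τ)) *
          ∫⁻ v in Set.Ioi (0 : ℝ), ENNReal.ofReal
            (v ^ (-(n / 2 + α₁ + (r + 1 / 2) * k.card + 1)) * Real.exp (-α₂ / v)) *
            ∫⁻ b : k → ℝ, ENNReal.ofReal (coefKernel r X A k y τ v b) := by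
  have hC := marginalConst_pos hn hα₁ hα₂
  have hJ := priorMoment_pos r hA ha₁ ha₂ k
  rw [marginal, ← lintegral_const_mul' _ _ ENNReal.ofReal_ne_top]
  refine setLIntegral_congr_fun measurableSet_Ioi fun τ (hτ : 0 < τ) => ?_
  rw [← lintegral_const_mul' _ _ ENNReal.ofReal_ne_top,
    ← lintegral_const_mul' _ _ ENNReal.ofReal_ne_top]
  refine setLIntegral_congr_fun measurableSet_Ioi fun v (hv : 0 < v) => ?_
  rw [← lintegral_const_mul' _ _ ENNReal.ofReal_ne_top,
    ← lintegral_const_mul' _ _ ENNReal.ofReal_ne_top,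
    ← lintegral_const_mul' _ _ ENNReal.ofReal_ne_top]
  refine lintegral_congr fun b => ?_
  rw [integrand_eq hA ha₁ hτ hv, ← ENNReal.ofReal_mul (by positivity),
    ← ENNReal.ofReal_mul (by positivity), ← ENNReal.ofReal_mul (by positivity)]
  simp only [mul_assoc]

lemma coefKernel_le (hA : ScaleMatrixBound A a₁ a₂) (ha₁ : 0 < a₁) {Q κ : ℝ} {l c b : k → ℝ}
    (hl : ∀ i, 0 < l i)
    (hQ : Q + κ * ∑ i, (b i - c i) ^ 2 + ∑ i, l i * b i ^ 2 ≤
      ∑ i, (y i - (designSub X k *ᵥ b) i) ^ 2) {τ v : ℝ} (hτ : 0 < τ) (hv : 0 < v) :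
    coefKernel r X A k y τ v b ≤
      Real.exp (-(Q / 2) / v) * (∏ i, ((2 * v / l i) ^ r * r.factorial)) *
        ∏ i, Real.exp (-(κ * (b i - c i) ^ 2) / (2 * v)) := by
  have hquad : 0 ≤ b ⬝ᵥ (prinSub A k *ᵥ b) / τ :=
    div_nonneg ((by positivity : 0 ≤ a₁ * ∑ i, b i ^ 2).trans (hA.mul_sum_sq_le k b)) hτ.le
  have hexp : Real.exp (-(∑ i, (y i - (designSub X k *ᵥ b) i) ^ 2 +
        b ⬝ᵥ (prinSub A k *ᵥ b) / τ) / (2 * v)) ≤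
      Real.exp (-(Q / 2) / v) * (∏ i, Real.exp (-(l i * b i ^ 2) / (2 * v))) *
        ∏ i, Real.exp (-(κ * (b i - c i) ^ 2) / (2 * v)) := by
    rw [← Real.exp_sum, ← Real.exp_sum, ← Real.exp_add, ← Real.exp_add, ← Finset.sum_div,
      ← Finset.sum_div, Finset.sum_neg_distrib, Finset.sum_neg_distrib, ← Finset.mul_sum,
      show -(Q / 2) / v = -Q / (2 * v) by ring, ← add_div, ← add_div]
    gcongr
    linarith
  calc coefKernel r X A k y τ v b
      ≤ (Real.exp (-(Q / 2) / v) * (∏ i, Real.exp (-(l i * b i ^ 2) / (2 * v))) *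
          ∏ i, Real.exp (-(κ * (b i - c i) ^ 2) / (2 * v))) * ∏ i, b i ^ (2 * r) :=
        mul_le_mul_of_nonneg_right hexp (prod_pow_two_mul_nonneg r b)
    _ = Real.exp (-(Q / 2) / v) *
          (∏ i, (b i ^ (2 * r) * Real.exp (-(l i * b i ^ 2) / (2 * v)))) *
          ∏ i, Real.exp (-(κ * (b i - c i) ^ 2) / (2 * v)) := by
        rw [Finset.prod_mul_distrib]
        ring
    _ ≤ _ := by
        refine mul_le_mul_of_nonneg_right (mul_le_mul_of_nonneg_left (Finset.prod_le_prod
          (fun i _ => ?_) fun i _ => pow_two_mul_mul_exp_le r (hl i) hv (b i)) (Real.exp_pos _).le)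
          (Finset.prod_nonneg fun i _ => (Real.exp_pos _).le)
        rw [pow_mul]
        positivity

lemma lintegral_coefKernel_le (hA : ScaleMatrixBound A a₁ a₂) (ha₁ : 0 < a₁) {Q κ : ℝ}
    {l c : k → ℝ} (hl : ∀ i, 0 < l i) (hκ : 0 < κ)
    (hQ : ∀ b : k → ℝ, Q + κ * ∑ i, (b i - c i) ^ 2 + ∑ i, l i * b i ^ 2 ≤
      ∑ i, (y i - (designSub X k *ᵥ b) i) ^ 2) {τ v : ℝ} (hτ : 0 < τ) (hv : 0 < v) :
    ∫⁻ b : k → ℝ, ENNReal.ofReal (coefKernel r X A k y τ v b) ≤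
      ENNReal.ofReal ((2 ^ r * r.factorial * √(2 * Real.pi / κ)) ^ k.card * (∏ i, (l i)⁻¹ ^ r) *
        v ^ ((r + 1 / 2) * k.card : ℝ) * Real.exp (-(Q / 2) / v)) := by
  have hD : 0 ≤ ∏ i, ((2 * v / l i) ^ r * r.factorial) :=
    Finset.prod_nonneg fun i _ => by have := hl i; positivity
  have hprod : ∏ i, ((2 * v / l i) ^ r * r.factorial) =
      (2 ^ r * r.factorial) ^ k.card * (∏ i, (l i)⁻¹ ^ r) * v ^ (r * k.card : ℝ) := by
    calc ∏ i, ((2 * v / l i) ^ r * (r.factorial : ℝ))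
        = ∏ i, ((2 ^ r * r.factorial) * v ^ r * (l i)⁻¹ ^ r) := by
          refine Finset.prod_congr rfl fun i _ => ?_
          rw [div_eq_mul_inv, mul_pow, mul_pow]
          ring
      _ = _ := by
          rw [Finset.prod_mul_distrib, Finset.prod_const, Finset.card_univ, Fintype.card_coe,
            mul_pow, ← pow_mul, ← Nat.cast_mul, Real.rpow_natCast]
          ring
  have hsqrt : √(2 * Real.pi * v / κ) ^ k.card =
      √(2 * Real.pi / κ) ^ k.card * v ^ (1 / 2 * k.card : ℝ) := by
    rw [mul_div_right_comm, Real.sqrt_mul' _ hv.le, mul_pow, Real.sqrt_eq_rpow v,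
      ← Real.rpow_mul_natCast hv.le]
  calc ∫⁻ b : k → ℝ, ENNReal.ofReal (coefKernel r X A k y τ v b)
      ≤ ∫⁻ b : k → ℝ, ENNReal.ofReal
            (Real.exp (-(Q / 2) / v) * ∏ i, ((2 * v / l i) ^ r * r.factorial)) *
          ENNReal.ofReal (∏ i, Real.exp (-(κ * (b i - c i) ^ 2) / (2 * v))) :=
        lintegral_mono fun b => by
          rw [← ENNReal.ofReal_mul (by positivity)]
          exact ENNReal.ofReal_le_ofReal (coefKernel_le hA ha₁ hl (hQ b) hτ hv)
    _ = _ := by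
        rw [lintegral_const_mul' _ _ ENNReal.ofReal_ne_top, lintegral_prod_exp_neg_sq hκ hv,
          ← ENNReal.ofReal_mul (by positivity), Fintype.card_coe, hprod, hsqrt, add_mul,
          Real.rpow_add hv, mul_pow _ (√_)]
        congr 1
        ring

lemma marginal_le (hA : ScaleMatrixBound A a₁ a₂) (ha₁ : 0 < a₁) (ha₂ : 0 < a₂) (hn : n ≠ 0)
    (hα₁ : 0 < α₁) (hα₂ : 0 < α₂) {Q κ : ℝ} {l c : k → ℝ} (hl : ∀ i, 0 < l i) (hκ : 0 < κ)
    (hB : 0 < α₂ + Q / 2)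
    (hQ : ∀ b : k → ℝ, Q + κ * ∑ i, (b i - c i) ^ 2 + ∑ i, l i * b i ^ 2 ≤
      ∑ i, (y i - (designSub X k *ᵥ b) i) ^ 2) :
    marginal r α₁ α₂ X A k y ≤ ENNReal.ofReal (marginalConst n α₁ α₂ *
      marginalUpper r n (gaussMoment r a₂) κ k.card (∏ i, (l i)⁻¹ ^ r) *
      (Real.Gamma (n / 2 + α₁) * (α₂ + Q / 2) ^ (-(n / 2 + α₁)))) := by
  have : (0 : ℝ) < n := by positivity
  have hC := marginalConst_pos hn hα₁ hα₂
  have hg := gaussMoment_pos r ha₂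
  have hJ := le_priorMoment r hA ha₁ ha₂ k
  have hΛ : 0 ≤ ∏ i, (l i)⁻¹ ^ r := Finset.prod_nonneg fun i _ => by have := hl i; positivity
  set x : ℝ := (r + 1 / 2) * k.card with hx
  set U : ℝ := (2 ^ r * r.factorial * √(2 * Real.pi / κ)) ^ k.card * ∏ i, (l i)⁻¹ ^ r with hU
  have hΓx := Real.Gamma_pos_of_pos (by positivity : 0 < x + 1 / 2)
  calc marginal r α₁ α₂ X A k y
      ≤ ENNReal.ofReal (marginalConst n α₁ α₂ * (gaussMoment r a₂ ^ k.card)⁻¹) *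
        ∫⁻ τ in Set.Ioi (0 : ℝ), ENNReal.ofReal
          (τ ^ (-(x + 1 / 2 + 1) : ℝ) * Real.exp (-(n / 2) / τ)) *
          ∫⁻ v in Set.Ioi (0 : ℝ), ENNReal.ofReal
            (v ^ (-(n / 2 + α₁ + x + 1)) * Real.exp (-α₂ / v)) *
            ENNReal.ofReal (U * v ^ x * Real.exp (-(Q / 2) / v)) := by
        rw [marginal_eq hA ha₁ ha₂ hn hα₁ hα₂]
        refine mul_le_mul' (ENNReal.ofReal_le_ofReal (by gcongr))
          (setLIntegral_mono' measurableSet_Ioi fun τ (hτ : 0 < τ) => mul_le_mul_right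
            (setLIntegral_mono' measurableSet_Ioi fun v (hv : 0 < v) => mul_le_mul_right
              (lintegral_coefKernel_le hA ha₁ hl hκ hQ hτ hv) _) _)
    _ = _ := by
        rw [lintegral_rpow_mul_exp_neg_div_mul (by positivity) hB (by positivity),
          lintegral_mul_const' _ _ ENNReal.ofReal_ne_top,
          lintegral_rpow_mul_exp_neg_div (by positivity) (by positivity),
          ← ENNReal.ofReal_mul (by positivity), ← ENNReal.ofReal_mul (by positivity),
          marginalUpper, ← hx, ← hU]
        congr 1
        ring

lemma le_lintegral_coefKernel (hA : ScaleMatrixBound A a₁ a₂) (ha₂ : 0 < a₂) {Q ρ w : ℝ}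
    (hρ : 0 ≤ ρ) (hw : 0 ≤ w) {c : k → ℝ} {τ₀ τ v : ℝ} (hτ₀ : 0 < τ₀) (hτ : τ₀ ≤ τ) (hv : 0 < v)
    (hbox : ∀ b ∈ Set.Icc c (fun i => c i + w),
      ∑ i, (y i - (designSub X k *ᵥ b) i) ^ 2 + a₂ / τ₀ * ∑ i, b i ^ 2 ≤ Q ∧
        ρ ≤ ∏ i, b i ^ (2 * r)) :
    ENNReal.ofReal (w ^ k.card * ρ * Real.exp (-(Q / 2) / v)) ≤
      ∫⁻ b : k → ℝ, ENNReal.ofReal (coefKernel r X A k y τ v b) := by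
  have hτ' := hτ₀.trans_le hτ
  have hle : ∀ b ∈ Set.Icc c (fun i => c i + w),
      ρ * Real.exp (-(Q / 2) / v) ≤ coefKernel r X A k y τ v b := by
    intro b hb
    obtain ⟨hS, hprod⟩ := hbox b hb
    have hquad : b ⬝ᵥ (prinSub A k *ᵥ b) / τ ≤ a₂ / τ₀ * ∑ i, b i ^ 2 := by
      calc b ⬝ᵥ (prinSub A k *ᵥ b) / τ ≤ a₂ * (∑ i, b i ^ 2) / τ := by
            gcongr; exact hA.le_mul_sum_sq k b
        _ ≤ a₂ * (∑ i, b i ^ 2) / τ₀ := by gcongr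
        _ = a₂ / τ₀ * ∑ i, b i ^ 2 := by ring
    rw [coefKernel, mul_comm, show -(Q / 2) / v = -Q / (2 * v) by ring]
    gcongr
    linarith
  calc ENNReal.ofReal (w ^ k.card * ρ * Real.exp (-(Q / 2) / v))
      = ∫⁻ _b in Set.Icc c (fun i => c i + w),
          ENNReal.ofReal (ρ * Real.exp (-(Q / 2) / v)) := by
        rw [setLIntegral_const, Real.volume_Icc_pi]
        simp only [add_sub_cancel_left, Finset.prod_const, Finset.card_univ, Fintype.card_coe]
        rw [← ENNReal.ofReal_pow hw, ← ENNReal.ofReal_mul (by positivity)]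
        congr 1
        ring
    _ ≤ ∫⁻ b in Set.Icc c (fun i => c i + w), ENNReal.ofReal (coefKernel r X A k y τ v b) :=
        setLIntegral_mono' measurableSet_Icc fun b hb => ENNReal.ofReal_le_ofReal (hle b hb)
    _ ≤ _ := setLIntegral_le_lintegral _ _

lemma le_lintegral_variance (hA : ScaleMatrixBound A a₁ a₂) (ha₂ : 0 < a₂) (hα₁ : 0 < α₁)
    {Q ρ w : ℝ} (hρ : 0 ≤ ρ) (hw : 0 ≤ w) {c : k → ℝ} {τ₀ τ : ℝ} (hτ₀ : 0 < τ₀) (hτ : τ₀ ≤ τ)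
    (hB : 0 < α₂ + Q / 2)
    (hbox : ∀ b ∈ Set.Icc c (fun i => c i + w),
      ∑ i, (y i - (designSub X k *ᵥ b) i) ^ 2 + a₂ / τ₀ * ∑ i, b i ^ 2 ≤ Q ∧
        ρ ≤ ∏ i, b i ^ (2 * r)) :
    ENNReal.ofReal (w ^ k.card * ρ * (Real.Gamma (n / 2 + α₁ + (r + 1 / 2) * k.card) *
        (α₂ + Q / 2) ^ (-(n / 2 + α₁ + (r + 1 / 2) * k.card)))) ≤
      ∫⁻ v in Set.Ioi (0 : ℝ), ENNReal.ofReal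
        (v ^ (-(n / 2 + α₁ + (r + 1 / 2) * k.card + 1)) * Real.exp (-α₂ / v)) *
        ∫⁻ b : k → ℝ, ENNReal.ofReal (coefKernel r X A k y τ v b) := by
  rw [← lintegral_rpow_mul_exp_neg_div_mul (x := 0) (by positivity) hB (by positivity)]
  refine setLIntegral_mono' measurableSet_Ioi fun v (hv : 0 < v) => ?_
  rw [Real.rpow_zero, mul_one, add_zero]
  exact mul_le_mul_right (le_lintegral_coefKernel hA ha₂ hρ hw hτ₀ hτ hv hbox) _

lemma le_marginal (hA : ScaleMatrixBound A a₁ a₂) (ha₁ : 0 < a₁) (ha₂ : 0 < a₂) (hn : n ≠ 0)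
    (hα₁ : 0 < α₁) (hα₂ : 0 < α₂) {Q ρ w : ℝ} (hρ : 0 ≤ ρ) (hw : 0 ≤ w) {c : k → ℝ}
    (hB : 0 < α₂ + Q / 2)
    (hbox : ∀ b ∈ Set.Icc c (fun i => c i + w),
      ∑ i, (y i - (designSub X k *ᵥ b) i) ^ 2 + a₂ / n * ∑ i, b i ^ 2 ≤ Q ∧
        ρ ≤ ∏ i, b i ^ (2 * r)) :
    ENNReal.ofReal (marginalConst n α₁ α₂ * marginalLower r n (gaussMoment r a₁) k.card w ρ *
      (Real.Gamma (n / 2 + α₁ + (r + 1 / 2) * k.card) *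
        (α₂ + Q / 2) ^ (-(n / 2 + α₁ + (r + 1 / 2) * k.card)))) ≤
      marginal r α₁ α₂ X A k y := by
  have hn' : (0 : ℝ) < n := by positivity
  have hC := marginalConst_pos hn hα₁ hα₂
  have := gaussMoment_pos r ha₁
  have hJ := priorMoment_pos r hA ha₁ ha₂ k
  set x : ℝ := (r + 1 / 2) * k.card with hx
  have hΓ := Real.Gamma_pos_of_pos (by positivity : 0 < n / 2 + α₁ + x)
  calc _ ≤ ENNReal.ofReal (marginalConst n α₁ α₂ * (priorMoment r A k)⁻¹) *
        (ENNReal.ofReal (n * ((2 * n : ℝ) ^ (-(x + 1 / 2 + 1)) * Real.exp (-(1 / 2)))) *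
          ENNReal.ofReal (w ^ k.card * ρ *
            (Real.Gamma (n / 2 + α₁ + x) * (α₂ + Q / 2) ^ (-(n / 2 + α₁ + x))))) := by
        rw [← ENNReal.ofReal_mul (by positivity), ← ENNReal.ofReal_mul (by positivity),
          marginalLower, ← hx]
        refine ENNReal.ofReal_le_ofReal ?_
        calc _ = marginalConst n α₁ α₂ * (gaussMoment r a₁ ^ k.card)⁻¹ *
              (n * ((2 * n : ℝ) ^ (-(x + 1 / 2 + 1)) * Real.exp (-(1 / 2))) *
                (w ^ k.card * ρ *
                  (Real.Gamma (n / 2 + α₁ + x) * (α₂ + Q / 2) ^ (-(n / 2 + α₁ + x))))) := by ring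
          _ ≤ _ := by gcongr; exact priorMoment_le r hA ha₁ k
    _ ≤ ENNReal.ofReal (marginalConst n α₁ α₂ * (priorMoment r A k)⁻¹) *
        ∫⁻ τ in Set.Ici (n : ℝ), ENNReal.ofReal
          (τ ^ (-(x + 1 / 2 + 1) : ℝ) * Real.exp (-(n / 2) / τ)) *
          ENNReal.ofReal (w ^ k.card * ρ *
            (Real.Gamma (n / 2 + α₁ + x) * (α₂ + Q / 2) ^ (-(n / 2 + α₁ + x)))) := by
        rw [lintegral_mul_const' _ _ ENNReal.ofReal_ne_top]
        gcongr
        exact le_setLIntegral_Ici_rpow_mul_exp hn' (by positivity)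
    _ ≤ marginal r α₁ α₂ X A k y := by
        rw [marginal_eq hA ha₁ ha₂ hn hα₁ hα₂]
        exact mul_le_mul_right ((setLIntegral_mono' measurableSet_Ici fun τ hτ =>
          mul_le_mul_right (le_lintegral_variance hA ha₂ hα₁ hρ hw hn' hτ hB hbox) _).trans
            (lintegral_mono_set fun τ hτ => hn'.trans_le hτ)) _

end Marginal

/-! ### Residual sums of squares -/

section SumSq

variable {ι : Type*} [Fintype ι]

lemma two_mul_abs_le_of_sq_le_mul {c W Z δ : ℝ} (hW : 0 ≤ W) (hZ : 0 ≤ Z) (hδ : 0 < δ)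
    (h : c ^ 2 ≤ W * Z) : 2 * |c| ≤ W / δ + δ * Z := by
  refine le_of_sq_le_sq ?_ (by positivity)
  calc (2 * |c|) ^ 2 = 4 * c ^ 2 := by rw [mul_pow, sq_abs]; ring
    _ ≤ 4 * (W / δ) * (δ * Z) := by rw [mul_assoc, div_mul_eq_mul_div,
          mul_div_assoc, mul_div_cancel_left₀ _ hδ.ne']; gcongr
    _ ≤ (W / δ + δ * Z) ^ 2 := four_mul_le_sq_add _ _

lemma sum_sub_sq_eq (e z : ι → ℝ) :
    ∑ i, (e i - z i) ^ 2 = ∑ i, e i ^ 2 - 2 * ∑ i, e i * z i + ∑ i, z i ^ 2 := by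
  simp only [sub_sq, Finset.sum_add_distrib, Finset.sum_sub_distrib, Finset.mul_sum, mul_assoc]

variable {e z : ι → ℝ} {W δ : ℝ}

lemma le_sum_sub_sq (hW : 0 ≤ W) (hδ : 0 < δ)
    (h : (∑ i, e i * z i) ^ 2 ≤ W * ∑ i, z i ^ 2) :
    ∑ i, e i ^ 2 - W / δ + (1 - δ) * ∑ i, z i ^ 2 ≤ ∑ i, (e i - z i) ^ 2 := by
  have := two_mul_abs_le_of_sq_le_mul hW (Finset.sum_nonneg fun i _ => sq_nonneg (z i)) hδ h
  rw [sum_sub_sq_eq]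
  linarith [le_abs_self (∑ i, e i * z i)]

lemma sum_sub_sq_le (hW : 0 ≤ W) (hδ : 0 < δ)
    (h : (∑ i, e i * z i) ^ 2 ≤ W * ∑ i, z i ^ 2) :
    ∑ i, (e i - z i) ^ 2 ≤ ∑ i, e i ^ 2 + W / δ + (1 + δ) * ∑ i, z i ^ 2 := by
  have := two_mul_abs_le_of_sq_le_mul hW (Finset.sum_nonneg fun i _ => sq_nonneg (z i)) hδ h
  rw [sum_sub_sq_eq]
  linarith [neg_abs_le (∑ i, e i * z i)]

lemma sum_sub_sq_le_of_mem_Icc {c b : ι → ℝ} {w : ℝ} (hb : b ∈ Set.Icc c fun i => c i + w) :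
    ∑ i, (b i - c i) ^ 2 ≤ Fintype.card ι * w ^ 2 := by
  calc ∑ i, (b i - c i) ^ 2 ≤ ∑ _i : ι, w ^ 2 :=
        Finset.sum_le_sum fun i _ => pow_le_pow_left₀ (sub_nonneg.2 (hb.1 i))
          (sub_le_iff_le_add'.2 (hb.2 i)) 2
    _ = Fintype.card ι * w ^ 2 := by simp

lemma sum_sq_le_two_mul_add (b c : ι → ℝ) :
    ∑ i, b i ^ 2 ≤ 2 * ∑ i, c i ^ 2 + 2 * ∑ i, (b i - c i) ^ 2 := by
  rw [Finset.mul_sum, Finset.mul_sum, ← Finset.sum_add_distrib]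
  exact Finset.sum_le_sum fun i _ => by nlinarith [sq_nonneg (b i - 2 * c i)]

lemma pow_card_le_prod_pow_of_mem_Icc {c b : ι → ℝ} {w b₀ : ℝ} (r : ℕ) (hb₀ : 0 ≤ b₀)
    (hc : ∀ i, b₀ ≤ |c i|) (hw : w ≤ b₀ / 2) (hb : b ∈ Set.Icc c fun i => c i + w) :
    ((b₀ / 2) ^ (2 * r)) ^ Fintype.card ι ≤ ∏ i, b i ^ (2 * r) := by
  have hle (i : ι) : b₀ / 2 ≤ |b i| := by
    have hsub : |b i - c i| ≤ b₀ / 2 :=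
      (abs_of_nonneg (sub_nonneg.2 (hb.1 i))).trans_le ((sub_le_iff_le_add'.2 (hb.2 i)).trans hw)
    have := abs_sub_abs_le_abs_sub (c i) (b i)
    rw [abs_sub_comm] at this
    linarith [hc i]
  calc ((b₀ / 2) ^ (2 * r)) ^ Fintype.card ι = ∏ _i : ι, (b₀ / 2) ^ (2 * r) := by simp
    _ ≤ ∏ i, |b i| ^ (2 * r) :=
        Finset.prod_le_prod (fun _ _ => by positivity) fun i _ =>
          pow_le_pow_left₀ (by positivity) (hle i) _
    _ = ∏ i, b i ^ (2 * r) := by simp only [(even_two_mul r).pow_abs]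

end SumSq

section Residual

variable {n p : ℕ} {X : Matrix (Fin n) (Fin p) ℝ} {ε W : ℝ} {t k : Model p} {β : Fin p → ℝ}
  {e : Fin n → ℝ}

lemma sum_residual_sq (X : Matrix (Fin n) (Fin p) ℝ) (k : Model p) (β : Fin p → ℝ)
    (e : Fin n → ℝ) (b : k → ℝ) :
    ∑ i, ((X *ᵥ β + e) i - (designSub X k *ᵥ b) i) ^ 2 =
      ∑ i, (e i - (X *ᵥ (extendZero k b - β)) i) ^ 2 := by
  refine Finset.sum_congr rfl fun i _ => ?_
  rw [designSub_mulVec, Matrix.mulVec_sub, Pi.add_apply, Pi.sub_apply]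
  ring

lemma sum_coe_sq_le (k : Model p) (β : Fin p → ℝ) : ∑ i : k, β i ^ 2 ≤ ∑ j, β j ^ 2 := by
  rw [Finset.sum_coe_sort k fun j => β j ^ 2]
  exact Finset.sum_le_univ_sum_of_nonneg fun _ => sq_nonneg _

lemma sum_ite_mul_sq_le {κ : ℝ} (hκ : 2 ≤ κ) (hβ : ∀ j ∉ t, β j = 0) (b : k → ℝ) :
    ∑ i : k, (if (i : Fin p) ∈ t then 1 else κ) * b i ^ 2 ≤
      2 * ∑ j, β j ^ 2 + κ * ∑ i : k, (b i - β i) ^ 2 := by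
  calc _ ≤ ∑ i : k, (2 * β i ^ 2 + κ * (b i - β i) ^ 2) := by
        refine Finset.sum_le_sum fun i _ => ?_
        split_ifs with hi
        · have : 2 * (b i - β i) ^ 2 ≤ κ * (b i - β i) ^ 2 := by gcongr
          nlinarith [sq_nonneg (b i - 2 * β i)]
        · simp [hβ i hi]
    _ ≤ _ := by
        rw [Finset.sum_add_distrib, ← Finset.mul_sum, ← Finset.mul_sum]
        gcongr
        exact sum_coe_sq_le k β

-- The squared error `n ε ∑ (b - β)²` pays for `κ ∑ (b - β)²`, for the weighted sum of squares of
-- `b` and, through the omitted covariates, for `κ ∑_{kᶜ} β²`.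
lemma le_residual_sum_sq (hX : EigenBound X ε) (hn : n ≠ 0) (hnε : 128 ≤ n * ε)
    (hk : (k ∪ t).card ≤ n) (hβ : ∀ j ∉ t, β j = 0)
    (hW : ‖(columnSpan X t).starProjection (WithLp.toLp 2 e)‖ ^ 2 +
      ‖(residualSpan X t (k \ t)).starProjection (WithLp.toLp 2 e)‖ ^ 2 ≤ W) (b : k → ℝ) :
    (∑ i, e i ^ 2 - 64 / 61 * W - 2 * ∑ j, β j ^ 2 + n * ε / 64 * ∑ j ∈ kᶜ, β j ^ 2) +
        n * ε / 64 * ∑ i : k, (b i - β i) ^ 2 +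
        ∑ i : k, (if (i : Fin p) ∈ t then 1 else n * ε / 64) * b i ^ 2 ≤
      ∑ i, ((X *ᵥ β + e) i - (designSub X k *ᵥ b) i) ^ 2 := by
  have hsupp (j : Fin p) (hjt : j ∉ t) (hjk : j ∉ k) : (extendZero k b - β) j = 0 := by
    simp [extendZero_of_notMem b hjk, hβ j hjt]
  have herror : n * ε * (∑ i : k, (b i - β i) ^ 2 + ∑ j ∈ kᶜ, β j ^ 2) ≤
      ∑ i, (X *ᵥ (extendZero k b - β)) i ^ 2 := by
    rw [← sum_extendZero_sub_sq]
    exact hX.le_sum_mulVec_sq hn hk fun j hj =>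
      hsupp j (fun h => hj (Finset.mem_union_right k h)) fun h => hj (Finset.mem_union_left t h)
  have hcross : (∑ i, e i * (X *ᵥ (extendZero k b - β)) i) ^ 2 ≤
      W * ∑ i, (X *ᵥ (extendZero k b - β)) i ^ 2 :=
    (sum_mul_mulVec_sq_le X e fun j hjt hjk =>
      hsupp j hjt fun h => hjk (Finset.mem_sdiff.2 ⟨h, hjt⟩)).trans (by gcongr)
  have hlow := le_sum_sub_sq (δ := 61 / 64) (hW.trans' (by positivity)) (by norm_num) hcross
  have hpen := sum_ite_mul_sq_le (by linarith : 2 ≤ n * ε / 64) hβ b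
  have hkept : 0 ≤ n * ε * ∑ i : k, (b i - β i) ^ 2 := by positivity
  have homitted : 0 ≤ n * ε * ∑ j ∈ kᶜ, β j ^ 2 := by positivity
  rw [sum_residual_sq]
  linarith

lemma residual_sum_sq_le (hX : EigenBound X ε) (hn : n ≠ 0) (hε : 0 < ε)
    (hβ : ∀ j ∉ t, β j = 0) {a : ℝ} (ha : 0 ≤ a)
    (hW : ‖(columnSpan X t).starProjection (WithLp.toLp 2 e)‖ ^ 2 +
      ‖(residualSpan X t ∅).starProjection (WithLp.toLp 2 e)‖ ^ 2 ≤ W) {b : t → ℝ}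
    (hb : b ∈ Set.Icc (fun i : t => β i) fun i => β i + (√n)⁻¹) :
    ∑ i, ((X *ᵥ β + e) i - (designSub X t *ᵥ b) i) ^ 2 + a / n * ∑ i, b i ^ 2 ≤
      ∑ i, e i ^ 2 + W + 2 * (t.card * ε⁻¹) + a * (2 * ∑ j, β j ^ 2 + 2 * t.card) := by
  have hn' : (1 : ℝ) ≤ n := Nat.one_le_cast.2 (Nat.one_le_iff_ne_zero.2 hn)
  have hdist : ∑ i : t, (b i - β i) ^ 2 ≤ t.card * (n : ℝ)⁻¹ := by
    simpa using sum_sub_sq_le_of_mem_Icc hb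
  have herror : ∑ i, (X *ᵥ (extendZero t b - β)) i ^ 2 ≤ t.card * ε⁻¹ := by
    have hcompl : ∑ j ∈ tᶜ, β j ^ 2 = 0 := Finset.sum_eq_zero fun j hj => by
      rw [hβ j (Finset.mem_compl.1 hj), zero_pow two_ne_zero]
    calc _ ≤ n * ε⁻¹ * ∑ i : t, (b i - β i) ^ 2 := by
          have := hX.sum_mulVec_sq_le hn (extendZero t b - β)
          simpa only [Pi.sub_apply, sum_extendZero_sub_sq, hcompl, add_zero] using this
      _ ≤ n * ε⁻¹ * (t.card * (n : ℝ)⁻¹) := by gcongr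
      _ = t.card * ε⁻¹ := by field_simp
  have hcross : (∑ i, e i * (X *ᵥ (extendZero t b - β)) i) ^ 2 ≤
      W * ∑ i, (X *ᵥ (extendZero t b - β)) i ^ 2 :=
    (sum_mul_mulVec_sq_le X e fun j hjt _ => by
      simp [extendZero_of_notMem b hjt, hβ j hjt]).trans (by gcongr)
  have hup := sum_sub_sq_le (δ := 1) (hW.trans' (by positivity)) one_pos hcross
  have hcoef : a / n * ∑ i, b i ^ 2 ≤ a * (2 * ∑ j, β j ^ 2 + 2 * t.card) := by
    have hsum := sum_coe_sq_le t β
    have hcard : (t.card : ℝ) * (n : ℝ)⁻¹ ≤ t.card :=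
      mul_le_of_le_one_right (by positivity) (inv_le_one_of_one_le₀ hn')
    calc a / n * ∑ i, b i ^ 2 ≤ a * ∑ i, b i ^ 2 := by gcongr; exact div_le_self ha hn'
      _ ≤ _ := by gcongr; linarith [sum_sq_le_two_mul_add b fun i : t => β i]
  rw [sum_residual_sq]
  linarith

end Residual

/-! ### Comparison of the bounds on the marginal densities -/

section Gamma

-- Log-convexity of the Gamma function at the weights `1 / (1 + a)` and `a / (1 + a)`.
lemma Gamma_rpow_one_add_le {s t u a : ℝ} (hs : 0 < s) (ht : 0 < t) (ha : 0 < a)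
    (hu : (1 + a) * u = s + a * t) :
    Real.Gamma u ^ (1 + a) ≤ Real.Gamma s * Real.Gamma t ^ a := by
  have hΓs := Real.Gamma_pos_of_pos hs
  have hΓt := Real.Gamma_pos_of_pos ht
  have hu' : u = 1 / (1 + a) * s + a / (1 + a) * t := by field_simp; linarith
  have hu0 : 0 < u := by rw [hu']; positivity
  have hconv := Real.Gamma_mul_add_mul_le_rpow_Gamma_mul_rpow_Gamma (a := 1 / (1 + a))
    (b := a / (1 + a)) hs ht (by positivity) (by positivity) (by field_simp)
  rw [← hu'] at hconv
  refine (Real.rpow_le_rpow (Real.Gamma_pos_of_pos hu0).le hconv (by positivity)).trans_eq ?_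
  rw [Real.mul_rpow (by positivity) (by positivity), ← Real.rpow_mul hΓs.le,
    ← Real.rpow_mul hΓt.le, div_mul_cancel₀ _ (by positivity), div_mul_cancel₀ _ (by positivity),
    Real.rpow_one]

lemma Gamma_mul_rpow_le {N a : ℝ} (hN : 1 < N) (ha : 0 ≤ a) :
    Real.Gamma N * (N - 1) ^ a ≤ Real.Gamma (N + a) := by
  rcases ha.eq_or_lt with rfl | ha
  · simp
  have hN1 : 0 < N - 1 := sub_pos.2 hN
  have hΓ1 := Real.Gamma_pos_of_pos hN1
  have hconv := Gamma_rpow_one_add_le (u := N) (by linarith : 0 < N + a) hN1 ha (by ring)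
  have hrec : Real.Gamma N = (N - 1) * Real.Gamma (N - 1) := by
    simpa using Real.Gamma_add_one hN1.ne'
  rw [Real.rpow_add (Real.Gamma_pos_of_pos (by linarith)), Real.rpow_one] at hconv
  nth_rw 2 [hrec] at hconv
  rw [Real.mul_rpow hN1.le hΓ1.le, ← mul_assoc] at hconv
  exact le_of_mul_le_mul_right hconv (by positivity)

lemma Gamma_add_le {N a : ℝ} (hN : 0 < N) (ha : 0 ≤ a) :
    Real.Gamma (N + a) ≤ Real.Gamma N * (N + a) ^ a := by
  rcases ha.eq_or_lt with rfl | ha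
  · simp
  have hNa : 0 < N + a := by positivity
  have hΓ := Real.Gamma_pos_of_pos hNa
  have hconv := Gamma_rpow_one_add_le (u := N + a) hN (by linarith : 0 < N + a + 1) ha (by ring)
  rw [Real.Gamma_add_one hNa.ne', Real.mul_rpow hNa.le hΓ.le, Real.rpow_add hΓ, Real.rpow_one,
    ← mul_assoc] at hconv
  exact le_of_mul_le_mul_right hconv (by positivity)

lemma Gamma_mul_rpow_neg_le {N x B c : ℝ} (hN : 1 < N) (hx : 0 ≤ x) (hB : 0 < B)
    (hBc : B ≤ c * (N - 1)) :
    Real.Gamma N * B ^ (-N) ≤ c ^ x * (Real.Gamma (N + x) * B ^ (-(N + x))) := by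
  have hN1 : 0 < N - 1 := sub_pos.2 hN
  have hc : 0 < c := pos_of_mul_pos_left (hB.trans_le hBc) hN1.le
  have := Real.Gamma_pos_of_pos (by linarith : 0 < N)
  calc Real.Gamma N * B ^ (-N) = Real.Gamma N * (B ^ x * B ^ (-(N + x))) := by
        rw [← Real.rpow_add hB]
        ring_nf
    _ ≤ Real.Gamma N * ((c * (N - 1)) ^ x * B ^ (-(N + x))) := by gcongr
    _ = c ^ x * (Real.Gamma N * (N - 1) ^ x * B ^ (-(N + x))) := by
        rw [Real.mul_rpow hc.le hN1.le]
        ring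
    _ ≤ _ := by gcongr; exact Gamma_mul_rpow_le hN hx

lemma rpow_neg_le_mul_exp {B B' N : ℝ} (hB : 0 < B) (hB' : 0 < B') (hN : 0 ≤ N) :
    B ^ (-N) ≤ B' ^ (-N) * Real.exp (N * ((B' - B) / B)) := by
  have hlog : Real.log B' - Real.log B ≤ (B' - B) / B := by
    rw [← Real.log_div hB'.ne' hB.ne', sub_div, div_self hB.ne']
    exact Real.log_le_sub_one_of_pos (by positivity)
  rw [Real.rpow_def_of_pos hB, Real.rpow_def_of_pos hB', ← Real.exp_add, Real.exp_le_exp]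
  linarith [mul_le_mul_of_nonneg_left hlog hN]

end Gamma

lemma marginalUpper_pos {r n m : ℕ} {g κ Λ : ℝ} (hn : n ≠ 0) (hg : 0 < g) (hκ : 0 < κ)
    (hΛ : 0 < Λ) : 0 < marginalUpper r n g κ m Λ := by
  have : (0 : ℝ) < n := by positivity
  have := Real.pi_pos
  have := Real.Gamma_pos_of_pos (by positivity : (0 : ℝ) < (r + 1 / 2) * m + 1 / 2)
  unfold marginalUpper
  positivity

lemma marginalLower_pos {r n m : ℕ} {G w ρ : ℝ} (hn : n ≠ 0) (hG : 0 < G) (hw : 0 < w)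
    (hρ : 0 < ρ) : 0 < marginalLower r n G m w ρ := by
  unfold marginalLower
  positivity

/-- The constant in the upper bound `log_marginalUpper_le` on the logarithm of `marginalUpper`. -/
def upperConst (r : ℕ) (g : ℝ) : ℝ :=
  |Real.log g| + |Real.log (Real.Gamma (1 / 2))| + Real.log (2 ^ r * r.factorial) +
    1 / 2 * Real.log (2 * Real.pi) + (r + 1 / 2) * Real.log (r + 1) +
    (r + 1) * (Real.log 2 + (1 + Real.log 64))

/-- The constant in the lower bound `mul_log_le_log_marginalLower_add` on the logarithm of
`marginalLower`; the term with `M` pays for the shift of the exponent in `Gamma_mul_rpow_neg_le`. -/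
def lowerConst (r T₀ : ℕ) (G d M : ℝ) : ℝ :=
  T₀ * (|Real.log G| + |Real.log d| + (r + 1 / 2) * (Real.log 2 + Real.log (4 * M))) +
    3 / 2 * Real.log 2 + 1 / 2

lemma one_le_two_pow_mul_factorial (r : ℕ) : (1 : ℝ) ≤ 2 ^ r * r.factorial :=
  one_le_mul_of_one_le_of_one_le (one_le_pow₀ one_le_two) (Nat.one_le_cast.2 r.factorial_pos)

lemma upperConst_nonneg (r : ℕ) (g : ℝ) : 0 ≤ upperConst r g := by
  have := Real.log_nonneg (one_le_two_pow_mul_factorial r)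
  have := Real.log_nonneg (by linarith [Real.pi_gt_three] : 1 ≤ 2 * Real.pi)
  have := Real.log_nonneg (by linarith [r.cast_nonneg (α := ℝ)] : (1 : ℝ) ≤ r + 1)
  unfold upperConst
  positivity

lemma lowerConst_nonneg (r T₀ : ℕ) (G d : ℝ) {M : ℝ} (hM : 1 ≤ M) :
    0 ≤ lowerConst r T₀ G d M := by
  have := Real.log_nonneg (by linarith : 1 ≤ 4 * M)
  unfold lowerConst
  positivity

lemma log_Gamma_add_half_le (r m : ℕ) :
    Real.log (Real.Gamma ((r + 1 / 2) * m + 1 / 2)) ≤ |Real.log (Real.Gamma (1 / 2))| +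
      (r + 1 / 2) * m * (Real.log (r + 1) + Real.log m) := by
  rcases m.eq_zero_or_pos with rfl | hm
  · simpa using le_abs_self _
  have hm' : (1 : ℝ) ≤ m := Nat.one_le_cast.2 hm
  have hΓ := Real.Gamma_pos_of_pos (one_half_pos (α := ℝ))
  set x : ℝ := (r + 1 / 2) * m with hx
  have hx1 : 1 / 2 + x ≤ (r + 1) * m := by rw [hx]; linarith
  have hle : Real.Gamma (x + 1 / 2) ≤ Real.Gamma (1 / 2) * ((r + 1) * m) ^ x := by
    rw [add_comm x]
    refine (Gamma_add_le one_half_pos (by positivity)).trans ?_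
    gcongr
  calc Real.log (Real.Gamma (x + 1 / 2))
      ≤ Real.log (Real.Gamma (1 / 2) * ((r + 1) * m) ^ x) :=
        Real.log_le_log (Real.Gamma_pos_of_pos (by positivity)) hle
    _ = Real.log (Real.Gamma (1 / 2)) + x * (Real.log (r + 1) + Real.log m) := by
        rw [Real.log_mul hΓ.ne' (by positivity), Real.log_rpow (by positivity),
          Real.log_mul (by positivity) (by positivity)]
    _ ≤ _ := by gcongr; exact le_abs_self _

lemma log_marginalUpper_eq {r n m s : ℕ} {g κ : ℝ} (hn : n ≠ 0) (hg : 0 < g) (hκ : 0 < κ) :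
    Real.log (marginalUpper r n g κ m ((κ⁻¹ ^ r) ^ s)) =
      -(m * Real.log g) + (Real.log (Real.Gamma ((r + 1 / 2) * m + 1 / 2)) -
        ((r + 1 / 2) * m + 1 / 2) * (Real.log n - Real.log 2)) +
      (m * Real.log (2 ^ r * r.factorial) +
        m / 2 * (Real.log (2 * Real.pi) - Real.log κ) - r * s * Real.log κ) := by
  have hn' : (0 : ℝ) < n := by positivity
  have := Real.pi_pos
  have hΓ := Real.Gamma_pos_of_pos (by positivity : (0 : ℝ) < (r + 1 / 2) * m + 1 / 2)
  rw [marginalUpper, Real.log_mul (by positivity) (by positivity),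
    Real.log_mul (by positivity) (by positivity), Real.log_mul hΓ.ne' (by positivity),
    Real.log_mul (by positivity) (by positivity), Real.log_inv, Real.log_pow,
    Real.log_rpow (by positivity), Real.log_div hn'.ne' two_ne_zero, Real.log_pow,
    Real.log_mul (x := 2 ^ r * _) (by positivity) (by positivity), Real.log_sqrt (by positivity),
    Real.log_div (by positivity) hκ.ne', Real.log_pow, Real.log_pow, Real.log_inv]
  ring

lemma mul_add_add_mul_le {K₁ K₀ R c m l : ℝ} (hK₁ : 0 ≤ K₁) (hK₀ : 0 ≤ K₀) (hR : 0 ≤ R)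
    (hc : 0 ≤ c) (hm : 0 ≤ m) (hl : 0 ≤ l) :
    m * K₁ + K₀ + R * m * (l + c) ≤ (K₁ + K₀ + R * (1 + c)) * (1 + m) * (1 + l) := by
  have : 0 ≤ m * l := by positivity
  have h₁ : 0 ≤ K₁ * (1 + l + m * l) := by positivity
  have h₀ : 0 ≤ K₀ * (m + l + m * l) := by positivity
  have hR' : 0 ≤ R * (1 + c + l + m + m * (l * c) + l * c) := by positivity
  linarith

lemma log_marginalUpper_le {r n m s : ℕ} {g ε : ℝ} (hn : n ≠ 0) (hg : 0 < g) (hε : 0 < ε)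
    (hε1 : ε < 1) (hs : s ≤ m) :
    Real.log (marginalUpper r n g (n * ε / 64) m (((n * ε / 64)⁻¹ ^ r) ^ s)) ≤
      upperConst r g * (1 + m) * (1 + Real.log ε⁻¹) +
        (r + 1 / 2) * m * (Real.log m - Real.log n) - (r * s + m / 2) * Real.log n -
        1 / 2 * Real.log n := by
  have hn' : (0 : ℝ) < n := by positivity
  have hlogκ : Real.log (n * ε / 64) = Real.log n - (Real.log ε⁻¹ + Real.log 64) := by
    rw [Real.log_div (by positivity) (by norm_num), Real.log_mul hn'.ne' hε.ne', Real.log_inv]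
    ring
  rw [log_marginalUpper_eq hn hg (by positivity), hlogκ]
  have hℓ : 0 ≤ Real.log ε⁻¹ := Real.log_nonneg ((one_le_inv₀ hε).2 hε1.le)
  have hΓ := log_Gamma_add_half_le r m
  have hlogg : -(m * Real.log g) ≤ m * |Real.log g| := by
    rw [← mul_neg]; gcongr; exact neg_le_abs _
  have hs' : (r * s + m / 2) * (Real.log ε⁻¹ + Real.log 64) ≤
      (r + 1) * m * (Real.log ε⁻¹ + Real.log 64) := by
    gcongr
    have : (s : ℝ) ≤ m := Nat.cast_le.2 hs
    nlinarith [r.cast_nonneg (α := ℝ)]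
  have hlr := Real.log_nonneg (by linarith [r.cast_nonneg (α := ℝ)] : (1 : ℝ) ≤ r + 1)
  have hlf := Real.log_nonneg (one_le_two_pow_mul_factorial r)
  have hlπ := Real.log_nonneg (by linarith [Real.pi_gt_three] : 1 ≤ 2 * Real.pi)
  have hlin := mul_add_add_mul_le (m := m) (K₁ := |Real.log g| + Real.log (2 ^ r * r.factorial) +
    1 / 2 * Real.log (2 * Real.pi) + (r + 1 / 2) * (Real.log (r + 1) + Real.log 2))
    (K₀ := |Real.log (Real.Gamma (1 / 2))| + 1 / 2 * Real.log 2) (R := r + 1)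
    (c := Real.log 64) (by positivity) (by positivity) (by positivity) (by positivity)
    (by positivity) hℓ
  unfold upperConst
  linarith

lemma log_marginalLower_eq {r n T : ℕ} {G d : ℝ} (hn : n ≠ 0) (hG : 0 < G) (hd : 0 < d) :
    Real.log (marginalLower r n G T (√n)⁻¹ (d ^ T)) =
      -(T * Real.log G) + (Real.log n - ((r + 1 / 2) * T + 3 / 2) * (Real.log 2 + Real.log n) -
        1 / 2) + (T * Real.log d - T / 2 * Real.log n) := by
  have hn' : (0 : ℝ) < n := by positivity
  rw [marginalLower, Real.log_mul (by positivity) (by positivity),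
    Real.log_mul (by positivity) (by positivity), Real.log_mul (by positivity) (by positivity),
    Real.log_mul (by positivity) (by positivity), Real.log_mul (by positivity) (by positivity),
    Real.log_rpow (by positivity), Real.log_mul two_ne_zero hn'.ne', Real.log_exp, Real.log_inv,
    Real.log_pow, Real.log_pow, Real.log_pow, Real.log_inv, Real.log_sqrt hn'.le]
  ring

lemma mul_log_le_log_marginalLower_add {r n T T₀ : ℕ} {G d M : ℝ} (hn : n ≠ 0) (hG : 0 < G)
    (hd : 0 < d) (hM : 1 ≤ M) (hT : T ≤ T₀) :
    (r + 1 / 2) * T * Real.log (4 * M) ≤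
      Real.log (marginalLower r n G T (√n)⁻¹ (d ^ T)) + lowerConst r T₀ G d M +
        (r + 1) * T * Real.log n + 1 / 2 * Real.log n := by
  have hlM := Real.log_nonneg (by linarith : 1 ≤ 4 * M)
  have hterms : T * Real.log G - T * Real.log d +
      (r + 1 / 2) * T * (Real.log 2 + Real.log (4 * M)) ≤
      T₀ * (|Real.log G| + |Real.log d| + (r + 1 / 2) * (Real.log 2 + Real.log (4 * M))) :=
    calc _ = T * (Real.log G + -Real.log d + (r + 1 / 2) * (Real.log 2 + Real.log (4 * M))) := by
          ring
      _ ≤ T * (|Real.log G| + |Real.log d| +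
          (r + 1 / 2) * (Real.log 2 + Real.log (4 * M))) := by
          gcongr
          exacts [le_abs_self _, neg_le_abs _]
      _ ≤ _ := by gcongr
  rw [log_marginalLower_eq hn hG hd]
  unfold lowerConst
  linarith

/-- The logarithm of the bound on the posterior odds of a model with `m` covariates, `s` of them
spurious, against a true model with `T` covariates, up to the contribution of the residual sums
of squares. -/
def oddsExponent (K : ℝ) (r n m s T : ℕ) (ε : ℝ) : ℝ :=
  K * (1 + m) * (1 + Real.log ε⁻¹) + (r + 1 / 2) * m * (Real.log m - Real.log n) -
    (r * s + m / 2) * Real.log n + (r + 1) * T * Real.log n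

lemma marginalUpper_mul_le {r n m s T T₀ : ℕ} {g G d M ε : ℝ} (hn : n ≠ 0) (hg : 0 < g)
    (hG : 0 < G) (hd : 0 < d) (hM : 1 ≤ M) (hε : 0 < ε) (hε1 : ε < 1) (hs : s ≤ m) (hT : T ≤ T₀) :
    marginalUpper r n g (n * ε / 64) m (((n * ε / 64)⁻¹ ^ r) ^ s) *
        (4 * M) ^ ((r + 1 / 2) * T : ℝ) ≤
      marginalLower r n G T (√n)⁻¹ (d ^ T) *
        Real.exp (oddsExponent (upperConst r g + lowerConst r T₀ G d M) r n m s T ε) := by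
  have : (0 : ℝ) < n := by positivity
  have hU := marginalUpper_pos (r := r) (m := m) hn hg (by positivity : 0 < n * ε / 64)
    (by positivity : 0 < ((n * ε / 64)⁻¹ ^ r) ^ s)
  have hL := marginalLower_pos (r := r) (m := T) hn hG (by positivity : 0 < (√n)⁻¹)
    (by positivity : 0 < d ^ T)
  have hlogU := log_marginalUpper_le (r := r) hn hg hε hε1 hs
  have hlogL := mul_log_le_log_marginalLower_add (r := r) hn hG hd hM hT
  have hC := lowerConst_nonneg r T₀ G d hM
  have hℓ : 0 ≤ Real.log ε⁻¹ := Real.log_nonneg ((one_le_inv₀ hε).2 hε1.le)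
  have hgrow : lowerConst r T₀ G d M ≤
      lowerConst r T₀ G d M * ((1 + m) * (1 + Real.log ε⁻¹)) :=
    le_mul_of_one_le_right hC (one_le_mul_of_one_le_of_one_le (by linarith [m.cast_nonneg (α := ℝ)])
      (by linarith))
  rw [← Real.log_le_log_iff (by positivity) (by positivity), Real.log_mul hU.ne' (by positivity),
    Real.log_mul hL.ne' (by positivity), Real.log_rpow (by positivity), Real.log_exp]
  unfold oddsExponent
  linarith

lemma marginalUpper_mul_Gamma_le {r n m s T T₀ : ℕ} {g G d M ε N B B' : ℝ} (hn : n ≠ 0)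
    (hg : 0 < g) (hG : 0 < G) (hd : 0 < d) (hM : 1 ≤ M) (hε : 0 < ε) (hε1 : ε < 1) (hs : s ≤ m)
    (hT : T ≤ T₀) (hN : 1 < N) (hB : 0 < B) (hB' : 0 < B') (hB'M : B' ≤ 4 * M * (N - 1)) :
    marginalUpper r n g (n * ε / 64) m (((n * ε / 64)⁻¹ ^ r) ^ s) * (Real.Gamma N * B ^ (-N)) ≤
      Real.exp (oddsExponent (upperConst r g + lowerConst r T₀ G d M) r n m s T ε +
        N * ((B' - B) / B)) *
      (marginalLower r n G T (√n)⁻¹ (d ^ T) *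
        (Real.Gamma (N + (r + 1 / 2) * T) * B' ^ (-(N + (r + 1 / 2) * T)))) := by
  have hU := marginalUpper_pos (r := r) (m := m) hn hg (by positivity : 0 < n * ε / 64)
    (by positivity : 0 < ((n * ε / 64)⁻¹ ^ r) ^ s)
  have := Real.Gamma_pos_of_pos (by linarith : 0 < N)
  have hΓ' := Real.Gamma_pos_of_pos (by positivity : 0 < N + (r + 1 / 2) * T)
  set U := marginalUpper r n g (n * ε / 64) m (((n * ε / 64)⁻¹ ^ r) ^ s)
  set x : ℝ := (r + 1 / 2) * T
  set E := Real.exp (N * ((B' - B) / B))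
  calc U * (Real.Gamma N * B ^ (-N))
      ≤ U * (Real.Gamma N * (B' ^ (-N) * E)) := by
        gcongr; exact rpow_neg_le_mul_exp hB hB' (by linarith)
    _ = U * (Real.Gamma N * B' ^ (-N)) * E := by ring
    _ ≤ U * ((4 * M) ^ x * (Real.Gamma (N + x) * B' ^ (-(N + x)))) * E := by
        gcongr _ * ?_ * _
        exact Gamma_mul_rpow_neg_le hN (by positivity) hB' hB'M
    _ = U * (4 * M) ^ x * (Real.Gamma (N + x) * B' ^ (-(N + x))) * E := by ring
    _ ≤ marginalLower r n G T (√n)⁻¹ (d ^ T) * Real.exp _ *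
        (Real.Gamma (N + x) * B' ^ (-(N + x))) * E := by
        gcongr ?_ * _ * _
        exact marginalUpper_mul_le hn hg hG hd hM hε hε1 hs hT
    _ = _ := by rw [Real.exp_add]; ring

/-! ### Posterior odds under tame noise -/

section Odds

variable {K D : ℝ} {r n m s T T₀ : ℕ} {ε : ℝ}

lemma oddsExponent_add_le_of_superset (hK : 0 ≤ K) (hr : 1 ≤ r) (hs : 1 ≤ s) (hT : T ≤ T₀)
    (hm : m = T + s) (hmn : Real.log m ≤ Real.log n) (hε : 0 ≤ Real.log ε⁻¹)
    (hn : 8 * ((2 + T₀) * (K + (r + 1) * T₀)) * (1 + Real.log ε⁻¹) ≤ Real.log n)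
    (hD : D ≤ 5 / 4 * (Real.log n * s)) :
    oddsExponent K r n m s T ε + D ≤ -(Real.log n / 8) := by
  have hr' : (1 : ℝ) ≤ r := Nat.one_le_cast.2 hr
  have hs' : (1 : ℝ) ≤ s := Nat.one_le_cast.2 hs
  have hT' : (T : ℝ) ≤ T₀ := Nat.cast_le.2 hT
  have hm' : (m : ℝ) = T + s := by rw [hm, Nat.cast_add]
  have hm1 : 1 + m ≤ (2 + T₀) * (s : ℝ) := by nlinarith
  have hL := Real.log_natCast_nonneg n
  unfold oddsExponent
  set L := Real.log n
  set l := Real.log ε⁻¹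
  have hmlog : m * Real.log m ≤ s * L + T₀ * m :=
    calc m * Real.log m = s * Real.log m + T * Real.log m := by rw [hm']; ring
      _ ≤ s * L + T₀ * m := by
        gcongr
        exact Real.log_le_self m.cast_nonneg
  have hsmall : K * (1 + m) * (1 + l) + (r + 1 / 2) * (T₀ * m) ≤ s * (L / 8) :=
    calc K * (1 + m) * (1 + l) + (r + 1 / 2) * (T₀ * m)
        ≤ K * (1 + m) * (1 + l) + (r + 1) * (T₀ * (1 + m)) * (1 + l) := by
          rw [mul_assoc (r + 1 : ℝ)]
          gcongr _ + ?_ * ?_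
          exacts [by linarith, by nlinarith [mul_nonneg (T₀.cast_nonneg (α := ℝ)) hε]]
      _ = (1 + m) * ((K + (r + 1) * T₀) * (1 + l)) := by ring
      _ ≤ (2 + T₀) * s * ((K + (r + 1) * T₀) * (1 + l)) := by gcongr
      _ = s * (8 * ((2 + T₀) * (K + (r + 1) * T₀)) * (1 + l) / 8) := by ring
      _ ≤ _ := by gcongr
  have hrmlog := mul_le_mul_of_nonneg_left hmlog (by positivity : (0 : ℝ) ≤ r + 1 / 2)
  have hrsL : 1 * (s * L) ≤ r * (s * L) := by gcongr
  have hsL : 1 * L ≤ s * L := by gcongr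
  have hsplit : (r + 1 / 2) * m * (Real.log m - L) - (r * s + m / 2) * L + (r + 1) * T * L =
      (r + 1 / 2) * (m * Real.log m) - (2 * r + 1) * (s * L) := by rw [hm']; ring
  linarith

lemma oddsExponent_add_le_of_le_neg {q x : ℝ} (hK : 0 ≤ K) (hT : T ≤ T₀) (hmq : m ≤ q)
    (hmn : Real.log m ≤ Real.log n) (hε : 1 + Real.log ε⁻¹ ≤ Real.log n)
    (hx : (K + (r + 1) * T₀ + 1) * (1 + q) * Real.log n ≤ x) (hD : D ≤ -x) :
    oddsExponent K r n m s T ε + D ≤ -(Real.log n / 8) := by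
  have hL := Real.log_natCast_nonneg n
  have hT' : (T : ℝ) ≤ T₀ := Nat.cast_le.2 hT
  have hq : 0 ≤ q := m.cast_nonneg.trans hmq
  unfold oddsExponent
  have hmain : K * (1 + m) * (1 + Real.log ε⁻¹) ≤ K * (1 + q) * Real.log n :=
    calc K * (1 + m) * (1 + Real.log ε⁻¹) ≤ K * (1 + m) * Real.log n := by gcongr
      _ ≤ _ := by gcongr
  have hlog : (r + 1 / 2) * m * (Real.log m - Real.log n) ≤ 0 :=
    mul_nonpos_of_nonneg_of_nonpos (by positivity) (by linarith)
  have hspur : 0 ≤ (r * s + m / 2) * Real.log n := by positivity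
  have htrue : (r + 1) * T * Real.log n ≤ (r + 1) * T₀ * Real.log n := by gcongr
  have hslack : 0 ≤ ((r + 1) * T₀ + 1) * q * Real.log n := by positivity
  linarith

lemma mul_div_le_of_le_mul {N B B' x y c : ℝ} (hB : 0 < B) (hN : 0 ≤ N) (hdiff : B' - B ≤ x)
    (hx : N * x ≤ c * y) (hyB : y ≤ B) (hc : 0 ≤ c) : N * ((B' - B) / B) ≤ c := by
  rw [← mul_div_assoc, div_le_iff₀ hB]
  calc N * (B' - B) ≤ N * x := by gcongr
    _ ≤ c * y := hx
    _ ≤ c * B := by gcongr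

lemma mul_div_le_neg_div {N B B' n M x : ℝ} (hM : 0 < M) (hx : 0 ≤ x) (hB : 0 < B)
    (hBn : B ≤ M * n) (hN : n / 2 ≤ N) (hdiff : B' - B ≤ -x) :
    N * ((B' - B) / B) ≤ -(x / (2 * M)) := by
  have hN0 : 0 ≤ N := by have := pos_of_mul_pos_right (hB.trans_le hBn) hM.le; linarith
  rw [← mul_div_assoc, div_le_iff₀ hB]
  calc N * (B' - B) ≤ N * -x := by gcongr
    _ ≤ n / 2 * -x := mul_le_mul_of_nonpos_right hN (by linarith)
    _ = -(x / (2 * M)) * (M * n) := by field_simp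
    _ ≤ -(x / (2 * M)) * B := mul_le_mul_of_nonpos_left hBn (neg_nonpos.2 (by positivity))

end Odds

/-- The rate, in the upper bound for the marginal density of the model `k`, of the Inverse-Gamma
integral over `σ²`: the penalized residual sum of squares of `k` is bounded below under tame
noise of variance `v`. -/
def rateLower {n p : ℕ} (α₂ ε v : ℝ) (t k : Model p) (β : Fin p → ℝ) (e : Fin n → ℝ) : ℝ :=
  α₂ + (∑ i, e i ^ 2 -
    64 / 61 * (v / 64 * Real.log n + 2 * v * (67 / 64 * ((k \ t).card * Real.log n))) -
    2 * ∑ j, β j ^ 2 + n * ε / 64 * ∑ j ∈ kᶜ, β j ^ 2) / 2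

/-- The rate, in the lower bound for the marginal density of the true model `t`, of the
Inverse-Gamma integral over `σ²`: the penalized residual sum of squares of `t` is bounded above
on a small box at the true coefficients. -/
def rateUpper {n p : ℕ} (α₂ ε v a : ℝ) (t : Model p) (β : Fin p → ℝ) (e : Fin n → ℝ) : ℝ :=
  α₂ + (∑ i, e i ^ 2 + v / 64 * Real.log n + 2 * (t.card * ε⁻¹) +
    a * (2 * ∑ j, β j ^ 2 + 2 * t.card)) / 2

/-- `β` is supported on `t`, its entries on `t` are at least `b₀` in absolute value, and `T₀` and
`S₀` bound the size of `t` and the squared norm of `β`. -/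
structure SignalBounds {p : ℕ} (t : Model p) (β : Fin p → ℝ) (T₀ : ℕ) (b₀ S₀ : ℝ) : Prop where
  support : ∀ j ∉ t, β j = 0
  le_abs : ∀ j ∈ t, b₀ ≤ |β j|
  card_le : t.card ≤ T₀
  sum_sq_le : ∑ j, β j ^ 2 ≤ S₀

/-- Requirements on the constant `C` in `LargeSample`; `a` bounds the eigenvalues of the scale
matrix, `v` is the error variance, `K` and `M` are as in `oddsExponent` and `lowerConst`. -/
structure LargeConst (r T₀ : ℕ) (α₁ a v b₀ S₀ K M C : ℝ) : Prop where
  le : 640 ≤ C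
  card : (T₀ : ℝ) + 1 ≤ C
  shape : 128 * α₁ ≤ C
  drift : 64 * (2 * T₀ + a * (2 * S₀ + 2 * T₀) + 2 * S₀) ≤ C * v
  signal : 4 ≤ C * b₀ ^ 2
  noise : 384 * v ≤ C * b₀ ^ 2
  superset : 8 * ((2 + T₀) * (K + (r + 1) * T₀)) ≤ C
  omitted : (K + (r + 1) * T₀ + 1) * (512 * M) ≤ C * b₀ ^ 2

/-- The sample size `n` is large relative to the constant `C`, the maximal model size `q` and the
eigenvalue bound `ε`. -/
structure LargeSample (C q ε : ℝ) (n : ℕ) : Prop where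
  pos : 0 < ε
  lt_one : ε < 1
  nonneg : 0 ≤ q
  le_mul : C * ((1 + q) * Real.log n) ≤ n * ε
  le_log : C * (1 + ε⁻¹) ≤ Real.log n

lemma exists_largeConst (r T₀ : ℕ) (α₁ a S₀ K M : ℝ) {v b₀ : ℝ} (hv : 0 < v) (hb₀ : 0 < b₀) :
    ∃ C, LargeConst r T₀ α₁ a v b₀ S₀ K M C := by
  have hid := tendsto_id (α := ℝ) (x := atTop)
  have hsq := hid.atTop_mul_const (by positivity : 0 < b₀ ^ 2)
  have hC : ∀ᶠ C : ℝ in atTop, LargeConst r T₀ α₁ a v b₀ S₀ K M C := by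
    filter_upwards [hid.eventually_ge_atTop _, hid.eventually_ge_atTop _,
      hid.eventually_ge_atTop _, (hid.atTop_mul_const hv).eventually_ge_atTop _,
      hsq.eventually_ge_atTop _, hsq.eventually_ge_atTop _, hid.eventually_ge_atTop _,
      hsq.eventually_ge_atTop _] with C h₁ h₂ h₃ h₄ h₅ h₆ h₇ h₈
    exact ⟨h₁, h₂, h₃, h₄, h₅, h₆, h₇, h₈⟩
  exact hC.exists

section LargeSample

variable {n r T₀ : ℕ} {α₁ a v b₀ S₀ K M C q ε : ℝ}

lemma LargeSample.one_le_inv (h : LargeSample C q ε n) : 1 ≤ ε⁻¹ :=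
  (one_le_inv₀ h.pos).2 h.lt_one.le

lemma LargeSample.le_log_natCast (h : LargeSample C q ε n) (hC : 0 ≤ C) : C ≤ Real.log n :=
  (le_mul_of_one_le_right hC (by linarith [h.one_le_inv])).trans h.le_log

lemma LargeSample.le_natCast (h : LargeSample C q ε n) (hC : 0 ≤ C) : C ≤ n :=
  (h.le_log_natCast hC).trans (Real.log_le_self n.cast_nonneg)

lemma LargeSample.mul_one_add_log_inv_le (h : LargeSample C q ε n) (hC : 0 ≤ C) :
    C * (1 + Real.log ε⁻¹) ≤ Real.log n :=
  (by gcongr; exact Real.log_le_self (inv_pos.2 h.pos).le :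
    C * (1 + Real.log ε⁻¹) ≤ C * (1 + ε⁻¹)).trans h.le_log

lemma LargeSample.mul_le_natCast (h : LargeSample C q ε n) :
    C * ((1 + q) * Real.log n) ≤ n :=
  h.le_mul.trans (mul_le_of_le_one_right n.cast_nonneg h.lt_one.le)

lemma LargeSample.mul_one_add_le (h : LargeSample C q ε n) (hC : 1 ≤ C) : C * (1 + q) ≤ n * ε := by
  have hlog := hC.trans (h.le_log_natCast (by linarith))
  have hq := h.nonneg
  refine le_trans ?_ h.le_mul
  gcongr
  exact le_mul_of_one_le_right (by positivity) hlog

lemma LargeConst.nonneg (h : LargeConst r T₀ α₁ a v b₀ S₀ K M C) : 0 ≤ C := by linarith [h.le]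

lemma LargeConst.one_le (h : LargeConst r T₀ α₁ a v b₀ S₀ K M C) : 1 ≤ C := by linarith [h.le]

lemma LargeConst.le_natCast (h : LargeConst r T₀ α₁ a v b₀ S₀ K M C)
    (hn : LargeSample C q ε n) : (640 : ℝ) ≤ n := h.le.trans (hn.le_natCast h.nonneg)

lemma LargeConst.ne_zero (h : LargeConst r T₀ α₁ a v b₀ S₀ K M C) (hn : LargeSample C q ε n) :
    n ≠ 0 := by
  rintro rfl
  have := h.le_natCast hn
  norm_num at this

lemma LargeConst.inv_sqrt_le (h : LargeConst r T₀ α₁ a v b₀ S₀ K M C)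
    (hn : LargeSample C q ε n) (hb₀ : 0 < b₀) : (√n)⁻¹ ≤ b₀ / 2 := by
  have hn' : (0 : ℝ) < n := by linarith [h.le_natCast hn]
  rw [inv_le_comm₀ (by positivity) (by positivity)]
  refine Real.le_sqrt_of_sq_le ?_
  rw [inv_div, div_pow, div_le_iff₀ (by positivity)]
  calc (2 : ℝ) ^ 2 ≤ C * b₀ ^ 2 := by linarith [h.signal]
    _ ≤ n * b₀ ^ 2 := by gcongr; exact hn.le_natCast h.nonneg

lemma LargeConst.le_mul (h : LargeConst r T₀ α₁ a v b₀ S₀ K M C) (hn : LargeSample C q ε n) :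
    128 ≤ n * ε := by
  have hq := hn.nonneg
  calc (128 : ℝ) ≤ C * 1 := by linarith [h.le]
    _ ≤ C * (1 + q) := by have := h.nonneg; gcongr; linarith
    _ ≤ n * ε := hn.mul_one_add_le h.one_le

lemma LargeConst.card_union_le {p : ℕ} {t k : Model p} (h : LargeConst r T₀ α₁ a v b₀ S₀ K M C)
    (hn : LargeSample C q ε n) (ht : t.card ≤ T₀) (hk : k.card ≤ q) : (k ∪ t).card ≤ n := by
  have hunion : ((k ∪ t).card : ℝ) ≤ k.card + t.card := mod_cast Finset.card_union_le k t
  have ht' : (t.card : ℝ) ≤ T₀ := Nat.cast_le.2 ht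
  have hq := hn.nonneg
  have hprod : (T₀ + 1) * (1 + q) ≤ C * (1 + q) := by gcongr; exact h.card
  have hn' := (hn.mul_one_add_le h.one_le).trans
    (mul_le_of_le_one_right n.cast_nonneg hn.lt_one.le)
  have hTq : 0 ≤ T₀ * q := by positivity
  exact_mod_cast (by linarith : ((k ∪ t).card : ℝ) ≤ n)

end LargeSample

/-- Over the sample size, this bounds both `rateLower` and `rateUpper`. -/
def rateConst (α₂ v S₀ : ℝ) : ℝ := 1 + α₂ + 2 * v + S₀

/-- The constant `K` of `oddsExponent` when comparing a model with the true one. -/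
def oddsConst (r T₀ : ℕ) (a₁ a b₀ M : ℝ) : ℝ :=
  upperConst r (gaussMoment r a) + lowerConst r T₀ (gaussMoment r a₁) ((b₀ / 2) ^ (2 * r)) M

section Rates

variable {n p r T₀ : ℕ} {α₁ α₂ a₁ a v b₀ S₀ K M C q ε : ℝ} {X : Matrix (Fin n) (Fin p) ℝ}
  {A : Matrix (Fin p) (Fin p) ℝ} {t k : Model p} {β : Fin p → ℝ} {e : Fin n → ℝ}

lemma SignalBounds.nonneg (hβ : SignalBounds t β T₀ b₀ S₀) : 0 ≤ S₀ :=
  (Finset.sum_nonneg fun _ _ => sq_nonneg _).trans hβ.sum_sq_le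

lemma SignalBounds.sq_le_sum_compl (hβ : SignalBounds t β T₀ b₀ S₀) (hb₀ : 0 ≤ b₀)
    (htk : ¬ t ⊆ k) : b₀ ^ 2 ≤ ∑ j ∈ kᶜ, β j ^ 2 := by
  obtain ⟨j, hjt, hjk⟩ := Finset.not_subset.1 htk
  calc b₀ ^ 2 ≤ |β j| ^ 2 := pow_le_pow_left₀ hb₀ (hβ.le_abs j hjt) 2
    _ = β j ^ 2 := sq_abs _
    _ ≤ ∑ j ∈ kᶜ, β j ^ 2 :=
      Finset.single_le_sum (fun j _ => sq_nonneg (β j)) (Finset.mem_compl.2 hjk)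

lemma drift_le (hC : LargeConst r T₀ α₁ a v b₀ S₀ K M C) (hn : LargeSample C q ε n)
    (hβ : SignalBounds t β T₀ b₀ S₀) (ha : 0 ≤ a) (hv : 0 ≤ v) :
    2 * (t.card * ε⁻¹) + a * (2 * ∑ j, β j ^ 2 + 2 * t.card) + 2 * ∑ j, β j ^ 2 ≤
      v / 64 * Real.log n := by
  have hT : (t.card : ℝ) ≤ T₀ := Nat.cast_le.2 hβ.card_le
  have hS := hβ.sum_sq_le
  have hS₀ := hβ.nonneg
  have hε := hn.one_le_inv
  calc _ ≤ 2 * (T₀ * ε⁻¹) + a * (2 * S₀ + 2 * T₀) + 2 * S₀ := by gcongr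
    _ ≤ (2 * T₀ + a * (2 * S₀ + 2 * T₀) + 2 * S₀) * (1 + ε⁻¹) := by
      have : 0 ≤ (a * (2 * S₀ + 2 * T₀) + 2 * S₀) * ε⁻¹ := by positivity
      linarith [T₀.cast_nonneg (α := ℝ)]
    _ ≤ C * v / 64 * (1 + ε⁻¹) := by gcongr; linarith [hC.drift]
    _ = v / 64 * (C * (1 + ε⁻¹)) := by ring
    _ ≤ v / 64 * Real.log n := by gcongr; exact hn.le_log

lemma card_sdiff_mul_log_le (hC : LargeConst r T₀ α₁ a v b₀ S₀ K M C)
    (hn : LargeSample C q ε n) (hk : k.card ≤ q) :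
    640 * ((1 + (k \ t).card) * Real.log n) ≤ n := by
  have hs : ((k \ t).card : ℝ) ≤ q :=
    (Nat.cast_le.2 (Finset.card_le_card Finset.sdiff_subset)).trans hk
  have := Real.log_natCast_nonneg n
  have := hn.nonneg
  have hC0 := hC.nonneg
  calc _ ≤ C * ((1 + q) * Real.log n) := by gcongr; exact hC.le
    _ ≤ n := hn.mul_le_natCast

lemma rateUpper_pos (hα₂ : 0 < α₂) (hv : 0 ≤ v) (ha : 0 ≤ a) (hε : 0 < ε) :
    0 < rateUpper α₂ ε v a t β e := by
  have := Real.log_natCast_nonneg n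
  unfold rateUpper
  positivity

lemma rateUpper_le (hC : LargeConst r T₀ α₁ a v b₀ S₀ K M C) (hn : LargeSample C q ε n)
    (hβ : SignalBounds t β T₀ b₀ S₀) (he : TameNoise X t v e) (hα₂ : 0 ≤ α₂) (ha : 0 ≤ a)
    (hv : 0 ≤ v) : rateUpper α₂ ε v a t β e ≤ rateConst α₂ v S₀ * n := by
  have hn1 : (1 : ℝ) ≤ n := by linarith [hC.le_natCast hn]
  have hα₂n : α₂ ≤ α₂ * n := le_mul_of_one_le_right hα₂ hn1
  have hlog : v * Real.log n ≤ v * n := by gcongr; exact Real.log_le_self n.cast_nonneg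
  have hS : 0 ≤ ∑ j, β j ^ 2 := Finset.sum_nonneg fun _ _ => sq_nonneg _
  have hS₀ : 0 ≤ S₀ * n := mul_nonneg hβ.nonneg n.cast_nonneg
  have hvn : 0 ≤ v * n := by positivity
  unfold rateUpper rateConst
  linarith [drift_le hC hn hβ ha hv, he.upper]

lemma le_rateLower (hC : LargeConst r T₀ α₁ a v b₀ S₀ K M C) (hn : LargeSample C q ε n)
    (hβ : SignalBounds t β T₀ b₀ S₀) (he : TameNoise X t v e) (hα₂ : 0 ≤ α₂) (ha : 0 ≤ a)
    (hv : 0 ≤ v) (hk : k.card ≤ q) : 63 / 128 * (n * v) ≤ rateLower α₂ ε v t k β e := by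
  have hspurious := mul_le_mul_of_nonneg_left (card_sdiff_mul_log_le (t := t) hC hn hk) hv
  have hε := hn.pos
  have hdrift := drift_le hC hn hβ ha hv
  have : 0 ≤ 2 * (t.card * ε⁻¹) + a * (2 * ∑ j, β j ^ 2 + 2 * t.card) := by positivity
  have homitted : 0 ≤ n * ε / 64 * ∑ j ∈ kᶜ, β j ^ 2 := by positivity
  have hvL : 0 ≤ v * Real.log n := mul_nonneg hv (Real.log_natCast_nonneg n)
  have hvsL : 0 ≤ v * ((k \ t).card * Real.log n) :=
    mul_nonneg hv (mul_nonneg (Nat.cast_nonneg _) (Real.log_natCast_nonneg n))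
  unfold rateLower
  linarith [he.lower]

lemma rateLower_le (hC : LargeConst r T₀ α₁ a v b₀ S₀ K M C) (hn : LargeSample C q ε n)
    (hβ : SignalBounds t β T₀ b₀ S₀) (he : TameNoise X t v e) (hα₂ : 0 ≤ α₂) (hv : 0 ≤ v) :
    rateLower α₂ ε v t k β e ≤ rateConst α₂ v S₀ * n := by
  have hn1 : (1 : ℝ) ≤ n := by linarith [hC.le_natCast hn]
  have hα₂n : α₂ ≤ α₂ * n := le_mul_of_one_le_right hα₂ hn1
  have := Real.log_natCast_nonneg n
  have hS : 0 ≤ ∑ j, β j ^ 2 := Finset.sum_nonneg fun _ _ => sq_nonneg _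
  have hpenalty : 0 ≤ 64 / 61 *
      (v / 64 * Real.log n + 2 * v * (67 / 64 * ((k \ t).card * Real.log n))) := by positivity
  have homitted : n * ε * ∑ j ∈ kᶜ, β j ^ 2 ≤ S₀ * n := by
    have := hn.pos
    calc n * ε * ∑ j ∈ kᶜ, β j ^ 2 ≤ n * 1 * S₀ := by
          gcongr
          · exact hn.lt_one.le
          · exact (Finset.sum_le_sum_of_subset_of_nonneg (Finset.subset_univ _)
              fun _ _ _ => sq_nonneg _).trans hβ.sum_sq_le
      _ = S₀ * n := by ring
  have hS₀ : 0 ≤ S₀ * n := mul_nonneg hβ.nonneg n.cast_nonneg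
  have hvn : 0 ≤ v * n := by positivity
  unfold rateLower rateConst
  linarith [he.upper]

lemma rateUpper_sub_rateLower_le (hC : LargeConst r T₀ α₁ a v b₀ S₀ K M C)
    (hn : LargeSample C q ε n) (hβ : SignalBounds t β T₀ b₀ S₀) (ha : 0 ≤ a) (hv : 0 ≤ v) :
    rateUpper α₂ ε v a t β e - rateLower α₂ ε v t k β e ≤
      (61 / 1280 * (v * Real.log n) + 134 / 61 * (v * ((k \ t).card * Real.log n)) -
        n * ε / 64 * ∑ j ∈ kᶜ, β j ^ 2) / 2 := by
  have hvL : 0 ≤ v * Real.log n := mul_nonneg hv (Real.log_natCast_nonneg n)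
  unfold rateUpper rateLower
  linarith [drift_le hC hn hβ ha hv]

lemma rateUpper_sub_rateLower_le_of_ssubset (hC : LargeConst r T₀ α₁ a v b₀ S₀ K M C)
    (hn : LargeSample C q ε n) (hβ : SignalBounds t β T₀ b₀ S₀) (ha : 0 ≤ a) (hv : 0 ≤ v)
    (htk : t ⊂ k) :
    rateUpper α₂ ε v a t β e - rateLower α₂ ε v t k β e ≤
      9 / 8 * (v * ((k \ t).card * Real.log n)) := by
  have hs : (1 : ℝ) ≤ (k \ t).card := Nat.one_le_cast.2 (Finset.card_pos.2
    (Finset.sdiff_nonempty.2 (not_subset_of_ssubset htk)))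
  have hL := Real.log_natCast_nonneg n
  have hvL : v * Real.log n ≤ v * ((k \ t).card * Real.log n) := by
    gcongr; exact le_mul_of_one_le_left hL hs
  have hvsL : 0 ≤ v * ((k \ t).card * Real.log n) := by positivity
  have hε := hn.pos
  have homitted : 0 ≤ n * ε / 64 * ∑ j ∈ kᶜ, β j ^ 2 := by positivity
  linarith [rateUpper_sub_rateLower_le (α₂ := α₂) (e := e) (k := k) hC hn hβ ha hv]

lemma rateUpper_sub_rateLower_le_of_not_subset (hC : LargeConst r T₀ α₁ a v b₀ S₀ K M C)
    (hn : LargeSample C q ε n) (hβ : SignalBounds t β T₀ b₀ S₀) (ha : 0 ≤ a) (hv : 0 ≤ v)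
    (hb₀ : 0 ≤ b₀) (hk : k.card ≤ q) (htk : ¬ t ⊆ k) :
    rateUpper α₂ ε v a t β e - rateLower α₂ ε v t k β e ≤ -(n * ε * b₀ ^ 2 / 256) := by
  have := Real.log_natCast_nonneg n
  have hs : ((k \ t).card : ℝ) ≤ q :=
    (Nat.cast_le.2 (Finset.card_le_card Finset.sdiff_subset)).trans hk
  have hq := hn.nonneg
  have hε := hn.pos
  have hvs : v * ((k \ t).card * Real.log n) ≤ v * (q * Real.log n) := by gcongr
  have homitted : n * ε * b₀ ^ 2 ≤ n * ε * ∑ j ∈ kᶜ, β j ^ 2 := by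
    gcongr; exact hβ.sq_le_sum_compl hb₀ htk
  have hnoise : 384 * (v * ((1 + q) * Real.log n)) ≤ n * ε * b₀ ^ 2 :=
    calc _ = 384 * v * ((1 + q) * Real.log n) := by ring
      _ ≤ C * b₀ ^ 2 * ((1 + q) * Real.log n) :=
        mul_le_mul_of_nonneg_right hC.noise (by positivity)
      _ = C * ((1 + q) * Real.log n) * b₀ ^ 2 := by ring
      _ ≤ n * ε * b₀ ^ 2 := mul_le_mul_of_nonneg_right hn.le_mul (sq_nonneg _)
  have hvL : 0 ≤ v * Real.log n := by positivity
  have hvqL : 0 ≤ v * (q * Real.log n) := by positivity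
  linarith [rateUpper_sub_rateLower_le (α₂ := α₂) (e := e) (k := k) hC hn hβ ha hv]

end Rates

lemma prod_ite_inv_pow {p : ℕ} (k t : Model p) (κ : ℝ) (r : ℕ) :
    ∏ i : k, (if (i : Fin p) ∈ t then 1 else κ)⁻¹ ^ r = (κ⁻¹ ^ r) ^ (k \ t).card := by
  calc ∏ i : k, (if (i : Fin p) ∈ t then 1 else κ)⁻¹ ^ r
      = ∏ j ∈ k, if j ∈ t then 1 else κ⁻¹ ^ r := by
        rw [Finset.prod_coe_sort k fun j => (if j ∈ t then 1 else κ)⁻¹ ^ r]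
        exact Finset.prod_congr rfl fun j _ => by split_ifs <;> simp
    _ = (κ⁻¹ ^ r) ^ (k \ t).card := by
        rw [Finset.prod_ite, Finset.prod_const_one, one_mul, Finset.prod_const,
          Finset.filter_notMem_eq_sdiff]

/-- The weight `m t` is positive, the weights over `s` are finite, and `m t` dominates all of the
others by the factor `δ`: the form of the comparison of the true model `t` with the other models,
first for marginal densities and then for posterior probabilities. -/
structure Dominates {ι : Type*} (s : Set ι) (t : ι) (δ : ℝ≥0∞) (m : ι → ℝ≥0∞) : Prop where
  pos : 0 < m t
  ne_top : ∀ k ∈ s, m k ≠ ∞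
  le_mul : ∀ k ∈ s, k ≠ t → m k ≤ δ * m t

lemma Dominates.mono {ι : Type*} {s s' : Set ι} {t : ι} {δ : ℝ≥0∞} {m : ι → ℝ≥0∞}
    (h : Dominates s t δ m) (hs : s' ⊆ s) : Dominates s' t δ m :=
  ⟨h.pos, fun k hk => h.ne_top k (hs hk), fun k hk => h.le_mul k (hs hk)⟩

section Comparison

variable {n p r T₀ : ℕ} {α₁ α₂ a₁ a v b₀ S₀ K M C q ε : ℝ} {X : Matrix (Fin n) (Fin p) ℝ}
  {A : Matrix (Fin p) (Fin p) ℝ} {t k : Model p} {β : Fin p → ℝ} {e : Fin n → ℝ}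

lemma marginal_le_of_tameNoise (hA : ScaleMatrixBound A a₁ a) (ha₁ : 0 < a₁) (ha : 0 < a)
    (hX : EigenBound X ε) (hn : n ≠ 0) (hα₁ : 0 < α₁) (hα₂ : 0 < α₂) (hnε : 128 ≤ n * ε)
    (hβ : ∀ j ∉ t, β j = 0) (he : TameNoise X t v e) (hkt : (k ∪ t).card ≤ n)
    (hB : 0 < rateLower α₂ ε v t k β e) :
    marginal r α₁ α₂ X A k (X *ᵥ β + e) ≤ ENNReal.ofReal (marginalConst n α₁ α₂ *
      (marginalUpper r n (gaussMoment r a) (n * ε / 64) k.card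
          (((n * ε / 64)⁻¹ ^ r) ^ (k \ t).card) *
        (Real.Gamma (n / 2 + α₁) * rateLower α₂ ε v t k β e ^ (-(n / 2 + α₁))))) := by
  rw [← prod_ite_inv_pow k t, ← mul_assoc]
  refine marginal_le hA ha₁ ha hn hα₁ hα₂ (c := fun i => β i) (fun i => ?_) (by linarith) hB
    fun b => le_residual_sum_sq hX hn hnε hkt hβ (add_le_add he.proj (he.resid (k \ t))) b
  split_ifs <;> linarith

lemma le_marginal_of_tameNoise (hA : ScaleMatrixBound A a₁ a) (ha₁ : 0 < a₁) (ha : 0 < a)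
    (hX : EigenBound X ε) (hn : n ≠ 0) (hα₁ : 0 < α₁) (hα₂ : 0 < α₂) (hε : 0 < ε)
    (hβ : SignalBounds t β T₀ b₀ S₀) (hb₀ : 0 < b₀) (hw : (√n)⁻¹ ≤ b₀ / 2)
    (he : TameNoise X t v e) (hB : 0 < rateUpper α₂ ε v a t β e) :
    ENNReal.ofReal (marginalConst n α₁ α₂ *
        (marginalLower r n (gaussMoment r a₁) t.card (√n)⁻¹ (((b₀ / 2) ^ (2 * r)) ^ t.card) *
          (Real.Gamma (n / 2 + α₁ + (r + 1 / 2) * t.card) *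
            rateUpper α₂ ε v a t β e ^ (-(n / 2 + α₁ + (r + 1 / 2) * t.card))))) ≤
      marginal r α₁ α₂ X A t (X *ᵥ β + e) := by
  have hempty : ‖(residualSpan X t ∅).starProjection (WithLp.toLp 2 e)‖ ^ 2 ≤ 0 := by
    simpa using he.resid ∅
  have hprod {b : t → ℝ} (hb : b ∈ Set.Icc (fun i : t => β i) fun i => β i + (√n)⁻¹) :
      ((b₀ / 2) ^ (2 * r)) ^ t.card ≤ ∏ i, b i ^ (2 * r) := by
    simpa only [Fintype.card_coe] using
      pow_card_le_prod_pow_of_mem_Icc r hb₀.le (fun i : t => hβ.le_abs i i.2) hw hb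
  rw [← mul_assoc]
  refine le_marginal hA ha₁ ha hn hα₁ hα₂ (by positivity) (by positivity) hB fun b hb =>
    ⟨residual_sum_sq_le hX hn hε hβ.support ha.le ?_ hb, hprod hb⟩
  linarith [he.proj]

lemma marginal_le_exp_oddsExponent_mul (hA : ScaleMatrixBound A a₁ a) (ha₁ : 0 < a₁)
    (ha : 0 < a) (hX : EigenBound X ε) (hα₁ : 0 < α₁) (hα₂ : 0 < α₂) (hb₀ : 0 < b₀) (hv : 0 < v)
    (hC : LargeConst r T₀ α₁ a v b₀ S₀ K M C) (hn : LargeSample C q ε n)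
    (hβ : SignalBounds t β T₀ b₀ S₀) (he : TameNoise X t v e) (hk : k.card ≤ q) :
    marginal r α₁ α₂ X A k (X *ᵥ β + e) ≤
      ENNReal.ofReal (Real.exp
        (oddsExponent (oddsConst r T₀ a₁ a b₀ (rateConst α₂ v S₀)) r n k.card (k \ t).card
            t.card ε +
          (n / 2 + α₁) * ((rateUpper α₂ ε v a t β e - rateLower α₂ ε v t k β e) /
            rateLower α₂ ε v t k β e))) *
      marginal r α₁ α₂ X A t (X *ᵥ β + e) := by
  have hn0 := hC.ne_zero hn
  have hn640 := hC.le_natCast hn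
  have hM : 1 ≤ rateConst α₂ v S₀ := by unfold rateConst; linarith [hβ.nonneg]
  have hB : 0 < rateLower α₂ ε v t k β e :=
    (le_rateLower hC hn hβ he hα₂.le ha.le hv.le hk).trans_lt' (by positivity)
  have hB' : 0 < rateUpper α₂ ε v a t β e := rateUpper_pos hα₂ hv.le ha.le hn.pos
  have hB'M : rateUpper α₂ ε v a t β e ≤ 4 * rateConst α₂ v S₀ * (n / 2 + α₁ - 1) :=
    calc _ ≤ rateConst α₂ v S₀ * n := rateUpper_le hC hn hβ he hα₂.le ha.le hv.le
      _ ≤ rateConst α₂ v S₀ * (4 * (n / 2 + α₁ - 1)) := by gcongr; linarith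
      _ = _ := by ring
  have hcomp := marginalUpper_mul_Gamma_le (r := r) (n := n) (d := (b₀ / 2) ^ (2 * r)) hn0
    (gaussMoment_pos r ha) (gaussMoment_pos r ha₁) (by positivity) hM hn.pos hn.lt_one
    (Finset.card_le_card (Finset.sdiff_subset (s := k) (t := t))) hβ.card_le
    (N := n / 2 + α₁) (by linarith) hB hB' hB'M
  calc _ ≤ _ := marginal_le_of_tameNoise hA ha₁ ha hX hn0 hα₁ hα₂ (hC.le_mul hn) hβ.support he
        (hC.card_union_le hn hβ.card_le hk) hB
    _ ≤ _ := ENNReal.ofReal_le_ofReal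
        (mul_le_mul_of_nonneg_left hcomp (marginalConst_pos hn0 hα₁ hα₂).le)
    _ = _ := by rw [oddsConst, mul_left_comm, ENNReal.ofReal_mul (Real.exp_pos _).le]
    _ ≤ _ := mul_le_mul_right (le_marginal_of_tameNoise hA ha₁ ha hX hn0 hα₁ hα₂ hn.pos hβ hb₀
        (hC.inv_sqrt_le hn hb₀) he hB') _

lemma log_card_le_log (hC : LargeConst r T₀ α₁ a v b₀ S₀ K M C) (hn : LargeSample C q ε n)
    (hk : k.card ≤ q) : Real.log k.card ≤ Real.log n := by
  rcases k.card.eq_zero_or_pos with h | h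
  · simpa only [h, Nat.cast_zero, Real.log_zero] using Real.log_natCast_nonneg n
  · gcongr
    simpa using hC.card_union_le hn (t := ∅) (by simp) hk

lemma oddsExponent_add_le_of_ssubset (hα₁ : 0 < α₁) (hα₂ : 0 < α₂) (ha : 0 < a) (hv : 0 < v)
    (hr : 1 ≤ r) (hK : 0 ≤ K) (hC : LargeConst r T₀ α₁ a v b₀ S₀ K M C)
    (hn : LargeSample C q ε n) (hβ : SignalBounds t β T₀ b₀ S₀) (he : TameNoise X t v e)
    (hk : k.card ≤ q) (htk : t ⊂ k) :
    oddsExponent K r n k.card (k \ t).card t.card ε +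
        (n / 2 + α₁) * ((rateUpper α₂ ε v a t β e - rateLower α₂ ε v t k β e) /
          rateLower α₂ ε v t k β e) ≤ -(Real.log n / 8) := by
  have hlower := le_rateLower hC hn hβ he hα₂.le ha.le hv.le hk
  have hn640 := hC.le_natCast hn
  have hB : 0 < rateLower α₂ ε v t k β e := hlower.trans_lt' (by positivity)
  have := Real.log_natCast_nonneg n
  have hlogε : 0 ≤ Real.log ε⁻¹ := Real.log_nonneg hn.one_le_inv
  have hN : (n : ℝ) / 2 + α₁ ≤ 65 / 128 * n := by linarith [hC.shape, hn.le_natCast hC.nonneg]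
  have hdrop : (n / 2 + α₁) * (9 / 8 * (v * ((k \ t).card * Real.log n))) ≤
      5 / 4 * (Real.log n * (k \ t).card) * (63 / 128 * (n * v)) := by
    have : 0 ≤ n * (v * ((k \ t).card * Real.log n)) := by positivity
    calc _ ≤ 65 / 128 * n * (9 / 8 * (v * ((k \ t).card * Real.log n))) := by gcongr
      _ ≤ _ := by linarith
  exact oddsExponent_add_le_of_superset hK hr
    (Finset.card_pos.2 (Finset.sdiff_nonempty.2 (not_subset_of_ssubset htk))) hβ.card_le
    (by rw [add_comm, Finset.card_sdiff_add_card_eq_card htk.subset])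
    (log_card_le_log hC hn hk) hlogε
    (le_trans (by gcongr; exact hC.superset) (hn.mul_one_add_log_inv_le hC.nonneg))
    (mul_div_le_of_le_mul hB (by positivity)
      (rateUpper_sub_rateLower_le_of_ssubset hC hn hβ ha.le hv.le htk) hdrop hlower
      (by positivity))

lemma oddsExponent_add_le_of_not_subset (hα₁ : 0 < α₁) (hα₂ : 0 < α₂) (ha : 0 < a)
    (hb₀ : 0 < b₀) (hv : 0 < v) (hK : 0 ≤ K)
    (hC : LargeConst r T₀ α₁ a v b₀ S₀ K (rateConst α₂ v S₀) C) (hn : LargeSample C q ε n)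
    (hβ : SignalBounds t β T₀ b₀ S₀) (he : TameNoise X t v e) (hk : k.card ≤ q)
    (htk : ¬ t ⊆ k) :
    oddsExponent K r n k.card (k \ t).card t.card ε +
        (n / 2 + α₁) * ((rateUpper α₂ ε v a t β e - rateLower α₂ ε v t k β e) /
          rateLower α₂ ε v t k β e) ≤ -(Real.log n / 8) := by
  have hn640 := hC.le_natCast hn
  have hB : 0 < rateLower α₂ ε v t k β e :=
    (le_rateLower hC hn hβ he hα₂.le ha.le hv.le hk).trans_lt' (by positivity)
  have hlogε : 0 ≤ Real.log ε⁻¹ := Real.log_nonneg hn.one_le_inv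
  have hM : 0 < rateConst α₂ v S₀ := by unfold rateConst; linarith [hβ.nonneg]
  have := Real.log_natCast_nonneg n
  have hq := hn.nonneg
  have hε := hn.pos
  have hsignal : (K + (r + 1) * T₀ + 1) * (1 + q) * Real.log n ≤
      n * ε * b₀ ^ 2 / 256 / (2 * rateConst α₂ v S₀) := by
    rw [div_div, le_div_iff₀ (by positivity)]
    calc _ = (K + (r + 1) * T₀ + 1) * (512 * rateConst α₂ v S₀) * ((1 + q) * Real.log n) := by ring
      _ ≤ C * b₀ ^ 2 * ((1 + q) * Real.log n) :=
        mul_le_mul_of_nonneg_right hC.omitted (by positivity)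
      _ = C * ((1 + q) * Real.log n) * b₀ ^ 2 := by ring
      _ ≤ n * ε * b₀ ^ 2 := mul_le_mul_of_nonneg_right hn.le_mul (sq_nonneg _)
  exact oddsExponent_add_le_of_le_neg hK hβ.card_le hk (log_card_le_log hC hn hk)
    (le_trans (le_mul_of_one_le_left (by positivity) hC.one_le)
      (hn.mul_one_add_log_inv_le hC.nonneg)) hsignal
    (mul_div_le_neg_div hM (by positivity) hB (rateLower_le hC hn hβ he hα₂.le hv.le)
      (by linarith) (rateUpper_sub_rateLower_le_of_not_subset hC hn hβ ha.le hv.le hb₀.le hk htk))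

lemma dominates_marginal_of_tameNoise (hA : ScaleMatrixBound A a₁ a) (ha₁ : 0 < a₁) (ha : 0 < a)
    (hX : EigenBound X ε) (hα₁ : 0 < α₁) (hα₂ : 0 < α₂) (hb₀ : 0 < b₀) (hv : 0 < v) (hr : 1 ≤ r)
    (hC : LargeConst r T₀ α₁ a v b₀ S₀ (oddsConst r T₀ a₁ a b₀ (rateConst α₂ v S₀))
      (rateConst α₂ v S₀) C)
    (hn : LargeSample C q ε n) (hβ : SignalBounds t β T₀ b₀ S₀) (he : TameNoise X t v e) :
    Dominates {k | (k.card : ℝ) ≤ q} t (ENNReal.ofReal (Real.exp (-(Real.log n / 8))))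
      fun k => marginal r α₁ α₂ X A k (X *ᵥ β + e) := by
  have hn0 := hC.ne_zero hn
  have := hC.le_natCast hn
  have hK : 0 ≤ oddsConst r T₀ a₁ a b₀ (rateConst α₂ v S₀) :=
    add_nonneg (upperConst_nonneg _ _)
      (lowerConst_nonneg _ _ _ _ (by unfold rateConst; linarith [hβ.nonneg]))
  have hB' : 0 < rateUpper α₂ ε v a t β e := rateUpper_pos hα₂ hv.le ha.le hn.pos
  refine ⟨(ENNReal.ofReal_pos.2 ?_).trans_le (le_marginal_of_tameNoise hA ha₁ ha hX hn0 hα₁ hα₂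
    hn.pos hβ hb₀ (hC.inv_sqrt_le hn hb₀) he hB'), fun k hk => ?_, fun k hk hkt => ?_⟩
  · have hconst := marginalConst_pos hn0 hα₁ hα₂
    have hmarg := marginalLower_pos (r := r) (m := t.card) hn0 (gaussMoment_pos r ha₁)
      (by positivity : 0 < (√n)⁻¹) (by positivity : 0 < ((b₀ / 2) ^ (2 * r)) ^ t.card)
    have := Real.Gamma_pos_of_pos
      (by positivity : 0 < n / 2 + α₁ + (r + 1 / 2) * (t.card : ℝ))
    positivity
  · exact ((marginal_le_of_tameNoise hA ha₁ ha hX hn0 hα₁ hα₂ (hC.le_mul hn) hβ.support he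
      (hC.card_union_le hn hβ.card_le hk)
      ((le_rateLower hC hn hβ he hα₂.le ha.le hv.le hk).trans_lt' (by positivity))).trans_lt
      ENNReal.ofReal_lt_top).ne
  · refine (marginal_le_exp_oddsExponent_mul hA ha₁ ha hX hα₁ hα₂ hb₀ hv hC hn hβ he hk).trans
      (mul_le_mul_left (ENNReal.ofReal_le_ofReal (Real.exp_le_exp.2 ?_)) _)
    by_cases htk : t ⊆ k
    · exact oddsExponent_add_le_of_ssubset hα₁ hα₂ ha hv hr hK hC hn hβ he hk
        (htk.ssubset_of_ne hkt.symm)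
    · exact oddsExponent_add_le_of_not_subset hα₁ hα₂ ha hb₀ hv hK hC hn hβ he hk htk

end Comparison

/-! ### Posterior consistency -/

lemma mul_log_isLittleO {f ε : ℕ → ℝ} {ξ : ℝ} (hf : f =O[atTop] fun n : ℕ => (n : ℝ) ^ ξ)
    (hξ : ξ < 1) (hε : ∀ᶠ n in atTop, 0 < ε n)
    (hεo : (fun n => (ε n)⁻¹) =o[atTop] fun n : ℕ => Real.log n) :
    (fun n : ℕ => f n * Real.log n) =o[atTop] fun n : ℕ => n * ε n := by
  have hone : (fun _ : ℕ => (1 : ℝ)) =O[atTop] fun n : ℕ => Real.log n * ε n :=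
    (hεo.isBigO.mul (isBigO_refl ε atTop)).congr' (hε.mono fun n hn => inv_mul_cancel₀ hn.ne')
      EventuallyEq.rfl
  have hlog : (fun n : ℕ => Real.log n ^ (2 : ℝ)) =o[atTop] fun n : ℕ => (n : ℝ) ^ (1 - ξ) :=
    (isLittleO_log_rpow_rpow_atTop 2 (sub_pos.2 hξ)).comp_tendsto tendsto_natCast_atTop_atTop
  have hprod : (fun n : ℕ => f n * Real.log n ^ (2 : ℝ)) =o[atTop] fun n : ℕ => (n : ℝ) := by
    refine (hf.mul_isLittleO hlog).congr' EventuallyEq.rfl ?_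
    filter_upwards [eventually_gt_atTop 0] with n hn
    rw [← Real.rpow_add (Nat.cast_pos.2 hn), add_sub_cancel, Real.rpow_one]
  calc (fun n : ℕ => f n * Real.log n)
      =O[atTop] fun n : ℕ => f n * Real.log n ^ (2 : ℝ) * ε n :=
        (((isBigO_refl (fun n : ℕ => f n * Real.log n) atTop).mul hone).congr
          (fun n => mul_one _) fun n => by rw [Real.rpow_two]; ring)
    _ =o[atTop] fun n : ℕ => n * ε n := hprod.mul_isBigO (isBigO_refl ε atTop)

lemma eventually_largeSample {ε q : ℕ → ℝ} (hε : ∀ᶠ n in atTop, 0 < ε n ∧ ε n < 1)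
    (hεo : (fun n => (ε n)⁻¹) =o[atTop] fun n : ℕ => Real.log n)
    (hq : (fun n : ℕ => q n * Real.log n) =o[atTop] fun n : ℕ => n * ε n) {C : ℝ} (hC : 0 < C) :
    ∀ᶠ n in atTop, LargeSample C |q n| (ε n) n := by
  have hlog : (fun n : ℕ => 1 * Real.log n) =o[atTop] fun n : ℕ => n * ε n :=
    mul_log_isLittleO (ξ := 0) (f := fun _ => 1) (by
      simpa only [Real.rpow_zero] using isBigO_refl (fun _ : ℕ => (1 : ℝ)) atTop) one_pos
      (hε.mono fun _ h => h.1) hεo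
  have hsize : (fun n : ℕ => (1 + |q n|) * Real.log n) =o[atTop] fun n : ℕ => n * ε n :=
    (hlog.add hq.abs_left).congr_left fun n => by
      rw [abs_mul, abs_of_nonneg (Real.log_natCast_nonneg n)]; ring
  have hinv : (fun n => 1 + (ε n)⁻¹) =o[atTop] fun n : ℕ => Real.log n :=
    ((Real.isLittleO_const_log_atTop (c := 1)).comp_tendsto tendsto_natCast_atTop_atTop).add hεo
  filter_upwards [hε, eventually_le_mul_of_isLittleO hsize
    (hε.mono fun n hn => mul_nonneg n.cast_nonneg hn.1.le) (inv_pos.2 hC),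
    eventually_le_mul_of_isLittleO hinv (.of_forall Real.log_natCast_nonneg) (inv_pos.2 hC)]
    with n hε hsize hinv
  exact ⟨hε.1, hε.2, abs_nonneg _, (le_inv_mul_iff₀ hC).1 hsize, (le_inv_mul_iff₀ hC).1 hinv⟩

lemma exists_signalBounds {t : Finset ℕ} {β₀ : ℕ → ℝ} (hβ₀ : ∀ j, β₀ j ≠ 0 ↔ j ∈ t) :
    ∃ b₀ > 0, ∀ p, SignalBounds (trueModel t p) (fun i => β₀ i) t.card b₀ (∑ j ∈ t, β₀ j ^ 2) := by
  obtain ⟨b₀, hb₀, hmin⟩ : ∃ b₀ > 0, ∀ j ∈ t, b₀ ≤ |β₀ j| := by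
    rcases t.eq_empty_or_nonempty with rfl | ht
    · exact ⟨1, one_pos, by simp⟩
    · obtain ⟨i, hi, hmin⟩ := t.exists_min_image (fun j => |β₀ j|) ht
      exact ⟨|β₀ i|, abs_pos.2 ((hβ₀ i).2 hi), hmin⟩
  have hzero {j : ℕ} (hj : j ∉ t) : β₀ j = 0 := not_not.1 (mt (hβ₀ j).1 hj)
  refine ⟨b₀, hb₀, fun p => ⟨fun j hj => hzero (mt mem_trueModel.2 hj),
    fun j hj => hmin j (mem_trueModel.1 hj), card_trueModel_le t p, ?_⟩⟩
  calc ∑ i : Fin p, β₀ i ^ 2 = ∑ j ∈ Finset.range p, β₀ j ^ 2 :=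
        Fin.sum_univ_eq_sum_range (fun j => β₀ j ^ 2) p
    _ = ∑ j ∈ Finset.range p with j ∈ t, β₀ j ^ 2 :=
        (Finset.sum_filter_of_ne fun j _ hj => by
          by_contra h
          simp [hzero h] at hj).symm
    _ ≤ ∑ j ∈ t, β₀ j ^ 2 := Finset.sum_le_sum_of_subset_of_nonneg
        (fun j hj => (Finset.mem_filter.1 hj).2) fun _ _ _ => sq_nonneg _

lemma eventually_dominates_marginal {r : ℕ} (hr : 1 ≤ r) {α₁ α₂ : ℝ} (hα₁ : 0 < α₁)
    (hα₂ : 0 < α₂) {p : ℕ → ℕ} {X : ∀ n, Matrix (Fin n) (Fin (p n)) ℝ}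
    {A : ∀ n, Matrix (Fin (p n)) (Fin (p n)) ℝ} {t : Finset ℕ} {β₀ : ℕ → ℝ}
    (hβ₀ : ∀ j, β₀ j ≠ 0 ↔ j ∈ t) {v : ℝ} (hv : 0 < v) {ε q : ℕ → ℝ}
    (hε : ∀ᶠ n in atTop, 0 < ε n ∧ ε n < 1)
    (hεo : (fun n => (ε n)⁻¹) =o[atTop] fun n : ℕ => Real.log n)
    (hX : ∀ᶠ n in atTop, EigenBound (X n) (ε n))
    (hq : (fun n : ℕ => q n * Real.log n) =o[atTop] fun n : ℕ => n * ε n)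
    {a₁ a₂ : ℝ} (ha₁ : 0 < a₁) (hA : ∀ᶠ n in atTop, ScaleMatrixBound (A n) a₁ a₂) :
    ∀ᶠ n in atTop, ∀ e : Fin n → ℝ, TameNoise (X n) (trueModel t (p n)) v e →
      Dominates {k | (k.card : ℝ) ≤ q n} (trueModel t (p n))
        (ENNReal.ofReal (Real.exp (-(Real.log n / 8))))
        fun k => marginal r α₁ α₂ (X n) (A n) k (response (X n) β₀ e) := by
  obtain ⟨b₀, hb₀, hsignal⟩ := exists_signalBounds hβ₀
  have ha : 0 < max a₂ 1 := lt_max_of_lt_right one_pos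
  obtain ⟨C, hC⟩ := exists_largeConst r t.card α₁ (max a₂ 1) (∑ j ∈ t, β₀ j ^ 2)
    (oddsConst r t.card a₁ (max a₂ 1) b₀ (rateConst α₂ v (∑ j ∈ t, β₀ j ^ 2)))
    (rateConst α₂ v (∑ j ∈ t, β₀ j ^ 2)) hv hb₀
  filter_upwards [hX, hA, eventually_largeSample hε hεo hq (zero_lt_one.trans_le hC.one_le)]
    with n hX hA hn e he
  exact (dominates_marginal_of_tameNoise (hA.mono (le_max_left _ _)) ha₁ ha hX hα₁ hα₂ hb₀ hv hr
    hC hn (hsignal (p n)) he).mono fun k hk => le_trans hk (le_abs_self (q n))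

lemma isLittleO_log_of_isBigO_log_rpow {f : ℕ → ℝ} {a : ℝ} (ha : a < 1)
    (hf : f =O[atTop] fun n : ℕ => Real.log n ^ a) : f =o[atTop] fun n : ℕ => Real.log n := by
  refine hf.trans_isLittleO (isLittleO_of_tendsto' ?_ ?_)
  · filter_upwards [tendsto_log_natCast.eventually_gt_atTop 0] with n hn h0
    exact absurd h0 hn.ne'
  · refine ((tendsto_rpow_neg_atTop (sub_pos.2 ha)).comp tendsto_log_natCast).congr' ?_
    filter_upwards [tendsto_log_natCast.eventually_gt_atTop 0] with n hn
    rw [Function.comp_apply, neg_sub, Real.rpow_sub_one hn.ne']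

lemma tendsto_ofReal_exp_neg_log_div :
    Tendsto (fun n : ℕ => ENNReal.ofReal (Real.exp (-(Real.log n / 8)))) atTop (𝓝 0) := by
  rw [← ENNReal.ofReal_zero]
  exact ENNReal.tendsto_ofReal (Real.tendsto_exp_neg_atTop_nhds_zero.comp
    (tendsto_log_natCast.atTop_div_const (by norm_num)))

lemma prior_le_of_lt_div {ι : Type*} {prior : PMF ι} {t : ι} {c : ℝ≥0∞} (hc : c ≠ 0)
    (hc' : c ≠ ∞) (hprior : ∀ k, 0 < prior k → c < prior t / prior k) (k : ι) :
    prior k ≤ c⁻¹ * prior t := by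
  rcases eq_zero_or_pos (prior k) with hk | hk
  · exact hk.trans_le zero_le
  · have hmul := (ENNReal.le_div_iff_mul_le (.inl hk.ne') (.inl (prior.apply_ne_top k))).1
      (hprior k hk).le
    rwa [mul_comm c⁻¹, ← div_eq_mul_inv, ENNReal.le_div_iff_mul_le (.inl hc) (.inl hc'), mul_comm]

lemma Dominates.posterior {n p r : ℕ} {α₁ α₂ : ℝ} {X : Matrix (Fin n) (Fin p) ℝ}
    {A : Matrix (Fin p) (Fin p) ℝ} {prior : PMF (Model p)} {y : Fin n → ℝ} {t : Model p}
    {s : Set (Model p)} {δ c : ℝ≥0∞}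
    (h : Dominates s t δ fun k => marginal r α₁ α₂ X A k y) (hs : ∀ k ∉ s, prior k = 0)
    (hc : c ≠ 0) (hc' : c ≠ ∞) (hprior : ∀ k, 0 < prior k → c < prior t / prior k) :
    Dominates Set.univ t (c⁻¹ * δ) (posterior r α₁ α₂ X A prior y) := by
  have hprior' := prior_le_of_lt_div hc hc' hprior
  have ht : prior t ≠ 0 := fun ht => by
    obtain ⟨k, hk⟩ := prior.support_nonempty
    exact hk (nonpos_iff_eq_zero.1 (by simpa [ht] using hprior' k))
  have hterm (k : Model p) : prior k * marginal r α₁ α₂ X A k y ≠ ∞ := by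
    by_cases hk : k ∈ s
    · exact ENNReal.mul_ne_top (prior.apply_ne_top k) (h.ne_top k hk)
    · simp [hs k hk]
  have hnum : prior t * marginal r α₁ α₂ X A t y ≠ 0 := mul_ne_zero ht h.pos.ne'
  have hsum_ne_top : ∑ j, prior j * marginal r α₁ α₂ X A j y ≠ ∞ :=
    ENNReal.sum_ne_top.2 fun j _ => hterm j
  have hsum_ne_zero : ∑ j, prior j * marginal r α₁ α₂ X A j y ≠ 0 := fun hsum =>
    hnum (Finset.sum_eq_zero_iff.1 hsum t (Finset.mem_univ t))
  refine ⟨ENNReal.div_pos hnum hsum_ne_top, fun k _ => ENNReal.div_ne_top (hterm k) hsum_ne_zero,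
    fun k _ hkt => ?_⟩
  rw [HyperPMOM.posterior, HyperPMOM.posterior, ← mul_div_assoc]
  refine ENNReal.div_le_div_right ?_ _
  by_cases hk : k ∈ s
  · calc prior k * marginal r α₁ α₂ X A k y
        ≤ (c⁻¹ * prior t) * (δ * marginal r α₁ α₂ X A t y) :=
          mul_le_mul' (hprior' k) (h.le_mul k hk hkt)
      _ = c⁻¹ * δ * (prior t * marginal r α₁ α₂ X A t y) := by ring
  · simp [hs k hk]

section Mode

variable {p : ℕ} {t : Model p} {θ : ℝ≥0∞} {post : Model p → ℝ≥0∞}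

lemma Dominates.maxRatio_le (h : Dominates Set.univ t θ post) : maxRatio post t ≤ θ :=
  iSup₂_le fun k hk => ENNReal.div_le_of_le_mul (h.le_mul k trivial hk)

lemma Dominates.isUniqueMode (h : Dominates Set.univ t θ post) (hθ : θ < 1) :
    IsUniqueMode post t := fun k hk =>
  calc post k ≤ θ * post t := h.le_mul k trivial hk
    _ < 1 * post t := ENNReal.mul_lt_mul_left h.pos.ne' (h.ne_top t trivial) hθ
    _ = post t := one_mul _

end Mode

section Consistency

variable {Ω : Type*} [MeasurableSpace Ω] {P : Measure Ω} {p : ℕ → ℕ} {t : ∀ n, Model (p n)}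
  {θ : ℕ → ℝ≥0∞} {post : ∀ n, Ω → Model (p n) → ℝ≥0∞} {good : ℕ → Ω → Prop}

lemma tendsto_measure_le_maxRatio (hgood : Tendsto (fun n => P {ω | ¬ good n ω}) atTop (𝓝 0))
    (hθ : Tendsto θ atTop (𝓝 0))
    (hpost : ∀ᶠ n in atTop, ∀ ω, good n ω → Dominates Set.univ (t n) (θ n) (post n ω))
    {η : ℝ≥0∞} (hη : 0 < η) :
    Tendsto (fun n => P {ω | η ≤ maxRatio (post n ω) (t n)}) atTop (𝓝 0) := by
  refine tendsto_of_tendsto_of_tendsto_of_le_of_le' tendsto_const_nhds hgood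
    (.of_forall fun _ => zero_le) ?_
  filter_upwards [hpost, hθ.eventually_lt_const hη] with n hpost hθη
  exact measure_mono fun ω hω hn => (hω.trans (hpost ω hn).maxRatio_le).not_gt hθη

lemma tendsto_measure_isUniqueMode [IsProbabilityMeasure P]
    (hgood : Tendsto (fun n => P {ω | ¬ good n ω}) atTop (𝓝 0)) (hθ : Tendsto θ atTop (𝓝 0))
    (hpost : ∀ᶠ n in atTop, ∀ ω, good n ω → Dominates Set.univ (t n) (θ n) (post n ω)) :
    Tendsto (fun n => P {ω | IsUniqueMode (post n ω) (t n)}) atTop (𝓝 1) := by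
  have hlim : Tendsto (fun n => 1 - P {ω | ¬ good n ω}) atTop (𝓝 1) := by
    simpa only [tsub_zero] using
      ENNReal.Tendsto.sub tendsto_const_nhds hgood (.inl ENNReal.one_ne_top)
  refine tendsto_of_tendsto_of_tendsto_of_le_of_le' hlim tendsto_const_nhds ?_
    (.of_forall fun _ => prob_le_one)
  filter_upwards [hpost, hθ.eventually_lt_const one_pos] with n hpost hθ
  rw [tsub_le_iff_right]
  calc 1 = P Set.univ := measure_univ.symm
    _ ≤ P ({ω | IsUniqueMode (post n ω) (t n)} ∪ {ω | ¬ good n ω}) := measure_mono fun ω _ =>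
        (em (good n ω)).imp (fun hω => (hpost ω hω).isUniqueMode hθ) id
    _ ≤ _ := measure_union_le _ _

end Consistency

end HyperPMOM

end

theorem theorem1_general
    {Ω : Type*} [MeasurableSpace Ω] (P : Measure Ω) [IsProbabilityMeasure P]
    (r : ℕ) (hr : 1 ≤ r) (α₁ α₂ : ℝ) (hα₁ : 0 < α₁) (hα₂ : 0 < α₂)
    (p : ℕ → ℕ) (X : ∀ n, Matrix (Fin n) (Fin (p n)) ℝ)
    (A : ∀ n, Matrix (Fin (p n)) (Fin (p n)) ℝ)
    (prior : ∀ n, PMF (HyperPMOM.Model (p n)))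
    (t : Finset ℕ) (β₀ : ℕ → ℝ) (hβ₀ : ∀ j, β₀ j ≠ 0 ↔ j ∈ t)
    (σ₀sq : ℝ≥0) (hσ₀ : 0 < σ₀sq)
    (noise : ∀ n, Fin n → Ω → ℝ)
    (hlaw : ∀ n i, HasLaw (noise n i) (gaussianReal 0 σ₀sq) P)
    (hindep : ∀ n, iIndepFun (noise n) P)
    (ε : ℕ → ℝ) (hε : ∀ᶠ n in atTop, 0 < ε n ∧ ε n < 1)
    (hεo : (fun n => (ε n)⁻¹) =o[atTop] fun n : ℕ => Real.log n)
    (hX : ∀ᶠ n in atTop, HyperPMOM.EigenBound (X n) (ε n))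
    (q : ℕ → ℝ) (hq : (fun n : ℕ => q n * Real.log n) =o[atTop] fun n : ℕ => n * ε n)
    (hsize : ∀ᶠ n in atTop, ∀ k, q n < (k.card : ℝ) → prior n k = 0)
    (c : ℝ) (hc : 0 < c)
    (hprior : ∀ᶠ n in atTop, ∀ k, 0 < prior n k →
      ENNReal.ofReal c < prior n (HyperPMOM.trueModel t (p n)) / prior n k)
    (a₁ a₂ : ℝ) (ha₁ : 0 < a₁)
    (hA : ∀ᶠ n in atTop, HyperPMOM.ScaleMatrixBound (A n) a₁ a₂) :
    (∀ η : ℝ≥0∞, 0 < η → Tendsto (fun n => P {ω | η ≤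
        HyperPMOM.maxRatio
          (HyperPMOM.posterior r α₁ α₂ (X n) (A n) (prior n)
            (HyperPMOM.response (X n) β₀ fun i => noise n i ω))
          (HyperPMOM.trueModel t (p n))}) atTop (𝓝 0)) ∧
      Tendsto (fun n => P {ω |
        HyperPMOM.IsUniqueMode
          (HyperPMOM.posterior r α₁ α₂ (X n) (A n) (prior n)
            (HyperPMOM.response (X n) β₀ fun i => noise n i ω))
          (HyperPMOM.trueModel t (p n))}) atTop (𝓝 1) := by
  have hc' : ENNReal.ofReal c ≠ 0 := (ENNReal.ofReal_pos.2 hc).ne'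
  have htame := HyperPMOM.tendsto_measure_not_tameNoise t hσ₀ hlaw hindep
    (hε.mono fun _ h => h.1) hεo hX
  have hθ := ENNReal.Tendsto.const_mul HyperPMOM.tendsto_ofReal_exp_neg_log_div
    (.inr (ENNReal.inv_ne_top.2 hc'))
  rw [mul_zero] at hθ
  have hpost : ∀ᶠ n in atTop, ∀ ω,
      HyperPMOM.TameNoise (X n) (HyperPMOM.trueModel t (p n)) σ₀sq (fun i => noise n i ω) →
      HyperPMOM.Dominates Set.univ (HyperPMOM.trueModel t (p n))
        ((ENNReal.ofReal c)⁻¹ * ENNReal.ofReal (Real.exp (-(Real.log n / 8))))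
        (HyperPMOM.posterior r α₁ α₂ (X n) (A n) (prior n)
          (HyperPMOM.response (X n) β₀ fun i => noise n i ω)) := by
    filter_upwards [HyperPMOM.eventually_dominates_marginal hr hα₁ hα₂ hβ₀ (v := σ₀sq) hσ₀ hε hεo
      hX hq ha₁ hA, hsize, hprior] with n hmarg hsize hprior ω hω
    exact (hmarg _ hω).posterior (fun k hk => hsize k (not_le.1 hk)) hc' ENNReal.ofReal_ne_top
      hprior
  exact ⟨fun η hη => HyperPMOM.tendsto_measure_le_maxRatio htame hθ hpost hη,
    HyperPMOM.tendsto_measure_isUniqueMode htame hθ hpost⟩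

theorem theorem1
    {Ω : Type*} [MeasurableSpace Ω] (P : Measure Ω) [IsProbabilityMeasure P]
    -- hyperparameters of the hierarchical model
    (r : ℕ) (hr : 1 ≤ r) (α₁ α₂ : ℝ) (hα₁ : 0 < α₁) (hα₂ : 0 < α₂)
    -- dimensions, designs, scale matrices and model priors, one for each sample size
    (p : ℕ → ℕ) (X : ∀ n, Matrix (Fin n) (Fin (p n)) ℝ)
    (A : ∀ n, Matrix (Fin (p n)) (Fin (p n)) ℝ)
    (prior : ∀ n, PMF (HyperPMOM.Model (p n)))
    -- the truth: fixed support, coefficients and error variance; i.i.d. Gaussian errors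
    (t : Finset ℕ) (β₀ : ℕ → ℝ) (hβ₀ : ∀ j, β₀ j ≠ 0 ↔ j ∈ t)
    (htp : ∀ᶠ n in atTop, ∀ j ∈ t, j < p n)
    (σ₀sq : ℝ≥0) (hσ₀ : 0 < σ₀sq)
    (noise : ∀ n, Fin n → Ω → ℝ)
    (hlaw : ∀ n i, HasLaw (noise n i) (gaussianReal 0 σ₀sq) P)
    (hindep : ∀ n, iIndepFun (noise n) P)
    -- eigenvalues of the Gram matrices
    (ε : ℕ → ℝ) (hε : ∀ᶠ n in atTop, 0 < ε n ∧ ε n < 1)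
    (hεO : (fun n => (ε n)⁻¹) =O[atTop] fun n : ℕ => Real.log n ^ (1 / 8 : ℝ))
    (hX : ∀ᶠ n in atTop, HyperPMOM.EigenBound (X n) (ε n))
    -- no prior mass on large models
    (q : ℕ → ℝ) (ξ : ℝ) (hξ : ξ < 1)
    (hq : q =O[atTop] fun n : ℕ => (n : ℝ) ^ ξ)
    (hsize : ∀ᶠ n in atTop, ∀ k, q n < (k.card : ℝ) → prior n k = 0)
    -- prior ratios bounded below
    (c : ℝ) (hc : 0 < c)
    (hprior : ∀ᶠ n in atTop, ∀ k, 0 < prior n k →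
      ENNReal.ofReal c < prior n (HyperPMOM.trueModel t (p n)) / prior n k)
    -- eigenvalues of the scale matrices
    (a₁ a₂ : ℝ) (ha₁ : 0 < a₁)
    (hA : ∀ᶠ n in atTop, HyperPMOM.ScaleMatrixBound (A n) a₁ a₂) :
    (∀ η : ℝ≥0∞, 0 < η → Tendsto (fun n => P {ω | η ≤
        HyperPMOM.maxRatio
          (HyperPMOM.posterior r α₁ α₂ (X n) (A n) (prior n)
            (HyperPMOM.response (X n) β₀ fun i => noise n i ω))
          (HyperPMOM.trueModel t (p n))}) atTop (𝓝 0)) ∧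
      Tendsto (fun n => P {ω |
        HyperPMOM.IsUniqueMode
          (HyperPMOM.posterior r α₁ α₂ (X n) (A n) (prior n)
            (HyperPMOM.response (X n) β₀ fun i => noise n i ω))
          (HyperPMOM.trueModel t (p n))}) atTop (𝓝 1) := by
  have hεo := HyperPMOM.isLittleO_log_of_isBigO_log_rpow (by norm_num) hεO
  exact theorem1_general P r hr α₁ α₂ hα₁ hα₂ p X A prior t β₀ hβ₀ σ₀sq hσ₀ noise hlaw hindep ε hε
    hεo hX q (HyperPMOM.mul_log_isLittleO hq hξ (hε.mono fun _ h => h.1) hεo) hsize c hc hprior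
    a₁ a₂ ha₁ hA
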